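/- Let $M$ be a finite-dimensional smooth manifold (possibly with boundary or corners), let $\mathfrak g$ be a real Lie algebra (finite-dimensional, or more generally normed with continuous bracket), let $n\ge 0$, and let $\langle\cdots\rangle:\mathfrak g^{n+1}\to V$ be a continuous symmetric multilinear map with values in a Banach space $V$ (for instance $\mathbb R$ or $\mathbb C$) which is invariant: $\sum_{i}\langle Z_1,\dots,[Y,Z_i],\dots,Z_{n+1}\rangle=0$ for all $Y,Z_1,\dots,Z_{n+1}\in\mathfrak g$. A connection is a smooth $\mathfrak g$-valued 1-form $A$ on $M$; its curvature is $F=\mathrm dA+A^2$ with $A^2=\tfrac12[A,A]$. Inside $\langle\cdots\rangle$ forms are multiplied by the exterior product. **Triangle identity.** For two connections let $$Q^{(2n+1)}_{A_1\leftarrow A_0}=(n+1)\int_0^1 dt\,\langle (A_1-A_0)F_t^{\,n}\rangle ,$$ where $F_t$ is the curvature of $A_0+t(A_1-A_0)$. Let $n\ge 1$, and for three connections let $$Q^{(2n)}_{A_2\leftarrow A_1\leftarrow A_0}=n(n+1)\int_0^1dt\int_0^t ds\,\langle (A_2-A_1)(A_1-A_0)F_{st}^{\,n-1}\rangle ,$$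 where $F_{st}$ is the curvature of $A_0+s(A_2-A_1)+t(A_1-A_0)$. Then $$Q^{(2n+1)}_{A_2\leftarrow A_0}=Q^{(2n+1)}_{A_2\leftarrow A_1}+Q^{(2n+1)}_{A_1\leftarrow A_0}+\mathrm d\,Q^{(2n)}_{A_2\leftarrow A_1\leftarrow A_0},$$ and $Q^{(2n)}_{A_2\leftarrow A_1\leftarrow A_0}=\int_{T_2}\frac{l_t^2}{2}\langle F_t^{\,n+1}\rangle$ in the notation below, for the simplex $T_2=(A_0A_1A_2)$. **Restricted extended Cartan homotopy formula.** Let $n\ge 0$, $0\le p\le 2n+2$, and let $A_0,\dots,A_{p+1}$ be connections. On the simplex $T_{p+1}=\{t\in\mathbb R^{p+2}:t^i\ge0,\ \sum_i t^i=1\}$, oriented by $dt^1\cdots dt^{p+1}$, put $A_t=\sum_i t^iA_i$, let $F_t$ be its curvature for fixed $t$, and let $\mathrm d_t$ be the exterior derivative in the variables $t$. Let $l_t$ be the derivation on formal polynomials in the even symbols $F_t$ and $\mathrm d_tA_t$ with $l_tF_t=\mathrm d_tA_t$ and $l_t\mathrm d_tA_t=0$; such polynomials are evaluated as forms on $M\times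 T_{p+1}$. A form $dt^{1}\cdots dt^{q}\,\beta_t$, with the differentials of the $q$-simplex written first, is integrated to the form $\int\beta_t\,dt$ on $M$, and $\partial T_{p+1}=\sum_j(-1)^j(A_0\cdots\widehat{A_j}\cdots A_{p+1})$. Then $$\int_{\partial T_{p+1}}\frac{l_t^{p}}{p!}\langle F_t^{\,n+1}\rangle=(-1)^p\,\mathrm d\int_{T_{p+1}}\frac{l_t^{p+1}}{(p+1)!}\langle F_t^{\,n+1}\rangle ,$$ where for $p=2n+2$ the right-hand side, the derivative of a form of degree $-1$, is zero. -/

import Mathlib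

open scoped ContDiff

noncomputable section

/-! ### Lie algebras with a topology -/

/-- A Lie ring whose additive group carries a norm. -/
class NormedLieRing (L : Type*) extends NormedAddCommGroup L, LieRing L

/-- A real Lie algebra on a normed space, with continuous bracket. Every finite-dimensional real
(or complex) Lie algebra is one, for any choice of norm. -/
class NormedLieAlgebra (L : Type*) [NormedLieRing L] extends NormedSpace ℝ L, LieAlgebra ℝ L where
  continuous_lie : Continuous fun p : L × L => ⁅p.1, p.2⁆

/-! ### Invariant symmetric tensors -/

section Tensor

variable {L V : Type*} [NormedLieRing L] [NormedLieAlgebra L]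
  [NormedAddCommGroup V] [NormedSpace ℝ V]

/-- `⟨Z_{σ 1}, …, Z_{σ r}⟩ = ⟨Z_1, …, Z_r⟩` for all permutations `σ`. -/
def IsSymmetricTensor {r : ℕ} (f : L [×r]→L[ℝ] V) : Prop :=
  ∀ (σ : Equiv.Perm (Fin r)) (Z : Fin r → L), f (fun i => Z (σ i)) = f Z

/-- `⟨[Y, Z_1], Z_2, …, Z_r⟩ + … + ⟨Z_1, …, Z_{r-1}, [Y, Z_r]⟩ = 0`. -/
def IsInvariantTensor {r : ℕ} (f : L [×r]→L[ℝ] V) : Prop :=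
  ∀ (Y : L) (Z : Fin r → L), ∑ i, f (Function.update Z i ⁅Y, Z i⁆) = 0

end Tensor

/-! ### Multilinear algebra of forms at a point -/

section Pointwise

variable {W L V : Type*} [NormedAddCommGroup W] [NormedSpace ℝ W]
  [NormedLieRing L] [NormedLieAlgebra L] [NormedAddCommGroup V] [NormedSpace ℝ V]

/-- A homogeneous `L`-valued exterior form on `W`, together with its degree. -/
abbrev HomForm (W L : Type*) [NormedAddCommGroup W] [NormedSpace ℝ W]
    [NormedLieRing L] [NormedLieAlgebra L] : Type _ :=
  Σ k : ℕ, W [⋀^Fin k]→L[ℝ] L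

/-- `(v_1, …, v_N) ↦ ⟨α_1(v_1, …, v_{k_1}), α_2(v_{k_1 + 1}, …), …⟩`, with `N = k_1 + ⋯ + k_r`. -/
def blockPairing {r N : ℕ} (f : L [×r]→L[ℝ] V) (α : Fin r → HomForm W L)
    (h : ∑ i, (α i).1 = N) : ContinuousMultilinearMap ℝ (fun _ : Fin N => W) V where
  toMultilinearMap :=
    (f.toMultilinearMap.compMultilinearMap fun i => (α i).2.toMultilinearMap).domDomCongr
      (finSigmaFinEquiv.trans (finCongr h))
  cont := f.cont.comp <| continuous_pi fun i =>
    (α i).2.cont.comp <| continuous_pi fun j =>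
      continuous_apply ((finSigmaFinEquiv.trans (finCongr h)) ⟨i, j⟩)

/-- The form `⟨α_1 α_2 ⋯ α_r⟩`: exterior product of the form parts, `⟨⋯⟩` applied to the values,
`⟨α_1 ⋯ α_r⟩(v) = 1 / (k_1! ⋯ k_r!) ∑_σ sgn σ ⟨α_1(v_{σ 1}, …, v_{σ k_1}), α_2(…), …⟩`. -/
def wedgePairing {r N : ℕ} (f : L [×r]→L[ℝ] V) (α : Fin r → HomForm W L)
    (h : ∑ i, (α i).1 = N) : W [⋀^Fin N]→L[ℝ] V :=
  (∏ i, ((α i).1.factorial : ℝ))⁻¹ • ContinuousMultilinearMap.alternatization (blockPairing f α h)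

/-- The 2-form `A² = ½ [A, A]` of a 1-form `A`: `A²(u, v) = [A(u), A(v)]`. -/
def squareForm (A : W [⋀^Fin 1]→L[ℝ] L) : W [⋀^Fin 2]→L[ℝ] L where
  toFun v := ⁅A fun _ => v 0, A fun _ => v 1⁆
  map_update_add' := by
    intro _ m i x y
    have e : ∀ a b : W, (A fun _ => a + b) = (A fun _ => a) + A fun _ => b := fun a b => by
      have := A.map_update_add (fun _ => 0) 0 a b
      have u : ∀ c : W, Function.update (fun _ : Fin 1 => (0 : W)) 0 c = fun _ => c := fun c => by
        ext i; fin_cases i; simp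
      simpa only [u] using this
    fin_cases i <;> simp [e]
  map_update_smul' := by
    intro _ m i c x
    have e : ∀ (c : ℝ) (a : W), (A fun _ => c • a) = c • (A fun _ => a) := fun c a => by
      have := A.map_update_smul (fun _ => 0) 0 c a
      have u : ∀ c : W, Function.update (fun _ : Fin 1 => (0 : W)) 0 c = fun _ => c := fun c => by
        ext i; fin_cases i; simp
      simpa only [u] using this
    fin_cases i <;> simp [e]
  map_eq_zero_of_eq' := by
    intro v i j hv hij
    have h01 : v 0 = v 1 := by
      fin_cases i <;> fin_cases j <;> simp_all
    simp [h01]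
  cont := NormedLieAlgebra.continuous_lie.comp <|
    (A.cont.comp (continuous_pi fun _ => continuous_apply 0)).prodMk
      (A.cont.comp (continuous_pi fun _ => continuous_apply 1))

/-- A form of degree `N`, seen as a form of degree `N' = N`. -/
def castDegree {N N' : ℕ} (h : N = N') (Ω : W [⋀^Fin N]→L[ℝ] V) : W [⋀^Fin N']→L[ℝ] V where
  toContinuousMultilinearMap := Ω.toContinuousMultilinearMap.domDomCongr (finCongr h)
  map_eq_zero_of_eq' := by
    subst h
    intro v i j hv hij
    exact Ω.map_eq_zero_of_eq v hv hij

/-- Insertion of the vectors `u_1, …, u_q` into the first `q` arguments: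
`insertVectors q Ω u (v) = Ω(u_1, …, u_q, v_1, …, v_a)`. -/
def insertVectors {a : ℕ} :
    (q : ℕ) → W [⋀^Fin (a + q)]→L[ℝ] V → (Fin q → W) → W [⋀^Fin a]→L[ℝ] V
  | 0, Ω, _ => Ω
  | q + 1, Ω, u => insertVectors q (Ω.curryLeft (u 0)) (fun i => u i.succ)

end Pointwise

/-! ### Differential forms on a manifold -/

section Manifold

variable {E H M F L V : Type*} [NormedAddCommGroup E] [NormedSpace ℝ E]
  [TopologicalSpace H] (I : ModelWithCorners ℝ E H) [TopologicalSpace M] [ChartedSpace H M]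
  [NormedAddCommGroup F] [NormedSpace ℝ F]
  [NormedLieRing L] [NormedLieAlgebra L] [NormedAddCommGroup V] [NormedSpace ℝ V]

/-- Differential `k`-forms on `M` with values in `F`; an element of `DForm E M 1 L` is a connection
1-form (a gauge potential on `M`, or a connection form on the total space `M` of a bundle). As everywhere in Mathlib, the tangent space
`TangentSpace I x` of `M` at `x` is `E`, through the preferred chart at `x`. -/
abbrev DForm (E M : Type*) (k : ℕ) (F : Type*) [NormedAddCommGroup E] [NormedSpace ℝ E]
    [NormedAddCommGroup F] [NormedSpace ℝ F] : Type _ :=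
  M → E [⋀^Fin k]→L[ℝ] F

/-- The form `α` written in the chart at `x₀`, as a form on (a subset of) `E`. At `y`, tangent
vectors are carried from the chart at `x₀` to the preferred chart at the point `y` represents. -/
def inChart {k : ℕ} (α : DForm E M k F) (x₀ : M) (y : E) : E [⋀^Fin k]→L[ℝ] F :=
  let z : M := (extChartAt I x₀).symm y
  (α z).compContinuousLinearMap
    (fderivWithin ℝ (extChartAt I z ∘ (extChartAt I x₀).symm) (Set.range I) y)

/-- Smooth forms: smooth in every chart. -/
def IsSmoothForm {k : ℕ} (α : DForm E M k F) : Prop :=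
  ∀ x₀ : M, ContDiffOn ℝ ∞ (inChart I α x₀) (extChartAt I x₀).target

/-- The exterior derivative on `M`, computed in the chart at each point. -/
def extD {k : ℕ} (α : DForm E M k F) : DForm E M (k + 1) F := fun x =>
  extDerivWithin (inChart I α x) (Set.range I) (extChartAt I x x)

/-- The curvature `F = dA + A²`. -/
def curvature (A : DForm E M 1 L) : DForm E M 2 L := fun x => extD I A x + squareForm (A x)

/-! ### Transgression forms -/

/-- The factors of `⟨Θ Fⁿ⟩`. -/
def transgressionFactors {W : Type*} [NormedAddCommGroup W] [NormedSpace ℝ W] (n : ℕ)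
    (Θ : W [⋀^Fin 1]→L[ℝ] L) (Ft : W [⋀^Fin 2]→L[ℝ] L) : Fin (n + 1) → HomForm W L :=
  fun i => if i.val = 0 then ⟨1, Θ⟩ else ⟨2, Ft⟩

theorem sum_transgressionFactors {W : Type*} [NormedAddCommGroup W] [NormedSpace ℝ W] (n : ℕ)
    (Θ : W [⋀^Fin 1]→L[ℝ] L) (Ft : W [⋀^Fin 2]→L[ℝ] L) :
    ∑ i, (transgressionFactors n Θ Ft i).1 = 2 * n + 1 := by
  simp [transgressionFactors, Fin.sum_univ_succ]; ring

/-- The factors of `⟨Θ Ξ Fⁿ⁻¹⟩`. -/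
def boundaryFactors {W : Type*} [NormedAddCommGroup W] [NormedSpace ℝ W] (n : ℕ)
    (Θ Ξ : W [⋀^Fin 1]→L[ℝ] L) (Ft : W [⋀^Fin 2]→L[ℝ] L) : Fin (n + 1) → HomForm W L :=
  fun i => if i.val = 0 then ⟨1, Θ⟩ else if i.val = 1 then ⟨1, Ξ⟩ else ⟨2, Ft⟩

theorem sum_boundaryFactors {W : Type*} [NormedAddCommGroup W] [NormedSpace ℝ W] {n : ℕ}
    (hn : 1 ≤ n) (Θ Ξ : W [⋀^Fin 1]→L[ℝ] L) (Ft : W [⋀^Fin 2]→L[ℝ] L) :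
    ∑ i, (boundaryFactors n Θ Ξ Ft i).1 = 2 * n := by
  obtain ⟨m, rfl⟩ : ∃ m, n = m + 1 := ⟨n - 1, by omega⟩
  simp [boundaryFactors, Fin.sum_univ_succ]; ring

/-- The transgression `(2n+1)`-form
`Q_{A₁ ← A₀} = (n + 1) ∫₀¹ dt ⟨(A₁ - A₀) F_tⁿ⟩`, `F_t` the curvature of `A₀ + t (A₁ - A₀)`. -/
def transgression {n : ℕ} (f : L [×(n + 1)]→L[ℝ] V) (A₁ A₀ : DForm E M 1 L) :
    DForm E M (2 * n + 1) V := fun x =>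
  ((n : ℝ) + 1) • ∫ t in (0 : ℝ)..1,
    wedgePairing f
      (transgressionFactors n (A₁ x - A₀ x) (curvature I (A₀ + t • (A₁ - A₀)) x))
      (sum_transgressionFactors n _ _)

/-- The `2n`-form
`Q_{A₂ ← A₁ ← A₀} = n (n + 1) ∫₀¹ dt ∫₀ᵗ ds ⟨(A₂ - A₁) (A₁ - A₀) F_{st}ⁿ⁻¹⟩`, `F_{st}` the
curvature of `A₀ + s (A₂ - A₁) + t (A₁ - A₀)`. -/
def transgressionBoundary {n : ℕ} (hn : 1 ≤ n) (f : L [×(n + 1)]→L[ℝ] V)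
    (A₂ A₁ A₀ : DForm E M 1 L) : DForm E M (2 * n) V := fun x =>
  ((n : ℝ) * ((n : ℝ) + 1)) • ∫ t in (0 : ℝ)..1, ∫ s in (0 : ℝ)..t,
    wedgePairing f
      (boundaryFactors n (A₂ x - A₁ x) (A₁ x - A₀ x)
        (curvature I (A₀ + s • (A₂ - A₁) + t • (A₁ - A₀)) x))
      (sum_boundaryFactors hn _ _ _)

/-! ### Forms on `M × T` and integration over simplices

`T` lies in `ℝ^{m+1}` with coordinates `t^0, …, t^m`. The tangent space of `M × ℝ^{m+1}` at
`(x, t)` is `E × ℝ^{m+1}`. -/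

/-- Forms of total degree `N` on `M × ℝ^{m+1}`. -/
abbrev ProdForm (E M : Type*) (m N : ℕ) (F : Type*) [NormedAddCommGroup E] [NormedSpace ℝ E]
    [NormedAddCommGroup F] [NormedSpace ℝ F] : Type _ :=
  (Fin (m + 1) → ℝ) → M → (E × (Fin (m + 1) → ℝ)) [⋀^Fin N]→L[ℝ] F

/-- A family, indexed by `t`, of forms on `M`, seen as a form on `M × ℝ^{m+1}`. -/
def liftForm {m k : ℕ} (α : (Fin (m + 1) → ℝ) → DForm E M k F) : ProdForm E M m k F :=
  fun t x => (α t x).compContinuousLinearMap (ContinuousLinearMap.fst ℝ E (Fin (m + 1) → ℝ))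

/-- The exterior derivative `d_t` in the directions of `ℝ^{m+1}`. -/
def dT {m N : ℕ} (Ω : ProdForm E M m N F) : ProdForm E M m (N + 1) F := fun t x =>
  ContinuousAlternatingMap.alternatizeUncurryFin
    ((fderiv ℝ (fun t' => Ω t' x) t).comp (ContinuousLinearMap.snd ℝ E (Fin (m + 1) → ℝ)))

/-- The point of the simplex with vertices `w_0, …, w_q` with coordinates `τ`. -/
def simplexPoint {m q : ℕ} (w : Fin (q + 1) → Fin (m + 1) → ℝ) (τ : Fin q → ℝ) :
    Fin (m + 1) → ℝ :=
  w 0 + ∑ i, τ i • (w i.succ - w 0)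

/-- `{τ ∈ ℝ^q : τ_i ≥ 0, τ_1 + ⋯ + τ_q ≤ 1}`. -/
def coordSimplex (q : ℕ) : Set (Fin q → ℝ) := {τ | (∀ i, 0 ≤ τ i) ∧ ∑ i, τ i ≤ 1}

/-- Integration of a form on `M × ℝ^{m+1}` over the oriented simplex `(w_0 ⋯ w_q)`, the
differentials of the simplex standing first: the integral of `dτ^1 ⋯ dτ^q β_τ`, with `β_τ` an
`a`-form on `M`, is the `a`-form `∫ β_τ dτ`. -/
def integrateSimplex {m N a q : ℕ} (h : a + q = N) (w : Fin (q + 1) → Fin (m + 1) → ℝ)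
    (Ω : ProdForm E M m N F) : DForm E M a F := fun x =>
  ∫ τ in coordSimplex q,
    (insertVectors q (castDegree h.symm (Ω (simplexPoint w τ) x))
      (fun i => ((0 : E), w i.succ - w 0))).compContinuousLinearMap
        (ContinuousLinearMap.inl ℝ E (Fin (m + 1) → ℝ))

/-- The vertices `e_0, …, e_m` of `T_m = {t : t^i ≥ 0, ∑ t^i = 1}`. -/
def stdVertices (m : ℕ) : Fin (m + 1) → Fin (m + 1) → ℝ := fun i => Pi.single i 1

/-- `∫_{T_m} Ω`. -/
def integrateT {m N a : ℕ} (h : a + m = N) (Ω : ProdForm E M m N F) : DForm E M a F :=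
  integrateSimplex h (stdVertices m) Ω

/-- `∫_{∂T_{p+1}} Ω`, where `∂(w_0 ⋯ w_{p+1}) = ∑_j (-1)^j (w_0 ⋯ ŵ_j ⋯ w_{p+1})`. -/
def integrateBoundaryT {p N a : ℕ} (h : a + p = N) (Ω : ProdForm E M (p + 1) N F) :
    DForm E M a F :=
  ∑ j : Fin (p + 2), (-1 : ℝ) ^ (j : ℕ) •
    integrateSimplex h (fun i => stdVertices (p + 1) (j.succAbove i)) Ω

/-! ### The homotopy derivation -/

/-- The symbols `F_t` and `d_t A_t`. -/
inductive HomotopySymbol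
  | F
  | dtA

/-- Formal real combinations of expressions `⟨w_1 ⋯ w_r⟩` with each `w_i` one of the symbols. -/
abbrev HomotopyPoly (r : ℕ) : Type := (Fin r → HomotopySymbol) →₀ ℝ

/-- The homotopy derivation `l_t`: the derivation with `l_t F_t = d_t A_t` and
`l_t (d_t A_t) = d_t (l_t A_t) = 0`. It preserves the total degree on `M × T`, so that its Leibniz
rule has no signs: each occurrence of `F_t` in turn is replaced by `d_t A_t`. -/
def homotopyDerivation (r : ℕ) : Module.End ℝ (HomotopyPoly r) :=
  Finsupp.linearCombination ℝ fun w : Fin r → HomotopySymbol =>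
    ∑ i, match w i with
      | .F => Finsupp.single (Function.update w i .dtA) (1 : ℝ)
      | .dtA => 0

/-- `A_t = ∑ t^i A_i`. -/
def simplexConnection {m : ℕ} (A : Fin (m + 1) → DForm E M 1 L) (t : Fin (m + 1) → ℝ) :
    DForm E M 1 L :=
  ∑ i, t i • A i

/-- The 2-form on `M × ℝ^{m+1}` that a symbol stands for. -/
def homotopySymbolForm {m : ℕ} (A : Fin (m + 1) → DForm E M 1 L) :
    HomotopySymbol → ProdForm E M m 2 L
  | .F => liftForm fun t => curvature I (simplexConnection A t)
  | .dtA => dT (liftForm (simplexConnection A))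

/-- The form on `M × ℝ^{m+1}` that a formal expression stands for. -/
def homotopyPolyForm {m n : ℕ} (f : L [×(n + 1)]→L[ℝ] V) (A : Fin (m + 1) → DForm E M 1 L)
    (P : HomotopyPoly (n + 1)) : ProdForm E M m (2 * n + 2) V := fun t x =>
  P.sum fun w c => c •
    wedgePairing f (fun i => ⟨2, homotopySymbolForm I A (w i) t x⟩) (by simp; ring)

/-- `(l_t^p / p!) ⟨F_t^{n+1}⟩`. -/
def homotopyPower {m n : ℕ} (f : L [×(n + 1)]→L[ℝ] V) (A : Fin (m + 1) → DForm E M 1 L)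
    (p : ℕ) : ProdForm E M m (2 * n + 2) V :=
  homotopyPolyForm I f A
    ((p.factorial : ℝ)⁻¹ • (homotopyDerivation (n + 1) ^ p) (Finsupp.single (fun _ => .F) 1))

end Manifold

end

/-! The mechanism is Chern-Weil theory on the product of `M` with the parameter space. The
connections assemble into one connection `∑ tⁱ Aᵢ` on `M × ℝ^{m+1}`. It has no `dt` component, so
its curvature is `F_t + d_t A_t`. For an invariant tensor the form `⟨(F_t + d_t A_t)^{n+1}⟩` is
closed: its differential is a sum of terms with one curvature factor `F` replaced by `dF`;
invariance allows `dF` to be completed to `dF + [A, F]`, and the alternating sum of the latter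
vanishes by `bianchi`. Stokes' theorem for integration along the simplex fibres (`fibre_stokes`)
then turns closedness into the relation between the integral over the boundary and `d` of the
integral over the simplex.

The operator `l_t` extracts components. It replaces one `F_t` at a time by `d_t A_t`, so `l_t^p /
p!` of `⟨F_t^{n+1}⟩` is the part of `⟨(F_t + d_t A_t)^{n+1}⟩` of degree `p` in `d_t A_t`, that is,
in `dt`. Integration over a `q`-simplex sees only the part of degree `q` in `dt`
(`insertCLM_wedgePairing_add`). Hence a single closed form yields both sides of the formula for
every `p`. For `p = 2n + 2` there are more applications of `l_t` than factors, and the integrand is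
zero.

The analysis is local (`local_homotopy_formula`). In a chart one works on the range of the model
intersected with a ball, a convex set with unique derivatives contained in the closure of its
interior; boundary and corners thus need no separate treatment. Naturality of `d` under changes of
charts (`inChart_extD`) carries the result to `M`.

The triangle identity is the case `p = 1` on the simplex `(A₀ A₁ A₂)`. Symmetry of the tensor lets
two-forms commute, so the components of degree one and two in `dt` each collapse to a single
pairing, and inserting the edge vectors gives the two transgression forms. The edges at `A₀` are `A₁
- A₀` and `A₂ - A₀`; since one-forms anticommute under a symmetric tensor, the second may be
replaced by `A₂ - A₁`. -/

noncomputable section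

/-! ### Exterior products as continuous multilinear maps; pullback; the square of a connection. -/

section WedgeAlgebra

variable {W W' L V : Type*} [NormedAddCommGroup W] [NormedSpace ℝ W]
  [NormedAddCommGroup W'] [NormedSpace ℝ W']
  [NormedLieRing L] [NormedLieAlgebra L] [NormedAddCommGroup V] [NormedSpace ℝ V]

/-- The bracket of a normed Lie algebra as a continuous bilinear map. -/
def lieCMM (L : Type*) [NormedLieRing L] [NormedLieAlgebra L] : L [×2]→L[ℝ] L where
  toFun v := ⁅v 0, v 1⁆
  map_update_add' := by
    intro _ m i x y
    fin_cases i <;> simp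
  map_update_smul' := by
    intro _ m i c x
    fin_cases i <;> simp
  cont := (NormedLieAlgebra.continuous_lie (L := L)).comp <|
    (continuous_apply (A := fun _ : Fin 2 => L) 0).prodMk (continuous_apply 1)

@[simp] theorem lieCMM_apply (v : Fin 2 → L) : lieCMM L v = ⁅v 0, v 1⁆ := rfl

theorem wedgePairing_apply {r N : ℕ} (f : L [×r]→L[ℝ] V) (α : Fin r → HomForm W L)
    (h : ∑ i, (α i).1 = N) (v : Fin N → W) :
    wedgePairing f α h v = (∏ i, ((α i).1.factorial : ℝ))⁻¹ •
      ∑ σ : Equiv.Perm (Fin N), Equiv.Perm.sign σ •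
        f fun i => (α i).2 fun j => v (σ (Fin.cast h (finSigmaFinEquiv ⟨i, j⟩))) := by
  simp only [wedgePairing, ContinuousAlternatingMap.smul_apply,
    ContinuousMultilinearMap.alternatization_apply_apply]
  rfl

/-- The proof of the degree count mentions the factors, so replacing the factors requires
transporting it. -/
theorem wedgePairing_congr {r N : ℕ} (f : L [×r]→L[ℝ] V) {α β : Fin r → HomForm W L}
    (hαβ : α = β) (h : ∑ i, (α i).1 = N) :
    wedgePairing f α h = wedgePairing f β (hαβ ▸ h) := by
  subst hαβ; rfl

theorem prod_norm_blocks {W : Type*} [NormedAddCommGroup W] {r N : ℕ} {k : Fin r → ℕ}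
    (h : ∑ i, k i = N) (v : Fin N → W) (σ : Equiv.Perm (Fin N)) :
    ∏ i : Fin r, ∏ j : Fin (k i), ‖v (σ (Fin.cast h (finSigmaFinEquiv ⟨i, j⟩)))‖ =
      ∏ l, ‖v l‖ := by
  rw [← Fintype.prod_sigma' fun i j => ‖v (σ (Fin.cast h (finSigmaFinEquiv ⟨i, j⟩)))‖]
  exact Fintype.prod_equiv ((finSigmaFinEquiv.trans (finCongr h)).trans σ) _ _ fun _ => rfl

/-- Exterior multiplication of factors of fixed degrees, as a continuous multilinear map. -/
def wedgePairingCMM {r N : ℕ} (f : L [×r]→L[ℝ] V) (k : Fin r → ℕ) (h : ∑ i, k i = N) :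
    ContinuousMultilinearMap ℝ (fun i => W [⋀^Fin (k i)]→L[ℝ] L) (W [⋀^Fin N]→L[ℝ] V) :=
  MultilinearMap.mkContinuous
    { toFun := fun η => wedgePairing f (fun i => ⟨k i, η i⟩) h
      map_update_add' := by
        intro _ η i x y
        ext v
        simp only [wedgePairing_apply, ContinuousAlternatingMap.add_apply, ← smul_add,
          ← Finset.sum_add_distrib]
        congr 1
        refine Finset.sum_congr rfl fun σ _ => ?_
        congr 1
        have e : ∀ z : W [⋀^Fin (k i)]→L[ℝ] L,
            (fun j => (Function.update η i z j) fun l =>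
              v (σ (Fin.cast h (finSigmaFinEquiv ⟨j, l⟩)))) =
            Function.update (fun j => (η j) fun l =>
              v (σ (Fin.cast h (finSigmaFinEquiv ⟨j, l⟩)))) i
              (z fun l => v (σ (Fin.cast h (finSigmaFinEquiv ⟨i, l⟩)))) := fun z => by
          ext j
          rcases eq_or_ne j i with rfl | hj <;> simp [*]
        rw [e, e, e, ← f.map_update_add]
        rfl
      map_update_smul' := by
        intro _ η i c x
        ext v
        simp only [wedgePairing_apply, ContinuousAlternatingMap.smul_apply]
        rw [smul_comm c]
        congr 1
        rw [Finset.smul_sum]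
        refine Finset.sum_congr rfl fun σ _ => ?_
        rw [smul_comm c]
        congr 1
        have e : ∀ z : W [⋀^Fin (k i)]→L[ℝ] L,
            (fun j => (Function.update η i z j) fun l =>
              v (σ (Fin.cast h (finSigmaFinEquiv ⟨j, l⟩)))) =
            Function.update (fun j => (η j) fun l =>
              v (σ (Fin.cast h (finSigmaFinEquiv ⟨j, l⟩)))) i
              (z fun l => v (σ (Fin.cast h (finSigmaFinEquiv ⟨i, l⟩)))) := fun z => by
          ext j
          rcases eq_or_ne j i with rfl | hj <;> simp [*]
        rw [e, e, ← f.map_update_smul]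
        rfl }
    (‖(∏ i, ((k i).factorial : ℝ))⁻¹‖ * (Fintype.card (Equiv.Perm (Fin N)) * ‖f‖)) (by
      intro η
      refine ContinuousAlternatingMap.opNorm_le_bound _ (by positivity) fun v => ?_
      have hb : ∀ σ : Equiv.Perm (Fin N), ‖Equiv.Perm.sign σ • f fun i => (η i) fun j =>
          v (σ (Fin.cast h (finSigmaFinEquiv ⟨i, j⟩)))‖ ≤ ‖f‖ * (∏ i, ‖η i‖) * ∏ l, ‖v l‖ := by
        intro σ
        have h1 : ∀ x : V, ‖Equiv.Perm.sign σ • x‖ = ‖x‖ := fun x => by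
          rcases Int.units_eq_one_or (Equiv.Perm.sign σ) with h | h <;> simp [h]
        rw [h1, mul_assoc, ← prod_norm_blocks h v σ, ← Finset.prod_mul_distrib]
        exact f.le_opNorm_mul_prod_of_le fun i => (η i).le_opNorm _
      change ‖wedgePairing f (fun i => ⟨k i, η i⟩) h v‖ ≤ _
      rw [wedgePairing_apply, norm_smul, mul_assoc, mul_assoc]
      refine mul_le_mul_of_nonneg_left ?_ (norm_nonneg _)
      refine (norm_sum_le _ _).trans ((Finset.sum_le_sum fun σ _ => hb σ).trans (le_of_eq ?_))
      simp only [Finset.sum_const, Finset.card_univ, nsmul_eq_mul]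
      ring)

@[simp] theorem wedgePairingCMM_apply {r N : ℕ} (f : L [×r]→L[ℝ] V) (k : Fin r → ℕ)
    (h : ∑ i, k i = N) (η : ∀ i, W [⋀^Fin (k i)]→L[ℝ] L) :
    wedgePairingCMM f k h η = wedgePairing f (fun i => ⟨k i, η i⟩) h := rfl

theorem wedgePairing_compContinuousLinearMap {r N : ℕ} (f : L [×r]→L[ℝ] V)
    (α : Fin r → HomForm W' L) (h : ∑ i, (α i).1 = N) (g : W →L[ℝ] W') :
    (wedgePairing f α h).compContinuousLinearMap g =
      wedgePairing f (fun i => ⟨(α i).1, (α i).2.compContinuousLinearMap g⟩) h := by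
  ext v
  simp only [ContinuousAlternatingMap.compContinuousLinearMap_apply, wedgePairing_apply]
  rfl

@[simp] theorem squareForm_apply (A : W [⋀^Fin 1]→L[ℝ] L) (v : Fin 2 → W) :
    squareForm A v = ⁅A fun _ => v 0, A fun _ => v 1⁆ := rfl

/-- Written as half a wedge product taken with the bracket, `A²` inherits smoothness in `A` from
continuous multilinear maps. -/
theorem squareForm_eq_wedgePairing (A : W [⋀^Fin 1]→L[ℝ] L) :
    squareForm A = (2 : ℝ)⁻¹ •
      wedgePairingCMM (lieCMM L) (fun _ : Fin 2 => 1) (N := 2) (by simp) (fun _ => A) := by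
  ext v
  have hp : (Finset.univ : Finset (Equiv.Perm (Fin 2))) = {1, Equiv.swap 0 1} := by decide
  have e : ∀ i : Fin 2, (∀ l : Fin 1, (Fin.cast (by simp : ∑ i : Fin 2, 1 = 2)
      (finSigmaFinEquiv (m := 2) (n := fun _ => 1) ⟨i, l⟩) : Fin 2) = i) := by
    intro i l; ext; simp [finSigmaFinEquiv_apply]
  simp only [wedgePairingCMM_apply, ContinuousAlternatingMap.smul_apply, wedgePairing_apply, hp, e,
    squareForm_apply, lieCMM_apply]
  rw [Finset.sum_pair (by decide)]
  simp only [Equiv.Perm.coe_one, id, Equiv.Perm.sign_one, one_smul, Nat.factorial_one, Nat.cast_one,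
    Finset.prod_const_one, inv_one, Equiv.Perm.sign_swap (show (0 : Fin 2) ≠ 1 by decide),
    Equiv.swap_apply_left, Equiv.swap_apply_right, Units.neg_smul]
  rw [← lie_skew (A fun _ => v 1), neg_neg, ← two_smul ℝ, smul_smul]
  norm_num

theorem contDiff_squareForm {m : WithTop ℕ∞} :
    ContDiff ℝ m (squareForm : (W [⋀^Fin 1]→L[ℝ] L) → W [⋀^Fin 2]→L[ℝ] L) := by
  have : (squareForm : (W [⋀^Fin 1]→L[ℝ] L) → W [⋀^Fin 2]→L[ℝ] L) = fun A => (2 : ℝ)⁻¹ •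
      wedgePairingCMM (lieCMM L) (fun _ : Fin 2 => 1) (N := 2) (by simp) (fun _ => A) :=
    funext squareForm_eq_wedgePairing
  rw [this]
  exact ContDiff.const_smul _ ((wedgePairingCMM (W := W) (lieCMM L) (fun _ : Fin 2 => 1) (N := 2)
    (by simp)).contDiff.comp (contDiff_pi.2 fun _ => contDiff_id))

end WedgeAlgebra

/-! ### Insertion of vectors, weight in the vertical directions, expansion of sums over
permutations. -/

section Insertion

variable {W W' E X V : Type*} [NormedAddCommGroup W] [NormedSpace ℝ W]
  [NormedAddCommGroup W'] [NormedSpace ℝ W']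
  [NormedAddCommGroup E] [NormedSpace ℝ E] [NormedAddCommGroup X] [NormedSpace ℝ X]
  [NormedAddCommGroup V] [NormedSpace ℝ V]

/-- The tuple `(u_1, …, u_q, v_1, …, v_a)`. -/
def headTail {α : Type*} {N a q : ℕ} (h : a + q = N) (u : Fin q → α) (v : Fin a → α) : Fin N → α :=
  fun k => if hk : k.1 < q then u ⟨k, hk⟩ else v ⟨k - q, by omega⟩

theorem headTail_succ {α : Type*} {a q : ℕ} (u : Fin (q + 1) → α) (v : Fin a → α) :
    headTail (N := a + (q + 1)) rfl u v =
      (Fin.cons (u 0) (headTail (N := a + q) rfl (fun i => u i.succ) v) : Fin (a + q + 1) → α) := by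
  ext k
  refine Fin.cases ?_ (fun k => ?_) k
  · simp [headTail]
  · simp only [headTail, Fin.val_succ, Fin.cons_succ, Nat.add_lt_add_iff_right]
    by_cases hk : k.1 < q
    · simp only [hk, dite_true]; rfl
    · simp only [hk, dite_false]; congr 2; omega

theorem comp_headTail {α β : Type*} {N a q : ℕ} (h : a + q = N) (g : α → β) (u : Fin q → α)
    (v : Fin a → α) : (fun k => g (headTail h u v k)) =
      headTail h (fun i => g (u i)) (fun i => g (v i)) := by
  ext k
  simp only [headTail]
  split_ifs <;> rfl

theorem insertVectors_apply_aux {a : ℕ} (q : ℕ) (Ω : W [⋀^Fin (a + q)]→L[ℝ] V) (u : Fin q → W)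
    (v : Fin a → W) : insertVectors q Ω u v = Ω (headTail rfl u v) := by
  induction q with
  | zero =>
    simp only [insertVectors]
    congr 1
  | succ q ih =>
    rw [headTail_succ]
    exact ih (Ω.curryLeft (u 0)) (fun i => u i.succ)

theorem insertVectors_apply {N a q : ℕ} (h : a + q = N) (Ω : W [⋀^Fin N]→L[ℝ] V) (u : Fin q → W)
    (v : Fin a → W) : insertVectors q (castDegree h.symm Ω) u v = Ω (headTail h u v) := by
  subst h
  rw [insertVectors_apply_aux]
  rfl

theorem continuous_insertVectors {a : ℕ} (q : ℕ) (u : Fin q → W) :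
    Continuous fun Ω : W [⋀^Fin (a + q)]→L[ℝ] V => insertVectors q Ω u := by
  induction q with
  | zero => exact continuous_id
  | succ q ih =>
    refine (ih fun i => u i.succ).comp ?_
    exact (ContinuousLinearMap.apply ℝ (W [⋀^Fin (a + q)]→L[ℝ] V) (u 0)).continuous.comp
      (ContinuousAlternatingMap.curryLeftLI (𝕜 := ℝ) (E := W) (F := V) (n := a + q)).continuous

/-- Insertion of vectors followed by restriction along a linear map, as a continuous linear map. -/
def insertCLM {N a q : ℕ} (h : a + q = N) (u : Fin q → W') (g : W →L[ℝ] W') :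
    W' [⋀^Fin N]→L[ℝ] V →L[ℝ] W [⋀^Fin a]→L[ℝ] V where
  toFun Ω := (insertVectors q (castDegree h.symm Ω) u).compContinuousLinearMap g
  map_add' Ω Ω' := by
    ext v
    simp only [ContinuousAlternatingMap.compContinuousLinearMap_apply, insertVectors_apply h,
      ContinuousAlternatingMap.add_apply]
  map_smul' c Ω := by
    ext v
    simp only [ContinuousAlternatingMap.compContinuousLinearMap_apply, insertVectors_apply h,
      ContinuousAlternatingMap.smul_apply, RingHom.id_apply]
  cont := by
    subst h
    exact (ContinuousAlternatingMap.compContinuousLinearMapCLM g).continuous.comp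
      (continuous_insertVectors q u)

theorem insertCLM_apply {N a q : ℕ} (h : a + q = N) (u : Fin q → W') (g : W →L[ℝ] W')
    (Ω : W' [⋀^Fin N]→L[ℝ] V) (v : Fin a → W) :
    insertCLM h u g Ω v = Ω (headTail h u fun i => g (v i)) :=
  insertVectors_apply h Ω u _

/-- A form on `E × X` of weight `s` in `X` vanishes on `q` vectors of `X` followed by vectors of
`E`, unless `q = s`. -/
theorem apply_headTail_eq_zero_of_weight {N a q s : ℕ} (h : a + q = N) (hs : s ≠ q)
    (Ω : (E × X) [⋀^Fin N]→L[ℝ] V)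
    (hΩ : Ω.compContinuousLinearMap ((ContinuousLinearMap.id ℝ E).prodMap
      ((2 : ℝ) • ContinuousLinearMap.id ℝ X)) = (2 : ℝ) ^ s • Ω)
    (u : Fin q → X) (v : Fin a → E) :
    Ω (headTail h (fun i => ((0 : E), u i)) fun i => (v i, (0 : X))) = 0 := by
  set z := headTail h (fun i => ((0 : E), u i)) fun i => (v i, (0 : X)) with hz
  have h1 := DFunLike.congr_fun hΩ z
  have h2 : (fun k => ((ContinuousLinearMap.id ℝ E).prodMap
      ((2 : ℝ) • ContinuousLinearMap.id ℝ X)) (z k)) =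
      fun k => (if k.1 < q then (2 : ℝ) else 1) • z k := by
    ext1 k
    simp only [hz, headTail]
    split_ifs <;> simp
  -- The dilation doubles exactly the `q` vertical entries, so multilinearity produces `2 ^ q`,
  -- while the weight hypothesis produces `2 ^ s`. Any dilation factor with distinct powers would
  -- do.
  have hc : (∏ k : Fin N, if k.1 < q then (2 : ℝ) else 1) = 2 ^ q := by
    rw [Finset.prod_ite, Finset.prod_const_one, mul_one, Finset.prod_const]
    congr 1
    have : (Finset.univ.filter fun k : Fin N => k.1 < q) =
        Finset.univ.map (Fin.castLEEmb (show q ≤ N by omega)) := by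
      ext k
      simp only [Finset.mem_filter, Finset.mem_univ, true_and, Finset.mem_map, Fin.castLEEmb_apply]
      exact ⟨fun hk => ⟨⟨k, hk⟩, rfl⟩, fun ⟨j, hj⟩ => hj ▸ j.2⟩
    rw [this]; simp
  rw [ContinuousAlternatingMap.compContinuousLinearMap_apply] at h1
  replace h1 := (congrArg Ω h2).symm.trans h1
  have h3 : Ω (fun k => (if k.1 < q then (2 : ℝ) else 1) • z k) = (2 : ℝ) ^ q • Ω z := by
    rw [← hc]
    exact Ω.toMultilinearMap.map_smul_univ _ _
  rw [h3, ContinuousAlternatingMap.smul_apply, ← sub_eq_zero, ← sub_smul] at h1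
  refine (smul_eq_zero.1 h1).resolve_left (sub_ne_zero.2 fun h4 => hs ?_)
  exact (Nat.pow_right_injective le_rfl (by exact_mod_cast h4)).symm

/-- The permutation sending `p` to `0` and the remaining arguments to the successors via `e`. -/
def permInsert {N : ℕ} (p : Fin (N + 1)) (e : Equiv.Perm (Fin N)) : Equiv.Perm (Fin (N + 1)) :=
  Equiv.Perm.decomposeFin.symm (0, e) * p.cycleRange

@[simp] theorem permInsert_self {N : ℕ} (p : Fin (N + 1)) (e : Equiv.Perm (Fin N)) :
    permInsert p e p = 0 := by
  simp [permInsert, Fin.cycleRange_self]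

@[simp] theorem permInsert_succAbove {N : ℕ} (p : Fin (N + 1)) (e : Equiv.Perm (Fin N))
    (j : Fin N) : permInsert p e (p.succAbove j) = (e j).succ := by
  simp [permInsert, Fin.cycleRange_succAbove]

/-- The factor built from `e` fixes `0` and has the sign of `e`; `p.cycleRange` is a cycle of length
`p + 1`. -/
theorem sign_permInsert {N : ℕ} (p : Fin (N + 1)) (e : Equiv.Perm (Fin N)) :
    Equiv.Perm.sign (permInsert p e) = (-1) ^ (p : ℕ) * Equiv.Perm.sign e := by
  rw [permInsert, Equiv.Perm.sign_mul, Equiv.Perm.decomposeFin.symm_sign, Fin.sign_cycleRange,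
    if_pos rfl, one_mul, mul_comm]

/-- `p` is recovered as the preimage of `0` and `e` from the remaining values; the count `(N + 1) ·
N!` gives surjectivity. -/
theorem bijective_permInsert (N : ℕ) : Function.Bijective
    fun x : Fin (N + 1) × Equiv.Perm (Fin N) => permInsert x.1 x.2 := by
  rw [Fintype.bijective_iff_injective_and_card]
  constructor
  · rintro ⟨p, e⟩ ⟨p', e'⟩ h
    replace h : permInsert p e = permInsert p' e' := h
    have hp : p = p' := by
      have h1 := permInsert_self p e
      rw [h, ← permInsert_self p' e'] at h1
      exact (permInsert p' e').injective h1
    subst hp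
    congr 1
    ext j
    have h1 := permInsert_succAbove p e j
    rw [h, permInsert_succAbove] at h1
    rw [Fin.succ_injective _ h1]
  · rw [Fintype.card_prod, Fintype.card_perm, Fintype.card_perm, Fintype.card_fin,
      Fintype.card_fin, Nat.factorial_succ]

/-- Laplace-type expansion of an alternating sum along its first argument. -/
theorem sum_sign_smul_cons {α V : Type*} [AddCommGroup V] {N : ℕ} (g : (Fin (N + 1) → α) → V)
    (w : α) (v : Fin N → α) :
    ∑ σ : Equiv.Perm (Fin (N + 1)), Equiv.Perm.sign σ • g ((Fin.cons w v : Fin (N + 1) → α) ∘ σ) =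
      ∑ p : Fin (N + 1), (-1 : ℤˣ) ^ (p : ℕ) • ∑ e : Equiv.Perm (Fin N),
        Equiv.Perm.sign e • g (p.insertNth w (v ∘ e)) := by
  simp only [Finset.smul_sum, smul_smul]
  rw [← Fintype.sum_prod_type' fun (p : Fin (N + 1)) (e : Equiv.Perm (Fin N)) =>
    ((-1 : ℤˣ) ^ (p : ℕ) * Equiv.Perm.sign e) • g (p.insertNth w (v ∘ e))]
  symm
  refine Fintype.sum_bijective _ (bijective_permInsert N) _ _ ?_
  rintro ⟨p, e⟩
  have hcons : (Fin.cons w v : Fin (N + 1) → α) ∘ permInsert p e = p.insertNth w (v ∘ e) := by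
    ext1 k
    refine p.succAboveCases ?_ (fun j => ?_) k <;> simp
  change _ = Equiv.Perm.sign (permInsert p e) • g (_ ∘ permInsert p e)
  rw [hcons, sign_permInsert]

end Insertion

/-! ### Expansion along the first slot, and vanishing of alternating sums under a cyclic identity.
-/

section AlternatingSums

/-- The permutation sending `0` to `i` and the successors to the remaining arguments via `e`. -/
def permExtract {N : ℕ} (i : Fin (N + 1)) (e : Equiv.Perm (Fin N)) : Equiv.Perm (Fin (N + 1)) :=
  (permInsert i e⁻¹)⁻¹

@[simp] theorem permExtract_zero {N : ℕ} (i : Fin (N + 1)) (e : Equiv.Perm (Fin N)) :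
    permExtract i e 0 = i := by
  rw [permExtract, Equiv.Perm.inv_eq_iff_eq, permInsert_self]

@[simp] theorem permExtract_succ {N : ℕ} (i : Fin (N + 1)) (e : Equiv.Perm (Fin N)) (j : Fin N) :
    permExtract i e j.succ = i.succAbove (e j) := by
  rw [permExtract, Equiv.Perm.inv_eq_iff_eq, permInsert_succAbove,
    ← Equiv.Perm.mul_apply, inv_mul_cancel, Equiv.Perm.one_apply]

theorem bijective_permExtract (N : ℕ) : Function.Bijective
    fun x : Fin (N + 1) × Equiv.Perm (Fin N) => permExtract x.1 x.2 := by
  have h1 : (fun x : Fin (N + 1) × Equiv.Perm (Fin N) => permExtract x.1 x.2) =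
      (fun σ : Equiv.Perm (Fin (N + 1)) => σ⁻¹) ∘ (fun x => permInsert x.1 x.2) ∘
        (fun x : Fin (N + 1) × Equiv.Perm (Fin N) => (x.1, x.2⁻¹)) := rfl
  rw [h1]
  refine inv_bijective.comp ((bijective_permInsert N).comp ?_)
  exact Function.Involutive.bijective fun x => by simp

/-- Laplace-type expansion of an alternating sum along its first slot. -/
theorem sum_sign_smul_removeNth {α V : Type*} [AddCommGroup V] {N : ℕ}
    (g : (Fin (N + 1) → α) → V) (v : Fin (N + 1) → α) :
    ∑ σ : Equiv.Perm (Fin (N + 1)), Equiv.Perm.sign σ • g (v ∘ σ) =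
      ∑ i : Fin (N + 1), (-1 : ℤˣ) ^ (i : ℕ) • ∑ e : Equiv.Perm (Fin N),
        Equiv.Perm.sign e • g (Fin.cons (v i) (i.removeNth v ∘ e)) := by
  simp only [Finset.smul_sum, smul_smul]
  rw [← Fintype.sum_prod_type' fun (p : Fin (N + 1)) (e : Equiv.Perm (Fin N)) =>
    ((-1 : ℤˣ) ^ (p : ℕ) * Equiv.Perm.sign e) • g (Fin.cons (v p) (p.removeNth v ∘ e))]
  symm
  refine Fintype.sum_bijective _ (bijective_permExtract N) _ _ ?_
  rintro ⟨p, e⟩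
  have hcons : v ∘ permExtract p e = Fin.cons (v p) (p.removeNth v ∘ e) := by
    ext1 k
    refine Fin.cases ?_ (fun j => ?_) k <;> simp [Fin.removeNth]
  change _ = Equiv.Perm.sign (permExtract p e) • g (_ ∘ permExtract p e)
  rw [hcons, permExtract, Equiv.Perm.sign_inv, sign_permInsert, Equiv.Perm.sign_inv]

/-- The alternating sum of a function whose sum over an even cycle of order three vanishes. -/
theorem sum_sign_smul_eq_zero_of_cyclic {ι α V : Type*} [Fintype ι] [DecidableEq ι]
    [AddCommGroup V] [Module ℝ V] (c : Equiv.Perm ι) (hc : Equiv.Perm.sign c = 1)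
    (g : (ι → α) → V) (hg : ∀ z, g z + g (z ∘ c) + g ((z ∘ c) ∘ c) = 0) (v : ι → α) :
    ∑ σ : Equiv.Perm ι, Equiv.Perm.sign σ • g (v ∘ σ) = 0 := by
  -- Reindexing by `σ ↦ σ c` costs no sign because `c` is even. The three summands of the cyclic
  -- identity therefore have equal alternating sums, and three times the sum is zero.
  have key : ∀ g' : (ι → α) → V, ∑ σ : Equiv.Perm ι, Equiv.Perm.sign σ • g' ((v ∘ σ) ∘ c) =
      ∑ σ : Equiv.Perm ι, Equiv.Perm.sign σ • g' (v ∘ σ) := fun g' =>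
    Fintype.sum_equiv (Equiv.mulRight c) _ _ fun σ => by
      simp only [Equiv.coe_mulRight, Equiv.Perm.sign_mul, hc, mul_one, Equiv.Perm.coe_mul]
      rfl
  have h1 : ∑ σ : Equiv.Perm ι, Equiv.Perm.sign σ •
      (g (v ∘ σ) + g ((v ∘ σ) ∘ c) + g (((v ∘ σ) ∘ c) ∘ c)) = 0 :=
    Finset.sum_eq_zero fun σ _ => by rw [hg, smul_zero]
  simp only [smul_add, Finset.sum_add_distrib] at h1
  rw [key fun z => g (z ∘ c), key] at h1
  have h2 : (3 : ℝ) • ∑ σ : Equiv.Perm ι, Equiv.Perm.sign σ • g (v ∘ σ) = 0 := by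
    rw [← h1]; module
  exact (smul_eq_zero.1 h2).resolve_left (by norm_num)

end AlternatingSums

/-! ### The Bianchi identity and closedness of Chern-Weil forms on subsets of a vector space. -/

section ChernWeil

variable {W L V : Type*} [NormedAddCommGroup W] [NormedSpace ℝ W]
  [NormedLieRing L] [NormedLieAlgebra L] [NormedAddCommGroup V] [NormedSpace ℝ V]

/-- The curvature of a connection form on a subset of a vector space. -/
def localCurvature (S : Set W) (A : W → W [⋀^Fin 1]→L[ℝ] L) (y : W) : W [⋀^Fin 2]→L[ℝ] L :=
  extDerivWithin A S y + squareForm (A y)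

variable {S : Set W} {A : W → W [⋀^Fin 1]→L[ℝ] L} {y : W}

theorem ContDiffWithinAt.extDerivWithin_right {F : Type*} [NormedAddCommGroup F]
    [NormedSpace ℝ F] {k : ℕ} {α : W → W [⋀^Fin k]→L[ℝ] F} {m n : WithTop ℕ∞}
    (hα : ContDiffWithinAt ℝ n α S y) (hS : UniqueDiffOn ℝ S) (hmn : m + 1 ≤ n) (hy : y ∈ S) :
    ContDiffWithinAt ℝ m (extDerivWithin α S) S y := by
  have h : ContDiff ℝ m (fun T : W →L[ℝ] W [⋀^Fin k]→L[ℝ] F =>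
      ContinuousAlternatingMap.alternatizeUncurryFin T) :=
    @ContinuousLinearMap.contDiff ℝ (W →L[ℝ] W [⋀^Fin k]→L[ℝ] F) (W [⋀^Fin (k + 1)]→L[ℝ] F)
      _ _ _ _ _ m (ContinuousAlternatingMap.alternatizeUncurryFinCLM ℝ W F)
  exact h.comp_contDiffWithinAt (hα.fderivWithin_right hS hmn hy)

theorem ContDiffWithinAt.localCurvature {m n : WithTop ℕ∞}
    (hA : ContDiffWithinAt ℝ n A S y) (hS : UniqueDiffOn ℝ S) (hmn : m + 1 ≤ n) (hy : y ∈ S) :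
    ContDiffWithinAt ℝ m (localCurvature S A) S y :=
  (hA.extDerivWithin_right hS hmn hy).add
    (contDiff_squareForm.comp_contDiffWithinAt (hA.of_le (le_self_add.trans hmn)))

theorem fin_two_eta {α : Type*} (v : Fin 2 → α) : ![v 0, v 1] = v := by
  ext i; fin_cases i <;> rfl

/-- The Leibniz rule for the continuous bilinear bracket. It supplies the `[dA, A]` terms of `dF`,
which must cancel against `[A, dA]` in the Bianchi identity. -/
theorem fderivWithin_squareForm_apply (hA : DifferentiableWithinAt ℝ A S y)
    (hS : UniqueDiffWithinAt ℝ S y) (x a b : W) :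
    fderivWithin ℝ (fun z => squareForm (A z)) S y x ![a, b] =
      ⁅fderivWithin ℝ A S y x fun _ => a, A y fun _ => b⁆ +
        ⁅A y fun _ => a, fderivWithin ℝ A S y x fun _ => b⁆ := by
  have h1 : DifferentiableWithinAt ℝ (fun z => squareForm (A z)) S y :=
    ((contDiff_squareForm (m := 1)).differentiable one_ne_zero _).comp_differentiableWithinAt y hA
  rw [← fderivWithin_continuousAlternatingMap_apply_const_apply hS h1]
  have h2 : ∀ c : W, HasFDerivWithinAt (fun z => A z fun _ => c)
      ((ContinuousAlternatingMap.apply ℝ W L fun _ => c).comp (fderivWithin ℝ A S y)) S y :=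
    fun c =>
    (ContinuousAlternatingMap.apply ℝ W L fun _ : Fin 1 => c).hasFDerivAt.comp_hasFDerivWithinAt y
      hA.hasFDerivWithinAt
  have h3 : HasFDerivWithinAt (fun z => (![A z fun _ => a, A z fun _ => b] : Fin 2 → L))
      (ContinuousLinearMap.pi
        ![(ContinuousAlternatingMap.apply ℝ W L fun _ => a).comp (fderivWithin ℝ A S y),
        (ContinuousAlternatingMap.apply ℝ W L fun _ => b).comp (fderivWithin ℝ A S y)]) S y := by
    rw [hasFDerivWithinAt_pi']
    intro i
    fin_cases i
    · exact h2 a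
    · exact h2 b
  have h4 := ((lieCMM L).hasFDerivAt _).comp_hasFDerivWithinAt y h3
  have h5 : (fun z => squareForm (A z) ![a, b]) =
      (lieCMM L) ∘ fun z => (![A z fun _ => a, A z fun _ => b] : Fin 2 → L) := rfl
  rw [h5, h4.fderivWithin hS]
  simp [ContinuousMultilinearMap.linearDeriv_apply, Fin.sum_univ_two]

theorem removeNth_three {α : Type*} (x a b : α) :
    (Fin.removeNth 0 ![x, a, b] = ![a, b]) ∧ (Fin.removeNth 1 ![x, a, b] = ![x, b]) ∧
      Fin.removeNth 2 ![x, a, b] = ![x, a] := by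
  refine ⟨?_, ?_, ?_⟩ <;> ext i <;> fin_cases i <;> rfl

theorem twoForm_swap {F : Type*} [NormedAddCommGroup F] [NormedSpace ℝ F]
    (η : W [⋀^Fin 2]→L[ℝ] F) (a b : W) : η ![b, a] = - η ![a, b] := by
  have h := η.toAlternatingMap.map_swap ![a, b] (show (0 : Fin 2) ≠ 1 by decide)
  have e : (![a, b] ∘ Equiv.swap (0 : Fin 2) 1) = ![b, a] := by
    ext i; fin_cases i <;> rfl
  rw [e] at h
  exact h

/-- The Bianchi identity `dF + [A, F] = 0`, evaluated on three vectors. -/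
theorem bianchi (hA : ContDiffWithinAt ℝ 2 A S y) (hS : UniqueDiffOn ℝ S) (hy : y ∈ S)
    (hyc : y ∈ closure (interior S)) (x a b : W) :
    (fderivWithin ℝ (localCurvature S A) S y x ![a, b] +
        ⁅A y fun _ => x, localCurvature S A y ![a, b]⁆) +
      (fderivWithin ℝ (localCurvature S A) S y a ![b, x] +
        ⁅A y fun _ => a, localCurvature S A y ![b, x]⁆) +
      (fderivWithin ℝ (localCurvature S A) S y b ![x, a] +
        ⁅A y fun _ => b, localCurvature S A y ![x, a]⁆) = 0 := by
  have hSy := hS y hy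
  have hA1 : DifferentiableWithinAt ℝ A S y := hA.differentiableWithinAt two_ne_zero
  have hd : DifferentiableWithinAt ℝ (extDerivWithin A S) S y :=
    (hA.extDerivWithin_right (m := 1) hS (by norm_num) hy).differentiableWithinAt one_ne_zero
  have hs : DifferentiableWithinAt ℝ (fun z => squareForm (A z)) S y :=
    ((contDiff_squareForm (m := 1)).differentiable one_ne_zero _).comp_differentiableWithinAt y hA1
  have hsum : fderivWithin ℝ (localCurvature S A) S y =
      fderivWithin ℝ (extDerivWithin A S) S y +
        fderivWithin ℝ (fun z => squareForm (A z)) S y := fderivWithin_add hSy hd hs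
  have hdd : extDerivWithin (extDerivWithin A S) S y ![x, a, b] = 0 := by
    rw [extDerivWithin_extDerivWithin_apply hA (by simp) hS hyc hy]; rfl
  rw [extDerivWithin, ContinuousAlternatingMap.alternatizeUncurryFin_apply,
    Fin.sum_univ_three] at hdd
  obtain ⟨r0, r1, r2⟩ := removeNth_three x a b
  rw [r0, r1, r2] at hdd
  simp only [Matrix.cons_val_zero, Matrix.cons_val_one, Matrix.cons_val, Fin.val_zero, pow_zero,
    one_smul, Fin.val_one, pow_one, Fin.val_two, neg_smul, even_two, Even.neg_pow, one_pow] at hdd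
  -- The sign of the middle term is absorbed by exchanging its arguments, which gives the cyclic
  -- order of the statement.
  rw [← twoForm_swap] at hdd
  have hdA : ∀ p q : W, extDerivWithin A S y ![p, q] =
      (fderivWithin ℝ A S y p fun _ => q) - fderivWithin ℝ A S y q fun _ => p := by
    intro p q
    rw [extDerivWithin, ContinuousAlternatingMap.alternatizeUncurryFin_apply, Fin.sum_univ_two]
    have e0 : Fin.removeNth 0 ![p, q] = fun _ => q := by ext i; fin_cases i; rfl
    have e1 : Fin.removeNth 1 ![p, q] = fun _ => p := by ext i; fin_cases i; rfl
    rw [e0, e1]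
    simp [sub_eq_add_neg]
  have hF : ∀ p q : W, localCurvature S A y ![p, q] =
      ((fderivWithin ℝ A S y p fun _ => q) - fderivWithin ℝ A S y q fun _ => p) +
        ⁅A y fun _ => p, A y fun _ => q⁆ := by
    intro p q
    rw [← hdA]; rfl
  simp only [hsum, add_apply, ContinuousAlternatingMap.add_apply,
    fderivWithin_squareForm_apply hA1 hSy, hF]
  have hj := lie_jacobi (A y fun _ => x) (A y fun _ => a) (A y fun _ => b)
  simp only [lie_add, lie_sub]
  -- By skew-symmetry the brackets of `A` with its derivatives cancel in pairs; what remains is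
  -- `d(dA) = 0` plus the Jacobi identity.
  rw [← lie_skew (A y fun _ => b) (fderivWithin ℝ A S y x fun _ => a),
    ← lie_skew (A y fun _ => x) (fderivWithin ℝ A S y a fun _ => b),
    ← lie_skew (A y fun _ => a) (fderivWithin ℝ A S y b fun _ => x)]
  have := congrArg₂ (· + ·) hdd hj
  simp only [add_zero] at this
  rw [← this]
  abel


/-- The position of the `j`-th argument of the `i`-th factor of a product of two-forms. -/
def twoFormIndex {r N : ℕ} (h : ∑ _i : Fin r, 2 = N) (i : Fin r) (j : Fin 2) : Fin N :=
  Fin.cast h (finSigmaFinEquiv (n := fun _ : Fin r => 2) ⟨i, j⟩)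

theorem twoFormIndex_injective {r N : ℕ} (h : ∑ _i : Fin r, 2 = N) {i i' : Fin r} {j j' : Fin 2}
    (e : twoFormIndex h i j = twoFormIndex h i' j') : i = i' ∧ j = j' := by
  have h1 := finSigmaFinEquiv.injective (Fin.cast_injective h e)
  simpa using h1

theorem wedgePairing_twoForms_apply {r N : ℕ} (f : L [×r]→L[ℝ] V)
    (h : ∑ _i : Fin r, 2 = N) (η : Fin r → W [⋀^Fin 2]→L[ℝ] L) (v : Fin N → W) :
    wedgePairingCMM f (fun _ => 2) h η v = ((2 : ℝ) ^ r)⁻¹ •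
      ∑ σ : Equiv.Perm (Fin N), Equiv.Perm.sign σ •
        f fun i => η i ![(v ∘ σ) (twoFormIndex h i 0), (v ∘ σ) (twoFormIndex h i 1)] := by
  rw [wedgePairingCMM_apply, wedgePairing_apply]
  simp only [Nat.factorial_two, Nat.cast_ofNat, Finset.prod_const, Finset.card_univ,
    Fintype.card_fin]
  congr 1
  refine Finset.sum_congr rfl fun σ _ => ?_
  congr 2
  ext1 i
  congr 1
  exact (fin_two_eta _).symm

theorem cycle_three {α ι : Type*} [DecidableEq ι] (p q s : ι) (hpq : p ≠ q) (hps : p ≠ s)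
    (hqs : q ≠ s) (z : ι → α) :
    (z ∘ (Equiv.swap p q * Equiv.swap q s : Equiv.Perm ι)) p = z q ∧
    (z ∘ (Equiv.swap p q * Equiv.swap q s : Equiv.Perm ι)) q = z s ∧
    (z ∘ (Equiv.swap p q * Equiv.swap q s : Equiv.Perm ι)) s = z p ∧
    ∀ l, l ≠ p → l ≠ q → l ≠ s →
      (z ∘ (Equiv.swap p q * Equiv.swap q s : Equiv.Perm ι)) l = z l := by
  refine ⟨?_, ?_, ?_, fun l h1 h2 h3 => ?_⟩ <;>
    simp only [Function.comp_apply, Equiv.Perm.mul_apply]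
  · rw [Equiv.swap_apply_of_ne_of_ne hpq hps, Equiv.swap_apply_left]
  · rw [Equiv.swap_apply_left, Equiv.swap_apply_of_ne_of_ne hps.symm hqs.symm]
  · rw [Equiv.swap_apply_right, Equiv.swap_apply_right]
  · rw [Equiv.swap_apply_of_ne_of_ne h2 h3, Equiv.swap_apply_of_ne_of_ne h1 h2]

/-- If `Φ(x; a, b)` has vanishing cyclic sums, then so has the alternating sum of
`⟨F ⋯ Φ ⋯ F⟩`. -/
theorem sum_sign_smul_update_eq_zero {r N : ℕ} (f : L [×r]→L[ℝ] V) (h : ∑ _i : Fin r, 2 = N)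
    (F : W [⋀^Fin 2]→L[ℝ] L) (Φ : W → W → W → L)
    (hΦ : ∀ x a b, Φ x a b + Φ a b x + Φ b x a = 0) (k : Fin r) (v : Fin (N + 1) → W) :
    ∑ σ : Equiv.Perm (Fin (N + 1)), Equiv.Perm.sign σ • (fun z : Fin (N + 1) → W =>
      f (Function.update (fun i => F ![z (twoFormIndex h i 0).succ, z (twoFormIndex h i 1).succ]) k
        (Φ (z 0) (z (twoFormIndex h k 0).succ) (z (twoFormIndex h k 1).succ)))) (v ∘ σ) = 0 := by
  have n0 : (0 : Fin (N + 1)) ≠ (twoFormIndex h k 0).succ := (Fin.succ_ne_zero _).symm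
  have n1 : (0 : Fin (N + 1)) ≠ (twoFormIndex h k 1).succ := (Fin.succ_ne_zero _).symm
  have n2 : (twoFormIndex h k 0).succ ≠ (twoFormIndex h k 1).succ := fun e =>
    absurd (twoFormIndex_injective h (Fin.succ_injective _ e)).2 (by decide)
  refine sum_sign_smul_eq_zero_of_cyclic (V := V) (Equiv.swap 0 (twoFormIndex h k 0).succ *
    Equiv.swap (twoFormIndex h k 0).succ (twoFormIndex h k 1).succ) ?_ (fun z : Fin (N + 1) → W =>
      f (Function.update (fun i => F ![z (twoFormIndex h i 0).succ, z (twoFormIndex h i 1).succ]) k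
        (Φ (z 0) (z (twoFormIndex h k 0).succ) (z (twoFormIndex h k 1).succ)))) (fun z => ?_) v
  · rw [Equiv.Perm.sign_mul, Equiv.Perm.sign_swap n0, Equiv.Perm.sign_swap n2]; rfl
  · have hc := cycle_three (α := W) _ _ _ n0 n1 n2
    set c : Equiv.Perm (Fin (N + 1)) := Equiv.swap 0 (twoFormIndex h k 0).succ *
      Equiv.swap (twoFormIndex h k 0).succ (twoFormIndex h k 1).succ with hcdef
    -- The cycle moves only argument `0` and the two arguments of factor `k`. That factor is
    -- overwritten, and the others do not see the cycle.
    have hinv : ∀ (z : Fin (N + 1) → W) (x : L),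
        Function.update (fun i => F ![(z ∘ c) (twoFormIndex h i 0).succ,
          (z ∘ c) (twoFormIndex h i 1).succ]) k x =
        Function.update (fun i => F ![z (twoFormIndex h i 0).succ,
          z (twoFormIndex h i 1).succ]) k x := by
      intro z x
      ext i
      rcases eq_or_ne i k with rfl | hi
      · simp
      · simp only [Function.update_of_ne hi]
        have hne : ∀ j j', (twoFormIndex h i j).succ ≠ (twoFormIndex h k j').succ := fun j j' e =>
          hi (twoFormIndex_injective h (Fin.succ_injective _ e)).1
        rw [(hc z).2.2.2 _ (Fin.succ_ne_zero _) (hne _ _) (hne _ _),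
          (hc z).2.2.2 _ (Fin.succ_ne_zero _) (hne _ _) (hne _ _)]
    simp only [hinv]
    rw [(hc (z ∘ c)).1, (hc (z ∘ c)).2.1, (hc (z ∘ c)).2.2.1, (hc z).1, (hc z).2.1, (hc z).2.2.1,
      ← f.map_update_add, ← f.map_update_add, hΦ]
    exact f.map_update_zero _ _

/-- The Chern-Weil form `⟨F ⋯ F⟩` of an invariant tensor is closed. -/
theorem extDerivWithin_wedgePairing_localCurvature {r N : ℕ} (f : L [×r]→L[ℝ] V)
    (hinv : IsInvariantTensor f) (h : ∑ _i : Fin r, 2 = N)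
    (hA : ContDiffWithinAt ℝ 2 A S y) (hS : UniqueDiffOn ℝ S) (hy : y ∈ S)
    (hyc : y ∈ closure (interior S)) :
    extDerivWithin (fun z => wedgePairingCMM f (fun _ => 2) h fun _ => localCurvature S A z) S y =
      0 := by
  set D := fderivWithin ℝ (localCurvature S A) S y with hD
  set F := localCurvature S A y with hFdef
  have hF : HasFDerivWithinAt (localCurvature S A) D S y :=
    ((hA.localCurvature (m := 1) hS (by norm_num) hy).differentiableWithinAt
      one_ne_zero).hasFDerivWithinAt
  have hFr : HasFDerivWithinAt (fun z (_ : Fin r) => localCurvature S A z)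
      (ContinuousLinearMap.pi fun _ : Fin r => D) S y := hasFDerivWithinAt_pi.2 fun _ => hF
  have hG := ((wedgePairingCMM (W := W) f (fun _ => 2) h).hasFDerivAt
    (fun _ => F)).comp_hasFDerivWithinAt y hFr
  ext v
  rw [extDerivWithin, show (fun z => wedgePairingCMM f (fun _ => 2) h fun _ =>
    localCurvature S A z) = (wedgePairingCMM (W := W) f (fun _ => 2) h) ∘
      (fun z _ => localCurvature S A z) from rfl, hG.fderivWithin (hS y hy),
    ContinuousAlternatingMap.alternatizeUncurryFin_apply]
  -- The Leibniz term in which factor `k` is differentiated, the direction of differentiation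
  -- occupying argument `0`.
  let M : Fin r → (Fin (N + 1) → W) → V := fun k z =>
    f (Function.update (fun i => F ![z (twoFormIndex h i 0).succ, z (twoFormIndex h i 1).succ]) k
      (D (z 0) ![z (twoFormIndex h k 0).succ, z (twoFormIndex h k 1).succ]))
  have h1 : ∀ i : Fin (N + 1), (-1 : ℤ) ^ (i : ℕ) •
      (((wedgePairingCMM (W := W) f (fun _ => 2) h).linearDeriv (fun _ => F)).comp
        (ContinuousLinearMap.pi fun _ : Fin r => D)) (v i) (i.removeNth v) =
      ((2 : ℝ) ^ r)⁻¹ • ∑ k, (-1 : ℤˣ) ^ (i : ℕ) • ∑ e : Equiv.Perm (Fin N),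
        Equiv.Perm.sign e • M k (Fin.cons (v i) (i.removeNth v ∘ e)) := by
    intro i
    rw [ContinuousLinearMap.comp_apply, ContinuousMultilinearMap.linearDeriv_apply,
      ContinuousAlternatingMap.sum_apply]
    simp only [wedgePairing_twoForms_apply]
    rw [← Finset.smul_sum, smul_comm, Finset.smul_sum]
    congr 1
    refine Finset.sum_congr rfl fun k _ => ?_
    rw [Units.smul_def, Units.val_pow_eq_pow_val, Units.val_neg, Units.val_one]
    congr 1
    refine Finset.sum_congr rfl fun e _ => ?_
    congr 1
    simp only [M, Fin.cons_succ, Fin.cons_zero]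
    congr 1
    ext1 l
    rcases eq_or_ne l k with rfl | hl
    · simp
    · simp [hl]
  rw [Finset.sum_congr rfl fun i _ => h1 i, ← Finset.smul_sum, Finset.sum_comm]
  simp only [← sum_sign_smul_removeNth]
  rw [Finset.sum_comm]
  simp only [← Finset.smul_sum]
  -- Invariance, with `Y` the value of `A` on argument `0`, says that the added brackets sum to
  -- zero. Each derivative `dF` thereby becomes `dF + [A, F]`, to which the Bianchi identity applies
  -- factor by factor.
  have h2 : ∀ z : Fin (N + 1) → W, ∑ k, M k z = ∑ k,
      f (Function.update (fun i => F ![z (twoFormIndex h i 0).succ, z (twoFormIndex h i 1).succ]) k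
        (D (z 0) ![z (twoFormIndex h k 0).succ, z (twoFormIndex h k 1).succ] +
          ⁅A y fun _ => z 0, F ![z (twoFormIndex h k 0).succ, z (twoFormIndex h k 1).succ]⁆)) := by
    intro z
    simp only [f.map_update_add, Finset.sum_add_distrib]
    rw [hinv (A y fun _ => z 0)
      (fun i => F ![z (twoFormIndex h i 0).succ, z (twoFormIndex h i 1).succ]), add_zero]
  simp only [h2, Finset.smul_sum]
  rw [Finset.sum_comm]
  refine Finset.sum_eq_zero fun k _ => ?_
  rw [← Finset.smul_sum, sum_sign_smul_update_eq_zero f h F (fun x a b =>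
    D x ![a, b] + ⁅A y fun _ => x, F ![a, b]⁆) (bianchi hA hS hy hyc) k v, smul_zero]

end ChernWeil

/-! ### Fubini, the divergence theorem and symmetries of the coordinate simplex. -/

section Simplex

open MeasureTheory Set

variable {V : Type*} [NormedAddCommGroup V] [NormedSpace ℝ V]

theorem isCompact_coordSimplex (q : ℕ) : IsCompact (coordSimplex q) := by
  refine (isCompact_Icc (a := (0 : Fin q → ℝ)) (b := 1)).of_isClosed_subset ?_ ?_
  · refine IsClosed.inter ?_ ?_
    · have h : {τ : Fin q → ℝ | ∀ i, 0 ≤ τ i} = ⋂ i, {τ : Fin q → ℝ | 0 ≤ τ i} := by ext; simp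
      change IsClosed {τ : Fin q → ℝ | ∀ i, 0 ≤ τ i}
      rw [h]
      exact isClosed_iInter fun i => isClosed_le continuous_const (continuous_apply i)
    · exact isClosed_le (continuous_finsetSum _ fun i _ => continuous_apply i) continuous_const
  · intro τ hτ
    refine ⟨hτ.1, fun i => ?_⟩
    exact (Finset.single_le_sum (fun j _ => hτ.1 j) (Finset.mem_univ i)).trans hτ.2

/-- The slice of the simplex in direction `k` over `τ` is the interval from `0` to `1 - ∑ τ`; this
is the domain needed for Fubini. -/
theorem insertNth_mem_coordSimplex {q : ℕ} (k : Fin (q + 1)) (s : ℝ) (τ : Fin q → ℝ) :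
    k.insertNth s τ ∈ coordSimplex (q + 1) ↔
      τ ∈ coordSimplex q ∧ s ∈ Icc 0 (1 - ∑ i, τ i) := by
  have h1 : (∀ i, 0 ≤ (k.insertNth s τ : Fin (q + 1) → ℝ) i) ↔ 0 ≤ s ∧ ∀ i, 0 ≤ τ i := by
    rw [Fin.forall_iff_succAbove k]; simp
  have h2 : ∑ i, (k.insertNth s τ : Fin (q + 1) → ℝ) i = s + ∑ i, τ i := by
    rw [Fin.sum_univ_succAbove _ k]; simp
  simp only [coordSimplex, mem_ofPred_eq, h1, h2, mem_Icc]
  constructor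
  · rintro ⟨⟨h, h'⟩, h''⟩
    exact ⟨⟨h', by linarith⟩, h, by linarith⟩
  · rintro ⟨⟨h, h'⟩, h'', h'''⟩
    exact ⟨⟨h'', h⟩, by linarith⟩

theorem setIntegral_coordSimplex_succ {q : ℕ} (k : Fin (q + 1)) {h : (Fin (q + 1) → ℝ) → V}
    (hh : Continuous h) :
    ∫ τ in coordSimplex (q + 1), h τ =
      ∫ τ in coordSimplex q, ∫ s in (0 : ℝ)..(1 - ∑ i, τ i), h (k.insertNth s τ) := by
  set e := MeasurableEquiv.piFinSuccAbove (fun _ : Fin (q + 1) => ℝ) k with he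
  have hmp : MeasurePreserving e volume volume := volume_preserving_piFinSuccAbove (fun _ => ℝ) k
  have hsymm : ∀ p : ℝ × (Fin q → ℝ), e.symm p = k.insertNth p.1 p.2 := fun p => rfl
  have hint : IntegrableOn h (coordSimplex (q + 1)) :=
    hh.continuousOn.integrableOn_compact (isCompact_coordSimplex _)
  set R : Set (ℝ × (Fin q → ℝ)) := e.symm ⁻¹' coordSimplex (q + 1) with hR
  have hRm : MeasurableSet R := e.symm.measurable (isCompact_coordSimplex _).measurableSet
  have hmem : ∀ s τ, (s, τ) ∈ R ↔ τ ∈ coordSimplex q ∧ s ∈ Icc 0 (1 - ∑ i, τ i) :=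
    fun s τ => insertNth_mem_coordSimplex k s τ
  have h1 : ∫ τ in coordSimplex (q + 1), h τ = ∫ p in R, h (e.symm p) :=
    ((hmp.symm e).setIntegral_preimage_emb e.symm.measurableEmbedding h _).symm
  have hint' : IntegrableOn (fun p => h (e.symm p)) R :=
    ((hmp.symm e).integrableOn_comp_preimage e.symm.measurableEmbedding).2 hint
  rw [h1, ← integral_indicator hRm, Measure.volume_eq_prod,
    integral_prod_symm _ ((integrable_indicator_iff hRm).2 hint'),
    ← integral_indicator (isCompact_coordSimplex q).measurableSet]
  refine integral_congr_ae (Filter.Eventually.of_forall fun τ => ?_)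
  by_cases hτ : τ ∈ coordSimplex q
  · have hnn : 0 ≤ 1 - ∑ i, τ i := sub_nonneg.2 hτ.2
    simp only [indicator_of_mem hτ]
    rw [intervalIntegral.integral_of_le hnn, ← integral_Icc_eq_integral_Ioc,
      ← integral_indicator measurableSet_Icc]
    congr 1
    ext1 s
    simp only [indicator, hmem, hτ, true_and]
    rfl
  · simp only [indicator_of_notMem hτ]
    rw [← integral_zero ℝ V (μ := volume)]
    congr 1
    ext1 s
    simp [indicator, hmem, hτ]

theorem hasDerivAt_insertNth {q : ℕ} (k : Fin (q + 1)) (τ : Fin q → ℝ) (s : ℝ) :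
    HasDerivAt (fun s : ℝ => (k.insertNth s τ : Fin (q + 1) → ℝ)) (Pi.single k 1) s := by
  rw [hasDerivAt_pi]
  intro i
  refine k.succAboveCases ?_ (fun j => ?_) i
  · simpa using hasDerivAt_id' s
  · simpa [Fin.succAbove_ne] using hasDerivAt_const s (τ j)

/-- The divergence theorem on the coordinate simplex, in the direction of a coordinate. -/
theorem setIntegral_coordSimplex_fderiv [CompleteSpace V] {q : ℕ} (k : Fin (q + 1))
    {g : (Fin (q + 1) → ℝ) → V} (hg : ContDiff ℝ 1 g) :
    ∫ τ in coordSimplex (q + 1), fderiv ℝ g τ (Pi.single k 1) =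
      ∫ τ in coordSimplex q,
        (g (k.insertNth (1 - ∑ i, τ i) τ) - g (k.insertNth 0 τ)) := by
  have hc : Continuous fun τ => fderiv ℝ g τ (Pi.single k 1) :=
    (hg.continuous_fderiv one_ne_zero).clm_apply continuous_const
  rw [setIntegral_coordSimplex_succ k hc]
  refine integral_congr_ae (Filter.Eventually.of_forall fun τ => ?_)
  have hins : Continuous fun s : ℝ => (k.insertNth s τ : Fin (q + 1) → ℝ) :=
    continuous_iff_continuousAt.2 fun s => (hasDerivAt_insertNth k τ s).continuousAt
  refine intervalIntegral.integral_eq_sub_of_hasDerivAt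
    (f := fun s : ℝ => g (k.insertNth s τ)) (fun s _ => ?_)
    ((hc.comp hins).intervalIntegrable _ _)
  exact ((hg.differentiable one_ne_zero _).hasFDerivAt).comp_hasDerivAt s
    (hasDerivAt_insertNth k τ s)

/-- Exchange of the `j`-th coordinate with the remaining barycentric coordinate. -/
def simplexReflection {q : ℕ} (j : Fin q) (τ : Fin q → ℝ) : Fin q → ℝ :=
  Function.update τ j (1 - ∑ i, τ i)

theorem sum_update_eq {q : ℕ} (j : Fin q) (τ : Fin q → ℝ) (c : ℝ) :
    ∑ i, Function.update τ j c i = c + (∑ i, τ i - τ j) := by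
  rw [Finset.sum_update_of_mem (Finset.mem_univ j), Finset.sum_sdiff_eq_sub (by simp)]
  simp

theorem one_sub_sum_simplexReflection {q : ℕ} (j : Fin q) (τ : Fin q → ℝ) :
    1 - ∑ i, simplexReflection j τ i = τ j := by
  rw [simplexReflection, sum_update_eq]; ring

theorem simplexReflection_involutive {q : ℕ} (j : Fin q) :
    Function.Involutive (simplexReflection j) := by
  intro τ
  rw [simplexReflection, one_sub_sum_simplexReflection, simplexReflection]
  simp

theorem measurePreserving_simplexReflection {q : ℕ} (j : Fin q) :
    MeasurePreserving (simplexReflection j) volume volume := by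
  -- The linear part of the reflection. It is an involution, so its determinant is `±1`; composing
  -- with a translation keeps the volume.
  let Λ : (Fin q → ℝ) →ₗ[ℝ] (Fin q → ℝ) :=
    { toFun := fun τ => Function.update τ j (- ∑ i, τ i)
      map_add' := fun τ τ' => by
        ext i
        rcases eq_or_ne i j with rfl | hi
        · simp [Finset.sum_add_distrib]; ring
        · simp [hi]
      map_smul' := fun c τ => by
        ext i
        rcases eq_or_ne i j with rfl | hi
        · simp [Finset.mul_sum]
        · simp [hi] }
  have hΛ : ∀ τ, Λ τ = Function.update τ j (- ∑ i, τ i) := fun _ => rfl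
  have hinv : Λ ∘ₗ Λ = LinearMap.id := by
    ext1 i
    ext1
    simp only [LinearMap.comp_apply, hΛ, sum_update_eq]
    simp
  have hdet : LinearMap.det Λ * LinearMap.det Λ = 1 := by
    rw [← LinearMap.det_comp, hinv, LinearMap.det_id]
  have habs : |(LinearMap.det Λ)⁻¹| = 1 := by
    rcases mul_self_eq_one_iff.1 hdet with h | h <;> simp [h]
  have hne : LinearMap.det Λ ≠ 0 := fun h => by simp [h] at hdet
  have h1 : MeasurePreserving Λ volume volume := by
    refine ⟨Λ.continuous_of_finiteDimensional.measurable, ?_⟩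
    rw [Real.map_linearMap_volume_pi_eq_smul_volume_pi hne, habs, ENNReal.ofReal_one, one_smul]
  have h2 : simplexReflection j = (fun x => x + Pi.single j 1) ∘ Λ := by
    ext τ i
    rcases eq_or_ne i j with rfl | hi
    · simp [simplexReflection, hΛ]; ring
    · simp [simplexReflection, hΛ, hi]
  rw [h2]
  exact (measurePreserving_add_right volume _).comp h1

theorem simplexReflection_mem {q : ℕ} (j : Fin q) (τ : Fin q → ℝ) :
    simplexReflection j τ ∈ coordSimplex q ↔ τ ∈ coordSimplex q := by
  have key : ∀ τ : Fin q → ℝ, τ ∈ coordSimplex q → simplexReflection j τ ∈ coordSimplex q := by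
    intro τ hτ
    refine ⟨fun i => ?_, ?_⟩
    · rcases eq_or_ne i j with rfl | hi
      · simpa [simplexReflection] using hτ.2
      · simpa [simplexReflection, hi] using hτ.1 i
    · have := one_sub_sum_simplexReflection j τ
      linarith [hτ.1 j]
  exact ⟨fun h => by simpa [simplexReflection_involutive j τ] using key _ h, key τ⟩

/-- The slanted face can be parametrized by omitting any one coordinate. For two neighbouring
coordinates the parametrizations differ by a reflection, which preserves volume and the simplex. -/
theorem insertNth_castSucc_simplexReflection {q : ℕ} (j : Fin q) (τ : Fin q → ℝ) :
    (j.castSucc.insertNth (1 - ∑ i, simplexReflection j τ i) (simplexReflection j τ) :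
      Fin (q + 1) → ℝ) = j.succ.insertNth (1 - ∑ i, τ i) τ := by
  have e1 : j.succ.succAbove j = j.castSucc := by
    ext; simp [Fin.succAbove, Fin.lt_def]
  have e2 : j.castSucc.succAbove j = j.succ := by
    ext; simp [Fin.succAbove]
  rw [Fin.insertNth_eq_iff]
  constructor
  · rw [one_sub_sum_simplexReflection, ← e1, Fin.insertNth_apply_succAbove]
  · ext i
    simp only [Fin.removeNth]
    rcases eq_or_ne i j with rfl | hi
    · rw [e2, Fin.insertNth_apply_same]
      simp [simplexReflection]
    · have : j.castSucc.succAbove i = j.succ.succAbove i := by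
        have := Fin.val_ne_of_ne hi
        ext
        simp only [Fin.succAbove, Fin.lt_def, Fin.val_castSucc, Fin.val_succ]
        split_ifs <;> simp only [Fin.val_castSucc, Fin.val_succ] <;> omega
      rw [this, Fin.insertNth_apply_succAbove]
      simp [simplexReflection, hi]

theorem setIntegral_coordSimplex_comp_simplexReflection {q : ℕ} (j : Fin q)
    (g : (Fin q → ℝ) → V) :
    ∫ τ in coordSimplex q, g (simplexReflection j τ) = ∫ τ in coordSimplex q, g τ := by
  have hm := measurePreserving_simplexReflection j
  let e : (Fin q → ℝ) ≃ᵐ (Fin q → ℝ) :=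
    { toEquiv := (simplexReflection_involutive j).toPerm
      measurable_toFun := hm.measurable
      measurable_invFun := hm.measurable }
  have hset : simplexReflection j ⁻¹' coordSimplex q = coordSimplex q :=
    Set.ext fun τ => simplexReflection_mem j τ
  have h := hm.setIntegral_preimage_emb e.measurableEmbedding g (coordSimplex q)
  rwa [hset] at h

/-- The integral over the face opposite to the origin does not depend on the parametrization. -/
theorem setIntegral_coordSimplex_insertNth {q : ℕ} (k : Fin (q + 1)) (g : (Fin (q + 1) → ℝ) → V) :
    ∫ τ in coordSimplex q, g (k.insertNth (1 - ∑ i, τ i) τ) =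
      ∫ τ in coordSimplex q, g ((0 : Fin (q + 1)).insertNth (1 - ∑ i, τ i) τ) := by
  induction k using Fin.induction with
  | zero => rfl
  | succ j ih =>
    rw [← ih]
    rw [← setIntegral_coordSimplex_comp_simplexReflection j
      fun τ => g (j.castSucc.insertNth (1 - ∑ i, τ i) τ)]
    simp only [insertNth_castSucc_simplexReflection]

end Simplex

/-! ### Differentiation under the integral sign within a convex set. -/

section ParametricIntegral

open MeasureTheory Set Topology

/-- Differentiation under the integral sign over a compact set, within a convex set. -/
theorem hasFDerivWithinAt_setIntegral_of_convex {E T X : Type*} [NormedAddCommGroup E]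
    [NormedSpace ℝ E] [TopologicalSpace T] [T2Space T] [SecondCountableTopology T]
    [MeasurableSpace T] [BorelSpace T] {μ : Measure T} [IsFiniteMeasureOnCompacts μ]
    [NormedAddCommGroup X] [NormedSpace ℝ X] [CompleteSpace X] {S U : Set E} {K : Set T} {y₀ : E}
    (hS : Convex ℝ S) (hy₀ : y₀ ∈ S) (hUS : U ⊆ S) (hU : U ∈ 𝓝[S] y₀) (hK : IsCompact K)
    {g : E → T → X} {g' : E → T → E →L[ℝ] X}
    (hg : ∀ y ∈ U, ∀ τ ∈ K, HasFDerivWithinAt (fun z => g z τ) (g' y τ) S y)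
    (hg' : ContinuousOn (fun p : E × T => g' p.1 p.2) (U ×ˢ K))
    (hint : ∀ y ∈ U, IntegrableOn (g y) K μ) :
    HasFDerivWithinAt (fun y => ∫ τ in K, g y τ ∂μ) (∫ τ in K, g' y₀ τ ∂μ) S y₀ := by
  have hy₀U : y₀ ∈ U := mem_of_mem_nhdsWithin hy₀ hU
  have hint' : IntegrableOn (g' y₀) K μ := by
    refine ContinuousOn.integrableOn_compact hK ?_
    exact hg'.comp (continuousOn_const.prodMk continuousOn_id) fun τ hτ => ⟨hy₀U, hτ⟩
  rw [hasFDerivWithinAt_iff_isLittleO, Asymptotics.isLittleO_iff]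
  intro c hc
  set m := μ.real K with hm
  have hm0 : 0 ≤ m := measureReal_nonneg
  -- The summand `1` keeps the quotient meaningful when `K` has measure zero.
  set ε := c / (m + 1) with hε
  have hε0 : 0 < ε := by positivity
  -- Compactness of `K` makes the derivatives at `y` and `y₀` close uniformly in `τ`, for `y` near
  -- `y₀` within `U`.
  obtain ⟨v, hv, hvK⟩ := hK.mem_uniformity_of_prod (f := g') (s := U) (q := y₀)
    hg' hy₀U (Metric.dist_mem_uniformity hε0)
  have hUn : 𝓝[U] y₀ = 𝓝[S] y₀ := by
    refine le_antisymm (nhdsWithin_mono _ hUS) ?_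
    rw [nhdsWithin, nhdsWithin]
    exact le_inf inf_le_left (Filter.le_principal_iff.2 hU)
  rw [hUn] at hv
  obtain ⟨δ, hδ, hball⟩ := Metric.mem_nhdsWithin_iff.1 (Filter.inter_mem hv hU)
  have hCS : Metric.ball y₀ δ ∩ S ∈ 𝓝[S] y₀ :=
    Filter.inter_mem (mem_nhdsWithin_of_mem_nhds (Metric.ball_mem_nhds _ hδ)) self_mem_nhdsWithin
  filter_upwards [hCS] with y hy
  have hyU : y ∈ U := (hball hy).2
  -- The mean value inequality on the convex set `ball ∩ S`; convexity of `S` is needed for the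
  -- segment from `y₀` to `y` to stay in the domain.
  have hbound : ∀ τ ∈ K, ‖g y τ - g y₀ τ - g' y₀ τ (y - y₀)‖ ≤ ε * ‖y - y₀‖ := by
    intro τ hτ
    refine Convex.norm_image_sub_le_of_norm_hasFDerivWithin_le' (f := fun z => g z τ)
      (f' := fun z => g' z τ) (s := Metric.ball y₀ δ ∩ S)
      (fun z hz => (hg z (hball hz).2 τ hτ).mono inter_subset_right) (fun z hz => ?_)
      ((convex_ball _ _).inter hS) ⟨Metric.mem_ball_self hδ, hy₀⟩ hy
    have := hvK z (hball hz).1 τ hτ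
    rw [← dist_eq_norm]
    exact (show dist (g' z τ) (g' y₀ τ) < ε from this).le
  have happ : (∫ τ in K, g' y₀ τ ∂μ) (y - y₀) = ∫ τ in K, g' y₀ τ (y - y₀) ∂μ :=
    ContinuousLinearMap.integral_apply hint' _
  have hi1 : IntegrableOn (fun τ => g' y₀ τ (y - y₀)) K μ :=
    (ContinuousLinearMap.apply ℝ X (y - y₀)).integrable_comp hint'
  have heq : (∫ τ in K, g y τ ∂μ) - (∫ τ in K, g y₀ τ ∂μ) - (∫ τ in K, g' y₀ τ ∂μ) (y - y₀) =
      ∫ τ in K, (g y τ - g y₀ τ - g' y₀ τ (y - y₀)) ∂μ := by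
    rw [happ, ← integral_sub (hint y hyU) (hint y₀ hy₀U), ← integral_sub _ hi1]
    exact (hint y hyU).sub (hint y₀ hy₀U)
  rw [heq]
  refine (norm_setIntegral_le_of_norm_le_const hK.measure_lt_top hbound).trans ?_
  rw [← hm, mul_right_comm]
  refine mul_le_mul_of_nonneg_right ?_ (norm_nonneg _)
  rw [hε, div_mul_eq_mul_div, div_le_iff₀ (by positivity)]
  nlinarith

end ParametricIntegral

/-! ### Alternating maps in the first block of arguments, and removal of one argument. -/

section HeadAlternating

variable {W V : Type*} [NormedAddCommGroup W] [NormedSpace ℝ W]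
  [NormedAddCommGroup V] [NormedSpace ℝ V]

/-- Terms with `c` in two places vanish by alternation, so the multilinear expansion stops at first
order. -/
theorem AlternatingMap.map_add_const {ι : Type*} [DecidableEq ι] [Fintype ι]
    (M : W [⋀^ι]→ₗ[ℝ] V) (x : ι → W) (c : W) :
    M (fun i => x i + c) = M x + ∑ i, M (Function.update x i c) := by
  have key : ∀ (s : Finset ι) (x : ι → W), M (fun i => if i ∈ s then x i + c else x i) =
      M x + ∑ i ∈ s, M (Function.update x i c) := by
    intro s
    induction s using Finset.induction_on with
    | empty => intro x; simp
    | insert j s hj ih =>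
      intro x
      have e : ∀ b : W, (fun i => if i ∈ s then Function.update x j b i + c
          else Function.update x j b i) =
          Function.update (fun i => if i ∈ s then x i + c else x i) j b := by
        intro b
        ext i
        rcases eq_or_ne i j with rfl | hi
        · simp [hj]
        · simp [hi]
      have e1 : (fun i => if i ∈ insert j s then x i + c else x i) =
          Function.update (fun i => if i ∈ s then x i + c else x i) j (x j + c) := by
        ext i
        rcases eq_or_ne i j with rfl | hi
        · simp
        · simp [hi]
      have hz : ∑ i ∈ s, M (Function.update (Function.update x j c) i c) = 0 := by
        refine Finset.sum_eq_zero fun i hi => ?_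
        have hij : i ≠ j := fun h => hj (h ▸ hi)
        exact M.map_eq_zero_of_eq _ (by simp [hij.symm]) hij
      rw [e1, M.map_update_add, ← e, ← e, ih, ih, hz, Finset.sum_insert hj,
        Function.update_eq_self]
      abel
  simpa using key Finset.univ x

/-- Subtraction of the first vector from the others expands an alternating map as a cochain
differential. -/
theorem AlternatingMap.map_succ_sub_zero {q : ℕ} (M : W [⋀^Fin q]→ₗ[ℝ] V) (u : Fin (q + 1) → W) :
    M (fun i => u i.succ - u 0) =
      ∑ k : Fin (q + 1), (-1 : ℤ) ^ (k : ℕ) • M fun i => u (k.succAbove i) := by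
  cases q with
  | zero =>
    rw [Fin.sum_univ_succ, Fin.sum_univ_zero, add_zero, Fin.val_zero, pow_zero, one_smul]
    exact congrArg M (Subsingleton.elim _ _)
  | succ q =>
    have e0 : (fun i : Fin (q + 1) => u i.succ - u 0) = fun i => u i.succ + -u 0 :=
      funext fun i => sub_eq_add_neg _ _
    rw [e0, M.map_add_const, Fin.sum_univ_succ (n := q + 1)]
    simp only [Fin.val_zero, pow_zero, one_smul, Fin.zero_succAbove, Fin.val_succ]
    congr 1
    refine Finset.sum_congr rfl fun i _ => ?_
    -- Moving the replaced entry to the front costs `(-1) ^ i`; with the sign of `-u 0` this is the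
    -- `(-1) ^ (i + 1)` of the differential.
    rw [← Fin.insertNth_removeNth, M.map_insertNth]
    have e1 : (fun j => u (i.succ.succAbove j)) =
        Matrix.vecCons (u 0) (i.removeNth fun j => u j.succ) := by
      ext j
      refine Fin.cases ?_ (fun j => ?_) j
      · simp
      · simp [Fin.removeNth]
    rw [e1]
    have e2 : M (Matrix.vecCons (-u 0) (i.removeNth fun j => u j.succ)) =
        - M (Matrix.vecCons (u 0) (i.removeNth fun j => u j.succ)) := by
      have := M.map_update_neg (Matrix.vecCons (u 0) (i.removeNth fun j => u j.succ)) 0 (u 0)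
      have e3 : ∀ b, Function.update (Matrix.vecCons (u 0) (i.removeNth fun j => u j.succ)) 0 b =
          Matrix.vecCons b (i.removeNth fun j => u j.succ) := by
        intro b
        ext j
        refine Fin.cases ?_ (fun j => ?_) j <;> simp
      rwa [e3, e3] at this
    rw [e2, pow_succ]
    simp

theorem headTail_update {α : Type*} {N a q : ℕ} (h : a + q = N) (u : Fin q → α) (v : Fin a → α)
    (i : Fin q) (c : α) : headTail h (Function.update u i c) v =
      Function.update (headTail h u v) (Fin.castLE (by omega) i) c := by
  ext k
  rcases eq_or_ne k (Fin.castLE (by omega) i) with rfl | hk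
  · simp [headTail]
  · rw [Function.update_of_ne hk]
    simp only [headTail]
    split_ifs with hkq
    · rw [Function.update_of_ne]
      rintro rfl
      exact hk rfl
    · rfl

/-- An alternating map as an alternating map of its first arguments. -/
def headAlternating {N a q : ℕ} (h : a + q = N) (Ω : W [⋀^Fin N]→L[ℝ] V) (v : Fin a → W) :
    W [⋀^Fin q]→ₗ[ℝ] V where
  toFun u := Ω (headTail h u v)
  map_update_add' := by
    intro _ u i x y
    -- The structure field quantifies over the decidability instance, whereas `headTail_update` uses
    -- the standard one.
    have e : ‹DecidableEq (Fin q)› = instDecidableEqFin q := Subsingleton.elim _ _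
    subst e
    simp only [headTail_update]
    exact Ω.map_update_add _ _ _ _
  map_update_smul' := by
    intro _ u i c x
    have e : ‹DecidableEq (Fin q)› = instDecidableEqFin q := Subsingleton.elim _ _
    subst e
    simp only [headTail_update]
    exact Ω.map_update_smul _ _ _ _
  map_eq_zero_of_eq' := by
    intro u i j hu hij
    refine Ω.map_eq_zero_of_eq (i := Fin.castLE (by omega) i) (j := Fin.castLE (by omega) j) _ ?_
      (fun e => hij (Fin.castLE_injective _ e))
    simpa [headTail] using hu

theorem headTail_of_lt {α : Type*} {N a q : ℕ} (h : a + q = N) (u : Fin q → α) (v : Fin a → α)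
    {k : Fin N} (i : Fin q) (hk : k.1 = i.1) : headTail h u v k = u i := by
  have h1 : k.1 < q := hk ▸ i.2
  simp only [headTail, h1, dite_true]
  congr 1
  exact Fin.ext hk

theorem headTail_of_ge {α : Type*} {N a q : ℕ} (h : a + q = N) (u : Fin q → α) (v : Fin a → α)
    {k : Fin N} (j : Fin a) (hk : k.1 = q + j.1) : headTail h u v k = v j := by
  have h1 : ¬ k.1 < q := by omega
  simp only [headTail, h1, dite_false]
  congr 1
  exact Fin.ext (by simp [hk])

theorem val_succAbove {n : ℕ} (p : Fin (n + 1)) (i : Fin n) :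
    (p.succAbove i).1 = if i.1 < p.1 then i.1 else i.1 + 1 := by
  rw [Fin.succAbove]
  simp only [Fin.lt_def, Fin.val_castSucc]
  split_ifs <;> rfl

/-- The exterior derivative evaluated on `(u, v)` omits one argument at a time; here the omitted one
belongs to the first block, and `removeNth_headTail_right` treats the second. -/
theorem removeNth_headTail_left {α : Type*} {N a q : ℕ} (h : a + (q + 1) = N + 1) (h' : a + q = N)
    (u : Fin (q + 1) → α) (v : Fin a → α) (k : Fin (q + 1)) :
    (Fin.castLE (by omega) k : Fin (N + 1)).removeNth (headTail h u v) =
      headTail h' (fun i => u (k.succAbove i)) v := by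
  ext i
  have hk := k.2
  rcases lt_or_ge i.1 q with hi | hi
  · rw [headTail_of_lt h' _ _ ⟨i, hi⟩ rfl]
    refine headTail_of_lt _ _ _ _ ?_
    rw [val_succAbove, val_succAbove]; rfl
  · rw [headTail_of_ge h' _ _ ⟨i - q, by omega⟩ (by simp; omega)]
    refine headTail_of_ge _ _ _ _ ?_
    rw [val_succAbove]
    simp only [Fin.val_castLE]
    split_ifs <;> omega

theorem removeNth_headTail_right {α : Type*} {N a q : ℕ} (h : (a + 1) + q = N + 1) (h' : a + q = N)
    (u : Fin q → α) (v : Fin (a + 1) → α) (j : Fin (a + 1)) :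
    (⟨q + j, by omega⟩ : Fin (N + 1)).removeNth (headTail h u v) =
      headTail h' u (fun i => v (j.succAbove i)) := by
  ext i
  have hj := j.2
  rcases lt_or_ge i.1 q with hi | hi
  · rw [headTail_of_lt h' _ _ ⟨i, hi⟩ rfl]
    refine headTail_of_lt _ _ _ _ ?_
    rw [val_succAbove]
    split_ifs
    all_goals first | omega | (simp only at *; done) | (simp only at *; omega)
  · rw [headTail_of_ge h' _ _ ⟨i - q, by omega⟩ (by simp; omega)]
    refine headTail_of_ge _ _ _ _ ?_
    rw [val_succAbove, val_succAbove]
    split_ifs <;> simp only at * <;> omega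

theorem sum_univ_headTail {V : Type*} [AddCommMonoid V] {N a q : ℕ} (h : a + q = N)
    (g : Fin N → V) :
    ∑ l, g l = (∑ k : Fin q, g (Fin.castLE (by omega) k)) +
      ∑ j : Fin a, g ⟨q + j, by omega⟩ := by
  rw [← Fintype.sum_equiv (finCongr (show q + a = N by omega))
    (fun l => g (Fin.cast (by omega) l)) g
    (fun _ => rfl), Fin.sum_univ_add]
  rfl

end HeadAlternating

/-! ### Stokes' theorem for integration of a closed form along simplex fibres. -/

section FibreStokes

open MeasureTheory Set Topology

variable {E V : Type*} [NormedAddCommGroup E] [NormedSpace ℝ E]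
  [NormedAddCommGroup V] [NormedSpace ℝ V]

theorem contDiff_simplexPoint {m q : ℕ} (w : Fin (q + 1) → Fin (m + 1) → ℝ)
    {k : WithTop ℕ∞} : ContDiff ℝ k (simplexPoint w) := by
  unfold simplexPoint
  exact contDiff_const.add (ContDiff.sum fun i _ => (contDiff_apply ℝ ℝ i).smul contDiff_const)

theorem fderiv_simplexPoint {m q : ℕ} (w : Fin (q + 1) → Fin (m + 1) → ℝ) (τ : Fin q → ℝ)
    (k : Fin q) : fderiv ℝ (simplexPoint w) τ (Pi.single k 1) = w k.succ - w 0 := by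
  have h : HasFDerivAt (simplexPoint w)
      (∑ i, (ContinuousLinearMap.proj (R := ℝ) (φ := fun _ : Fin q => ℝ) i).smulRight
        (w i.succ - w 0)) τ := by
    unfold simplexPoint
    refine HasFDerivAt.const_add _ (HasFDerivAt.fun_sum fun i _ => ?_)
    exact (ContinuousLinearMap.proj (R := ℝ) (φ := fun _ : Fin q => ℝ) i).hasFDerivAt.smul_const _
  rw [h.fderiv]
  simp [Pi.single_apply]

theorem simplexPoint_insertNth {m q : ℕ} (w : Fin (q + 2) → Fin (m + 1) → ℝ) (k : Fin (q + 1))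
    (s : ℝ) (τ : Fin q → ℝ) :
    simplexPoint w (k.insertNth s τ) =
      w 0 + (s • (w k.succ - w 0) + ∑ i, τ i • (w (k.succAbove i).succ - w 0)) := by
  rw [simplexPoint, Fin.sum_univ_succAbove _ k]
  simp

/-- The face opposite `w 0` is the slanted face: the barycentric weight of its own first vertex is
`1 - ∑ τ`. -/
theorem simplexPoint_face_zero {m q : ℕ} (w : Fin (q + 2) → Fin (m + 1) → ℝ) (τ : Fin q → ℝ) :
    simplexPoint (fun i => w ((0 : Fin (q + 2)).succAbove i)) τ =
      simplexPoint w ((0 : Fin (q + 1)).insertNth (1 - ∑ i, τ i) τ) := by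
  rw [simplexPoint_insertNth, simplexPoint]
  simp only [Fin.zero_succAbove, Fin.succ_zero_eq_one, smul_sub, Finset.sum_sub_distrib,
    sub_smul, one_smul, ← Finset.sum_smul]
  abel

theorem simplexPoint_face_succ {m q : ℕ} (w : Fin (q + 2) → Fin (m + 1) → ℝ) (k : Fin (q + 1))
    (τ : Fin q → ℝ) : simplexPoint (fun i => w (k.succ.succAbove i)) τ =
      simplexPoint w (k.insertNth 0 τ) := by
  rw [simplexPoint_insertNth, simplexPoint]
  simp [Fin.succ_succAbove_succ]

theorem integrableOn_coordSimplex {X : Type*} [NormedAddCommGroup X] {q : ℕ}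
    {φ : (Fin q → ℝ) → X} (hφ : Continuous φ) :
    IntegrableOn φ (coordSimplex q) :=
  hφ.continuousOn.integrableOn_compact (isCompact_coordSimplex q)

theorem setIntegral_coordSimplex_sum_smul {κ : Type*} [Fintype κ] {q : ℕ} (c : κ → ℝ)
    {φ : κ → (Fin q → ℝ) → V} (hφ : ∀ k, Continuous (φ k)) :
    ∫ τ in coordSimplex q, ∑ k, c k • φ k τ = ∑ k, c k • ∫ τ in coordSimplex q, φ k τ := by
  refine (integral_finsetSum _ fun k _ => (integrableOn_coordSimplex (hφ k)).smul (c k)).trans ?_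
  exact Finset.sum_congr rfl fun k _ => integral_smul _ _

variable [CompleteSpace V]

/-- Stokes' theorem for the integration of a closed form along the fibres of `E × T → E`, with
`T` a simplex. -/
theorem fibre_stokes {m p a N : ℕ} (w : Fin (p + 2) → Fin (m + 1) → ℝ) {S : Set E} {y₀ : E}
    (hS : Convex ℝ S) (hSu : UniqueDiffOn ℝ S) (hy₀ : y₀ ∈ S)
    {G : E × (Fin (m + 1) → ℝ) → (E × (Fin (m + 1) → ℝ)) [⋀^Fin N]→L[ℝ] V}
    (hG : ContDiffOn ℝ 1 G (S ×ˢ univ))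
    (hclosed : ∀ t, extDerivWithin G (S ×ˢ univ) (y₀, t) = 0)
    (h : a + (p + 1) = N) (h' : a + 1 + p = N) :
    ∑ j : Fin (p + 2), (-1 : ℝ) ^ (j : ℕ) • ∫ τ in coordSimplex p,
        insertCLM h' (fun i => ((0 : E), w (j.succAbove i.succ) - w (j.succAbove 0)))
          (ContinuousLinearMap.inl ℝ E (Fin (m + 1) → ℝ))
          (G (y₀, simplexPoint (fun i => w (j.succAbove i)) τ)) =
      (-1 : ℝ) ^ p • extDerivWithin (fun y => ∫ τ in coordSimplex (p + 1),
        insertCLM h (fun i => ((0 : E), w i.succ - w 0))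
          (ContinuousLinearMap.inl ℝ E (Fin (m + 1) → ℝ)) (G (y, simplexPoint w τ))) S y₀ := by
  have hSu' : UniqueDiffOn ℝ (S ×ˢ (univ : Set (Fin (m + 1) → ℝ))) := hSu.prod uniqueDiffOn_univ
  set u : Fin (p + 1) → E × (Fin (m + 1) → ℝ) := fun i => (0, w i.succ - w 0) with hu
  set ι := ContinuousLinearMap.inl ℝ E (Fin (m + 1) → ℝ) with hι
  set D := fun z => fderivWithin ℝ G (S ×ˢ univ) z with hD
  have hGd : ∀ y ∈ S, ∀ t, HasFDerivWithinAt G (D (y, t)) (S ×ˢ univ) (y, t) := fun y hy t =>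
    (hG.differentiableOn one_ne_zero (y, t) ⟨hy, mem_univ _⟩).hasFDerivWithinAt
  have hDc : ContinuousOn D (S ×ˢ univ) := hG.continuousOn_fderivWithin hSu' le_rfl
  have hptc : Continuous (simplexPoint w) := (contDiff_simplexPoint w (k := 0)).continuous
  have hGt : ∀ y ∈ S, ContDiff ℝ 1 fun t => G (y, t) := fun y hy =>
    contDiffOn_univ.1 <| hG.comp (contDiff_const.prodMk contDiff_id).contDiffOn
      fun t _ => ⟨hy, mem_univ _⟩
  -- the derivative of the integral over the simplex
  have hK : HasFDerivWithinAt (fun y => ∫ τ in coordSimplex (p + 1),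
      insertCLM h u ι (G (y, simplexPoint w τ)))
      (∫ τ in coordSimplex (p + 1), (insertCLM h u ι).comp ((D (y₀, simplexPoint w τ)).comp ι))
      S y₀ := by
    refine hasFDerivWithinAt_setIntegral_of_convex (U := S) (K := coordSimplex (p + 1))
      (g := fun y τ => insertCLM h u ι (G (y, simplexPoint w τ)))
      (g' := fun y τ => (insertCLM h u ι).comp ((D (y, simplexPoint w τ)).comp ι))
      hS hy₀ le_rfl self_mem_nhdsWithin (isCompact_coordSimplex _) ?_ ?_ ?_
    · intro y hy τ _
      refine (insertCLM (V := V) h u ι).hasFDerivAt.comp_hasFDerivWithinAt y ?_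
      refine (hGd y hy (simplexPoint w τ)).comp (t := S ×ˢ univ) y ?_
        (fun z hz => (⟨hz, mem_univ _⟩ : (z, simplexPoint w τ) ∈ S ×ˢ univ))
      exact (hasFDerivAt_prodMk_left y (simplexPoint w τ)).hasFDerivWithinAt
    · refine continuousOn_const.clm_comp (ContinuousOn.clm_comp ?_ continuousOn_const)
      refine hDc.comp (f := fun p : E × (Fin (p + 1) → ℝ) => (p.1, simplexPoint w p.2))
        (Continuous.continuousOn (by fun_prop)) fun z hz => ⟨hz.1, mem_univ _⟩
    · intro y hy
      refine (Continuous.continuousOn ?_).integrableOn_compact (isCompact_coordSimplex _)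
      exact (insertCLM h u ι).continuous.comp ((hGt y hy).continuous.comp hptc)
  ext v
  -- the components of `G` whose divergence occurs
  let g : Fin (p + 1) → (Fin (p + 1) → ℝ) → V := fun k τ =>
    G (y₀, simplexPoint w τ) (headTail h' (fun i => u (k.succAbove i)) fun j => ι (v j))
  have hg : ∀ k, ContDiff ℝ 1 (g k) := fun k =>
    (ContinuousAlternatingMap.apply ℝ (E × (Fin (m + 1) → ℝ)) V
      (headTail h' (fun i => u (k.succAbove i)) fun j => ι (v j))).contDiff.comp
      ((hGt y₀ hy₀).comp (contDiff_simplexPoint w))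
  have hgd : ∀ k τ, fderiv ℝ (g k) τ (Pi.single k 1) = D (y₀, simplexPoint w τ) (u k)
      (headTail h' (fun i => u (k.succAbove i)) fun j => ι (v j)) := by
    intro k τ
    have h1 : HasFDerivAt (fun τ => G (y₀, simplexPoint w τ))
        ((D (y₀, simplexPoint w τ)).comp
          ((ContinuousLinearMap.inr ℝ E (Fin (m + 1) → ℝ)).comp
            (fderiv ℝ (simplexPoint w) τ))) τ := by
      rw [← hasFDerivWithinAt_univ]
      refine (hGd y₀ hy₀ (simplexPoint w τ)).comp (t := S ×ˢ univ) τ ?_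
        (fun z _ => (⟨hy₀, mem_univ _⟩ : (y₀, simplexPoint w z) ∈ S ×ˢ univ))
      refine HasFDerivAt.hasFDerivWithinAt ?_
      exact (hasFDerivAt_prodMk_right y₀ (simplexPoint w τ)).comp τ
        ((contDiff_simplexPoint w (k := 1)).differentiable one_ne_zero τ).hasFDerivAt
    have h2 := (ContinuousAlternatingMap.apply ℝ (E × (Fin (m + 1) → ℝ)) V
      (headTail h' (fun i => u (k.succAbove i)) fun j => ι (v j))).hasFDerivAt.comp τ h1
    have h3 : g k = (ContinuousAlternatingMap.apply ℝ (E × (Fin (m + 1) → ℝ)) V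
      (headTail h' (fun i => u (k.succAbove i)) fun j => ι (v j))) ∘
        fun τ => G (y₀, simplexPoint w τ) := rfl
    rw [h3, h2.fderiv]
    simp only [ContinuousLinearMap.comp_apply, fderiv_simplexPoint]
    rfl
  -- closedness, on the vectors `u`, `v`
  have hcl : ∀ τ, ∑ k : Fin (p + 1), (-1 : ℝ) ^ (k : ℕ) • fderiv ℝ (g k) τ (Pi.single k 1) =
      (-1 : ℝ) ^ p • ∑ j : Fin (a + 1), (-1 : ℝ) ^ (j : ℕ) • D (y₀, simplexPoint w τ) (ι (v j))
        (headTail h u fun i => ι (v (j.succAbove i))) := by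
    intro τ
    have hN : a + 1 + (p + 1) = N + 1 := by omega
    have h1 : extDerivWithin G (S ×ˢ univ) (y₀, simplexPoint w τ)
        (headTail hN u fun j => ι (v j)) = 0 := by rw [hclosed]; rfl
    rw [extDerivWithin, ContinuousAlternatingMap.alternatizeUncurryFin_apply] at h1
    -- Omitting a vertical argument gives a divergence in the simplex variables; omitting a
    -- horizontal one gives a term of the differential in the direction of `E`.
    rw [sum_univ_headTail hN] at h1
    simp only [removeNth_headTail_left hN h', removeNth_headTail_right hN h] at h1
    have e1 : ∀ k : Fin (p + 1), headTail hN u (fun j => ι (v j)) (Fin.castLE (by omega) k) = u k :=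
      fun k => headTail_of_lt _ _ _ _ rfl
    have e2 : ∀ j : Fin (a + 1), headTail hN u (fun j => ι (v j)) ⟨p + 1 + j, by omega⟩ =
        ι (v j) := fun j => headTail_of_ge _ _ _ _ rfl
    simp only [e1, e2, Fin.val_castLE] at h1
    simp only [hgd]
    rw [Finset.smul_sum, ← sub_eq_zero, ← h1, sub_eq_add_neg, ← Finset.sum_neg_distrib]
    congr 1
    · refine Finset.sum_congr rfl fun k _ => ?_
      rcases neg_one_pow_eq_or ℤ (k : ℕ) with hk | hk
      all_goals
        have hk' : (-1 : ℝ) ^ (k : ℕ) = ((-1 : ℤ) ^ (k : ℕ) : ℤ) := by push_cast; rfl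
        rw [hk', hk]; simp
        try rfl
    -- A horizontal argument sits behind `p + 1` vertical ones. Its sign `(-1) ^ (p + 1 + j)`,
    -- carried to the other side, produces the factor `(-1) ^ p` of the theorem.
    · refine Finset.sum_congr rfl fun j _ => ?_
      have hk' : -(((-1 : ℝ) ^ p) * (-1) ^ (j : ℕ)) = ((-1 : ℤ) ^ (p + 1 + (j : ℕ)) : ℤ) := by
        push_cast; ring
      rw [smul_smul, ← neg_smul, hk', Int.cast_smul_eq_zsmul]
  -- the faces
  have hface : ∀ (b : Fin (p + 1) → Fin (m + 1) → ℝ),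
      (∫ τ in coordSimplex p, insertCLM h' (fun i => ((0 : E), b i.succ - b 0)) ι
        (G (y₀, simplexPoint b τ))) v = ∫ τ in coordSimplex p, G (y₀, simplexPoint b τ)
          (headTail h' (fun i => ((0 : E), b i.succ - b 0)) fun j => ι (v j)) := by
    intro b
    have hc : Continuous fun τ => insertCLM h' (fun i => ((0 : E), b i.succ - b 0)) ι
        (G (y₀, simplexPoint b τ)) :=
      (insertCLM h' (fun i => ((0 : E), b i.succ - b 0)) ι).continuous.comp
        ((hGt y₀ hy₀).continuous.comp (contDiff_simplexPoint b (k := 0)).continuous)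
    have := (ContinuousAlternatingMap.apply ℝ E V v).integral_comp_comm
      (hc.continuousOn.integrableOn_compact (μ := volume) (isCompact_coordSimplex p))
    refine this.symm.trans ?_
    congr 1
    ext1 τ
    exact insertCLM_apply _ _ _ _ _
  have hins : ∀ (k : Fin (p + 1)) (c : (Fin p → ℝ) → ℝ), Continuous c →
      IntegrableOn (fun τ => g k (k.insertNth (c τ) τ)) (coordSimplex p) := fun k c hc =>
    (((hg k).continuous.comp (hc.finInsertNth k continuous_id)).continuousOn).integrableOn_compact
      (isCompact_coordSimplex p)
  have hsum : Continuous fun τ : Fin p → ℝ => 1 - ∑ i, τ i := by fun_prop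
  have hF0 : ∫ τ in coordSimplex p,
      G (y₀, simplexPoint (fun i => w ((0 : Fin (p + 2)).succAbove i)) τ)
      (headTail h' (fun i => ((0 : E), w ((0 : Fin (p + 2)).succAbove i.succ) -
        w ((0 : Fin (p + 2)).succAbove 0))) fun j => ι (v j)) =
      ∑ k : Fin (p + 1), (-1 : ℝ) ^ (k : ℕ) •
        ∫ τ in coordSimplex p, g k (k.insertNth (1 - ∑ i, τ i) τ) := by
    have e1 : ∀ τ : Fin p → ℝ,
        G (y₀, simplexPoint (fun i => w ((0 : Fin (p + 2)).succAbove i)) τ)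
          (headTail h' (fun i => ((0 : E), w ((0 : Fin (p + 2)).succAbove i.succ) -
            w ((0 : Fin (p + 2)).succAbove 0))) fun j => ι (v j)) =
        ∑ k : Fin (p + 1), (-1 : ℝ) ^ (k : ℕ) •
          g k ((0 : Fin (p + 1)).insertNth (1 - ∑ i, τ i) τ) := by
      intro τ
      rw [simplexPoint_face_zero]
      -- The edges of the slanted face are differences of the edges at `w 0`. Expanding the
      -- alternating form in them gives one term for each omitted edge.
      have e2 : (fun i : Fin p => ((0 : E), w ((0 : Fin (p + 2)).succAbove i.succ) -
            w ((0 : Fin (p + 2)).succAbove 0))) = fun i => u i.succ - u 0 := by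
        ext1 i
        simp only [hu, Prod.mk_sub_mk, sub_zero, Fin.zero_succAbove, sub_sub_sub_cancel_right]
      rw [e2]
      refine ((headAlternating h' (G (y₀, simplexPoint w ((0 : Fin (p + 1)).insertNth
        (1 - ∑ i, τ i) τ))) fun j => ι (v j)).map_succ_sub_zero u).trans ?_
      refine Finset.sum_congr rfl fun k _ => ?_
      have hk' : (-1 : ℝ) ^ (k : ℕ) = ((-1 : ℤ) ^ (k : ℕ) : ℤ) := by push_cast; rfl
      rw [hk', Int.cast_smul_eq_zsmul]
      rfl
    have hc0 : ∀ k, Continuous fun τ : Fin p → ℝ =>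
        g k ((0 : Fin (p + 1)).insertNth (1 - ∑ i, τ i) τ) := fun k =>
      (hg k).continuous.comp (hsum.finInsertNth 0 continuous_id)
    simp only [e1]
    rw [setIntegral_coordSimplex_sum_smul _ hc0]
    refine Finset.sum_congr rfl fun k _ => ?_
    -- The term omitting edge `k` is reparametrized by the coordinates other than `k`, as the
    -- divergence theorem in direction `k` requires.
    rw [← setIntegral_coordSimplex_insertNth k (g k)]
  have hFk : ∀ k : Fin (p + 1),
      ∫ τ in coordSimplex p, G (y₀, simplexPoint (fun i => w (k.succ.succAbove i)) τ)
        (headTail h' (fun i => ((0 : E), w (k.succ.succAbove i.succ) -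
          w (k.succ.succAbove 0))) fun j => ι (v j)) =
      ∫ τ in coordSimplex p, g k (k.insertNth 0 τ) := by
    intro k
    simp only [simplexPoint_face_succ, g, hu, Fin.succ_succAbove_succ, Fin.succ_succAbove_zero]
  have hDcont : ∀ j : Fin (a + 1), Continuous fun τ => D (y₀, simplexPoint w τ) (ι (v j))
      (headTail h u fun i => ι (v (j.succAbove i))) := by
    intro j
    have h1 : Continuous fun τ => D (y₀, simplexPoint w τ) :=
      hDc.comp_continuous (by fun_prop) fun τ => ⟨hy₀, mem_univ _⟩
    exact (ContinuousAlternatingMap.apply ℝ (E × (Fin (m + 1) → ℝ)) V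
      (headTail h u fun i => ι (v (j.succAbove i)))).continuous.comp
      (h1.clm_apply continuous_const)
  have hleft : ∀ x : Fin (p + 2) → E [⋀^Fin (a + 1)]→L[ℝ] V,
      (∑ j : Fin (p + 2), (-1 : ℝ) ^ (j : ℕ) • x j) v =
        ∑ j : Fin (p + 2), (-1 : ℝ) ^ (j : ℕ) • x j v := fun x => by
    simp [ContinuousAlternatingMap.sum_apply]
  have hfd : ∀ k, Continuous fun τ => fderiv ℝ (g k) τ (Pi.single k 1) := fun k =>
    ((hg k).continuous_fderiv one_ne_zero).clm_apply continuous_const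
  rw [hleft, Finset.sum_congr rfl fun j _ => by rw [hface fun i => w (j.succAbove i)],
    Fin.sum_univ_succ]
  simp only [hFk]
  rw [hF0, Fin.val_zero, pow_zero, one_smul, ← Finset.sum_add_distrib]
  -- In direction `k` the divergence theorem pairs one term of the slanted face with the face `τ_k =
  -- 0`, opposite vertex `k + 1`; the index shift gives the relative sign.
  have hterm : ∀ k : Fin (p + 1), (-1 : ℝ) ^ (k : ℕ) •
      (∫ τ in coordSimplex p, g k (k.insertNth (1 - ∑ i, τ i) τ)) +
      (-1 : ℝ) ^ (k.succ : ℕ) • (∫ τ in coordSimplex p, g k (k.insertNth 0 τ)) =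
      (-1 : ℝ) ^ (k : ℕ) • ∫ τ in coordSimplex (p + 1), fderiv ℝ (g k) τ (Pi.single k 1) := by
    intro k
    rw [setIntegral_coordSimplex_fderiv k (hg k),
      integral_sub (hins k _ hsum) (hins k _ continuous_const), smul_sub, Fin.val_succ, pow_succ]
    simp [sub_eq_add_neg]
  rw [Finset.sum_congr rfl fun k _ => hterm k,
    ← setIntegral_coordSimplex_sum_smul _ hfd]
  simp only [hcl]
  rw [integral_smul, setIntegral_coordSimplex_sum_smul _ hDcont,
    ContinuousAlternatingMap.smul_apply, extDerivWithin, hK.fderivWithin (hSu y₀ hy₀),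
    ContinuousAlternatingMap.alternatizeUncurryFin_apply]
  congr 1
  refine Finset.sum_congr rfl fun j _ => ?_
  have hcK : Continuous fun τ =>
      (insertCLM (V := V) h u ι).comp ((D (y₀, simplexPoint w τ)).comp ι) :=
    continuous_const.clm_comp ((hDc.comp_continuous (by fun_prop)
      fun τ => ⟨hy₀, mem_univ _⟩).clm_comp continuous_const)
  have hiK := integrableOn_coordSimplex (X := E →L[ℝ] E [⋀^Fin a]→L[ℝ] V) hcK
  rw [ContinuousLinearMap.integral_apply hiK]
  have hcKv : Continuous fun τ =>
      ((insertCLM (V := V) h u ι).comp ((D (y₀, simplexPoint w τ)).comp ι)) (v j) :=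
    hcK.clm_apply continuous_const
  have h5 := (ContinuousAlternatingMap.apply ℝ E V (j.removeNth v)).integral_comp_comm
      (hcKv.continuousOn.integrableOn_compact (μ := volume) (isCompact_coordSimplex (p + 1)))
  have hk' : (-1 : ℝ) ^ (j : ℕ) = ((-1 : ℤ) ^ (j : ℕ) : ℤ) := by push_cast; rfl
  rw [hk', Int.cast_smul_eq_zsmul]
  congr 1
  refine Eq.trans ?_ h5
  congr 1
  ext1 τ
  exact (insertCLM_apply _ _ _ _ _).symm

end FibreStokes

/-! ### Powers of the homotopy derivation and extraction of components in `dt`. -/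

section Homotopy

open Set Topology

/-- The word with `d_t A_t` in the places of `s` and `F_t` elsewhere. -/
def homotopyWord {r : ℕ} (s : Finset (Fin r)) : Fin r → HomotopySymbol :=
  fun i => if i ∈ s then .dtA else .F

theorem homotopyWord_insert {r : ℕ} (s : Finset (Fin r)) (i : Fin r) :
    Function.update (homotopyWord s) i .dtA = homotopyWord (insert i s) := by
  ext j
  rcases eq_or_ne j i with rfl | hj <;> simp [homotopyWord, *]

theorem homotopyDerivation_single {r : ℕ} (s : Finset (Fin r)) :
    homotopyDerivation r (Finsupp.single (homotopyWord s) 1) =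
      ∑ i ∈ sᶜ, Finsupp.single (homotopyWord (insert i s)) 1 := by
  rw [homotopyDerivation, Finsupp.linearCombination_single, one_smul,
    ← Finset.sum_subset (Finset.subset_univ sᶜ)]
  · refine Finset.sum_congr rfl fun i hi => ?_
    have : homotopyWord s i = .F := by simp [homotopyWord, Finset.mem_compl.1 hi]
    rw [this, homotopyWord_insert]
  · intro i _ hi
    have : homotopyWord s i = .dtA := by simpa [homotopyWord] using hi
    rw [this]

/-- Double counting: every set of size `p + 1` arises from `p + 1` pairs, one for each choice of its
last inserted element. -/
theorem sum_powersetCard_sum_insert {r p : ℕ} {X : Type*} [AddCommMonoid X]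
    (g : Finset (Fin r) → X) :
    ∑ s ∈ Finset.powersetCard p Finset.univ, ∑ i ∈ sᶜ, g (insert i s) =
      (p + 1) • ∑ s ∈ Finset.powersetCard (p + 1) Finset.univ, g s := by
  have h1 : (p + 1) • ∑ s ∈ Finset.powersetCard (p + 1) Finset.univ, g s =
      ∑ s ∈ Finset.powersetCard (p + 1) (Finset.univ : Finset (Fin r)), ∑ _i ∈ s, g s := by
    rw [Finset.smul_sum]
    refine Finset.sum_congr rfl fun s hs => ?_
    rw [Finset.sum_const, (Finset.mem_powersetCard.1 hs).2]
  rw [h1, Finset.sum_sigma', Finset.sum_sigma']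
  refine Finset.sum_bij' (fun x _ => ⟨insert x.2 x.1, x.2⟩) (fun x _ => ⟨x.1.erase x.2, x.2⟩)
    ?_ ?_ ?_ ?_ ?_
  · rintro ⟨s, i⟩ h
    simp only [Finset.mem_sigma, Finset.mem_powersetCard_univ, Finset.mem_compl] at h ⊢
    exact ⟨by rw [Finset.card_insert_of_notMem h.2, h.1], Finset.mem_insert_self _ _⟩
  · rintro ⟨s, i⟩ h
    simp only [Finset.mem_sigma, Finset.mem_powersetCard_univ, Finset.mem_compl] at h ⊢
    exact ⟨by rw [Finset.card_erase_of_mem h.2, h.1]; rfl, Finset.notMem_erase _ _⟩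
  · rintro ⟨s, i⟩ h
    simp only [Finset.mem_sigma, Finset.mem_compl] at h
    simp [Finset.erase_insert h.2]
  · rintro ⟨s, i⟩ h
    simp only [Finset.mem_sigma] at h
    simp [Finset.insert_erase h.2]
  · rintro ⟨s, i⟩ _
    rfl

/-- Every choice of `p` places is reached in `p!` orders, which is what the division by `p!` in
`homotopyPower` removes. -/
theorem homotopyDerivation_pow {r : ℕ} (p : ℕ) :
    (homotopyDerivation r ^ p) (Finsupp.single (fun _ => .F) 1) =
      p.factorial • ∑ s ∈ Finset.powersetCard p Finset.univ,
        Finsupp.single (homotopyWord s) (1 : ℝ) := by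
  induction p with
  | zero =>
    have h : homotopyWord (∅ : Finset (Fin r)) = fun _ => .F := by ext; simp [homotopyWord]
    simp [h]
  | succ p ih =>
    rw [pow_succ', Module.End.mul_apply, ih, map_nsmul, map_sum]
    simp only [homotopyDerivation_single]
    rw [sum_powersetCard_sum_insert (fun s => Finsupp.single (homotopyWord s) (1 : ℝ)), smul_smul,
      Nat.factorial_succ, mul_comm]

variable {E H M L V : Type*} [NormedAddCommGroup E] [NormedSpace ℝ E]
  [NormedLieRing L] [NormedLieAlgebra L] [NormedAddCommGroup V] [NormedSpace ℝ V]

/-- The two-form `∑ dt^i a_i`, for one-forms `a_i`. -/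
def dtForm {m : ℕ} (a : Fin (m + 1) → E [⋀^Fin 1]→L[ℝ] L) :
    (E × (Fin (m + 1) → ℝ)) [⋀^Fin 2]→L[ℝ] L :=
  ContinuousAlternatingMap.alternatizeUncurryFin
    ((∑ i, (ContinuousLinearMap.proj (R := ℝ) (φ := fun _ : Fin (m + 1) => ℝ) i).smulRight
      ((a i).compContinuousLinearMap (ContinuousLinearMap.fst ℝ E (Fin (m + 1) → ℝ)))).comp
        (ContinuousLinearMap.snd ℝ E (Fin (m + 1) → ℝ)))

theorem dtForm_apply {m : ℕ} (a : Fin (m + 1) → E [⋀^Fin 1]→L[ℝ] L)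
    (z : Fin 2 → E × (Fin (m + 1) → ℝ)) :
    dtForm a z = (∑ i, (z 0).2 i • a i fun _ => (z 1).1) -
      ∑ i, (z 1).2 i • a i fun _ => (z 0).1 := by
  have e : ∀ (k : Fin 2) (b : E [⋀^Fin 1]→L[ℝ] L), (b.compContinuousLinearMap
      (ContinuousLinearMap.fst ℝ E (Fin (m + 1) → ℝ))) (k.removeNth z) =
        b fun _ => (z (1 - k)).1 := by
    intro k b
    rw [ContinuousAlternatingMap.compContinuousLinearMap_apply]
    congr 1
    ext1 i
    fin_cases i
    fin_cases k <;> rfl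
  rw [dtForm, ContinuousAlternatingMap.alternatizeUncurryFin_apply, Fin.sum_univ_two]
  simp [ContinuousAlternatingMap.sum_apply, sub_eq_add_neg, -Fin.removeNth_zero,
    -ContinuousAlternatingMap.compContinuousLinearMap_apply, e]

theorem dtForm_compContinuousLinearMap {m : ℕ} (a : Fin (m + 1) → E [⋀^Fin 1]→L[ℝ] L)
    {E' : Type*} [NormedAddCommGroup E'] [NormedSpace ℝ E'] (g : E' →L[ℝ] E) :
    (dtForm a).compContinuousLinearMap (g.prodMap (ContinuousLinearMap.id ℝ (Fin (m + 1) → ℝ))) =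
      dtForm fun i => (a i).compContinuousLinearMap g := by
  ext z
  rw [ContinuousAlternatingMap.compContinuousLinearMap_apply, dtForm_apply, dtForm_apply]
  rfl

/-- The form has weight one in the vertical directions, so counting its occurrences in a product
amounts to counting the degree in `dt`. -/
theorem dtForm_scale {m : ℕ} (a : Fin (m + 1) → E [⋀^Fin 1]→L[ℝ] L) (c : ℝ) :
    (dtForm a).compContinuousLinearMap ((ContinuousLinearMap.id ℝ E).prodMap
      (c • ContinuousLinearMap.id ℝ (Fin (m + 1) → ℝ))) = c • dtForm a := by
  ext z
  rw [ContinuousAlternatingMap.compContinuousLinearMap_apply, ContinuousAlternatingMap.smul_apply,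
    dtForm_apply, dtForm_apply, smul_sub, Finset.smul_sum, Finset.smul_sum]
  simp [mul_smul]

theorem dT_liftForm_simplexConnection {m : ℕ} (A : Fin (m + 1) → DForm E M 1 L)
    (t : Fin (m + 1) → ℝ) (x : M) :
    dT (liftForm (simplexConnection A)) t x = dtForm fun i => A i x := by
  have h : HasFDerivAt (fun t' : Fin (m + 1) → ℝ => liftForm (simplexConnection A) t' x)
      (∑ i, (ContinuousLinearMap.proj (R := ℝ) (φ := fun _ : Fin (m + 1) => ℝ) i).smulRight
        ((A i x).compContinuousLinearMap (ContinuousLinearMap.fst ℝ E (Fin (m + 1) → ℝ)))) t := by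
    have e : (fun t' : Fin (m + 1) → ℝ => liftForm (simplexConnection A) t' x) = fun t' =>
        ∑ i, t' i • (A i x).compContinuousLinearMap
          (ContinuousLinearMap.fst ℝ E (Fin (m + 1) → ℝ)) := by
      ext t' v
      simp [liftForm, simplexConnection, ContinuousAlternatingMap.sum_apply]
    rw [e]
    refine HasFDerivAt.fun_sum fun i _ => ?_
    have hp : HasFDerivAt (fun t' : Fin (m + 1) → ℝ => t' i)
        (ContinuousLinearMap.proj (R := ℝ) (φ := fun _ : Fin (m + 1) => ℝ) i) t :=
      (ContinuousLinearMap.proj (R := ℝ) (φ := fun _ : Fin (m + 1) => ℝ) i).hasFDerivAt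
    exact hp.smul_const ((A i x).compContinuousLinearMap
      (ContinuousLinearMap.fst ℝ E (Fin (m + 1) → ℝ)))
  rw [dT, h.fderiv]
  rfl

theorem sum_two_eq (n : ℕ) : ∑ _i : Fin (n + 1), 2 = 2 * n + 2 := by simp; ring

/-- The part of `⟨(F + B)^{n+1}⟩` of degree `p` in `B`. -/
def pairingComponent {W : Type*} [NormedAddCommGroup W] [NormedSpace ℝ W] {n : ℕ}
    (f : L [×(n + 1)]→L[ℝ] V) (F B : W [⋀^Fin 2]→L[ℝ] L) (p : ℕ) : W [⋀^Fin (2 * n + 2)]→L[ℝ] V :=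
  ∑ s ∈ Finset.powersetCard p Finset.univ,
    wedgePairingCMM f (fun _ => 2) (sum_two_eq n) (s.piecewise (fun _ => B) fun _ => F)

theorem pairingComponent_compContinuousLinearMap {W W' : Type*} [NormedAddCommGroup W]
    [NormedSpace ℝ W] [NormedAddCommGroup W'] [NormedSpace ℝ W'] {n : ℕ}
    (f : L [×(n + 1)]→L[ℝ] V) (F B : W' [⋀^Fin 2]→L[ℝ] L) (p : ℕ) (g : W →L[ℝ] W') :
    (pairingComponent f F B p).compContinuousLinearMap g =
      pairingComponent f (F.compContinuousLinearMap g) (B.compContinuousLinearMap g) p := by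
  have h : ∀ s : Finset (Fin (n + 1)),
      (wedgePairingCMM f (fun _ => 2) (sum_two_eq n)
        (s.piecewise (fun _ => B) fun _ => F)).compContinuousLinearMap g =
      wedgePairingCMM f (fun _ => 2) (sum_two_eq n) (s.piecewise
        (fun _ => B.compContinuousLinearMap g) fun _ => F.compContinuousLinearMap g) := by
    intro s
    rw [wedgePairingCMM_apply, wedgePairing_compContinuousLinearMap, wedgePairingCMM_apply]
    refine wedgePairing_congr f (funext fun i => ?_) _
    by_cases hi : i ∈ s <;> simp [hi]
  simp only [pairingComponent, ← h]
  ext v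
  simp [ContinuousAlternatingMap.sum_apply]

/-- Insertion of `q` vertical vectors, followed by restriction to horizontal ones, extracts the
component of degree `q` in `dt`. -/
theorem insertCLM_wedgePairing_add {m n a q : ℕ} (f : L [×(n + 1)]→L[ℝ] V)
    (F : E [⋀^Fin 2]→L[ℝ] L) (b : Fin (m + 1) → E [⋀^Fin 1]→L[ℝ] L) (h : a + q = 2 * n + 2)
    (u : Fin q → Fin (m + 1) → ℝ) :
    insertCLM h (fun i => ((0 : E), u i)) (ContinuousLinearMap.inl ℝ E (Fin (m + 1) → ℝ))
      (wedgePairingCMM f (fun _ => 2) (sum_two_eq n) fun _ =>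
        F.compContinuousLinearMap (ContinuousLinearMap.fst ℝ E (Fin (m + 1) → ℝ)) + dtForm b) =
    insertCLM h (fun i => ((0 : E), u i)) (ContinuousLinearMap.inl ℝ E (Fin (m + 1) → ℝ))
      (pairingComponent f
        (F.compContinuousLinearMap (ContinuousLinearMap.fst ℝ E (Fin (m + 1) → ℝ)))
          (dtForm b) q) := by
  set F' := F.compContinuousLinearMap (ContinuousLinearMap.fst ℝ E (Fin (m + 1) → ℝ)) with hF'
  have hexp : (wedgePairingCMM f (fun _ => 2) (sum_two_eq n) fun _ => F' + dtForm b) =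
      ∑ s : Finset (Fin (n + 1)), wedgePairingCMM f (fun _ => 2) (sum_two_eq n)
        (s.piecewise (fun _ => dtForm b) fun _ => F') := by
    rw [← ContinuousMultilinearMap.map_add_univ]
    congr 1
    ext1 i
    exact add_comm _ _
  rw [hexp, pairingComponent, map_sum, map_sum]
  symm
  refine Finset.sum_subset (Finset.subset_univ _) fun s _ hs => ?_
  ext v
  rw [insertCLM_apply]
  refine apply_headTail_eq_zero_of_weight (s := s.card) h ?_ _ ?_ u v
  · intro hc
    exact hs (Finset.mem_powersetCard_univ.2 hc)
  · rw [wedgePairingCMM_apply, wedgePairing_compContinuousLinearMap]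
    -- Under the vertical dilation each `dtForm b` doubles and each `F'` is unchanged, so the
    -- summand indexed by `s` has weight `s.card` and vanishes unless `s.card = q`.
    have h1 : (fun i : Fin (n + 1) => (⟨2, ((s.piecewise (fun _ => dtForm b) fun _ => F') i
        ).compContinuousLinearMap ((ContinuousLinearMap.id ℝ E).prodMap
          ((2 : ℝ) • ContinuousLinearMap.id ℝ (Fin (m + 1) → ℝ)))⟩ :
        HomForm (E × (Fin (m + 1) → ℝ)) L)) = fun i => ⟨2, (if i ∈ s then (2 : ℝ) else 1) •
          (s.piecewise (fun _ => dtForm b) fun _ => F') i⟩ := by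
      ext1 i
      by_cases hi : i ∈ s
      · simp only [hi, Finset.piecewise_eq_of_mem, if_true, dtForm_scale]
      · simp only [hi, not_false_eq_true, Finset.piecewise_eq_of_notMem, if_false, one_smul]
        rfl
    rw [wedgePairing_congr f h1]
    have h2 := (wedgePairingCMM f (fun _ => 2) (sum_two_eq n)).map_smul_univ
      (fun i => if i ∈ s then (2 : ℝ) else 1) (s.piecewise (fun _ => dtForm b) fun _ => F')
    refine h2.trans ?_
    simp [Finset.prod_ite_mem]

variable [TopologicalSpace H] (I : ModelWithCorners ℝ E H) [TopologicalSpace M] [ChartedSpace H M]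

theorem homotopyPower_eq {m n : ℕ} (f : L [×(n + 1)]→L[ℝ] V) (A : Fin (m + 1) → DForm E M 1 L)
    (p : ℕ) (t : Fin (m + 1) → ℝ) (x : M) :
    homotopyPower I f A p t x = pairingComponent f
      ((curvature I (simplexConnection A t) x).compContinuousLinearMap
        (ContinuousLinearMap.fst ℝ E (Fin (m + 1) → ℝ))) (dtForm fun i => A i x) p := by
  have hlin : ∀ P : HomotopyPoly (n + 1), homotopyPolyForm I f A P t x =
      Finsupp.linearCombination ℝ (fun w : Fin (n + 1) → HomotopySymbol =>
        wedgePairing f (fun i => ⟨2, homotopySymbolForm I A (w i) t x⟩) (sum_two_eq n)) P :=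
    fun P => rfl
  rw [homotopyPower, hlin, homotopyDerivation_pow, ← Nat.cast_smul_eq_nsmul ℝ, smul_smul,
    inv_mul_cancel₀ (by positivity), one_smul, map_sum, pairingComponent]
  refine Finset.sum_congr rfl fun s _ => ?_
  rw [Finsupp.linearCombination_single, one_smul, wedgePairingCMM_apply]
  refine wedgePairing_congr f (funext fun i => ?_) _
  by_cases hi : i ∈ s
  · simp only [homotopyWord, hi, if_true, Finset.piecewise_eq_of_mem, homotopySymbolForm,
      dT_liftForm_simplexConnection]
  · simp only [homotopyWord, hi, if_false, not_false_eq_true, Finset.piecewise_eq_of_notMem,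
      homotopySymbolForm]
    rfl

end Homotopy

/-! ### The curvature of the total connection and the homotopy formula on a convex set. -/

section LocalHomotopyFormula

open MeasureTheory Set Topology

variable {E L V : Type*} [NormedAddCommGroup E] [NormedSpace ℝ E]
  [NormedLieRing L] [NormedLieAlgebra L] [NormedAddCommGroup V] [NormedSpace ℝ V]

theorem extDerivWithin_oneForm_apply {F : Type*} [NormedAddCommGroup F] [NormedSpace ℝ F]
    {S : Set E} {y : E} {α : E → E [⋀^Fin 1]→L[ℝ] F} {α' : E →L[ℝ] E [⋀^Fin 1]→L[ℝ] F}
    (hα : HasFDerivWithinAt α α' S y) (hS : UniqueDiffWithinAt ℝ S y) (z : Fin 2 → E) :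
    extDerivWithin α S y z = (α' (z 0) fun _ => z 1) - α' (z 1) fun _ => z 0 := by
  rw [extDerivWithin, hα.fderivWithin hS, ContinuousAlternatingMap.alternatizeUncurryFin_apply,
    Fin.sum_univ_two]
  have e0 : Fin.removeNth 0 z = fun _ => z 1 := by ext1 i; fin_cases i; rfl
  have e1 : Fin.removeNth 1 z = fun _ => z 0 := by ext1 i; fin_cases i; rfl
  rw [e0, e1]
  simp [sub_eq_add_neg]

/-- The connection `∑ t^i a_i` on `E × ℝ^{m+1}`. -/
def totalConnection {m : ℕ} (a : Fin (m + 1) → E → E [⋀^Fin 1]→L[ℝ] L)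
    (z : E × (Fin (m + 1) → ℝ)) : (E × (Fin (m + 1) → ℝ)) [⋀^Fin 1]→L[ℝ] L :=
  (∑ i, z.2 i • a i z.1).compContinuousLinearMap
    (ContinuousLinearMap.fst ℝ E (Fin (m + 1) → ℝ))

variable {m : ℕ} {a : Fin (m + 1) → E → E [⋀^Fin 1]→L[ℝ] L} {S : Set E}

theorem contDiffOn_totalConnection {k : WithTop ℕ∞} (ha : ∀ i, ContDiffOn ℝ k (a i) S) :
    ContDiffOn ℝ k (totalConnection a) (S ×ˢ univ) := by
  have h1 : ContDiffOn ℝ k (fun z : E × (Fin (m + 1) → ℝ) => ∑ i, z.2 i • a i z.1)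
      (S ×ˢ univ) := by
    refine ContDiffOn.sum fun i _ => ?_
    have h2 : ContDiffOn ℝ k (fun z : E × (Fin (m + 1) → ℝ) => z.2 i) (S ×ˢ univ) :=
      ((contDiff_apply ℝ ℝ i).comp contDiff_snd).contDiffOn
    have h3 : ContDiffOn ℝ k (fun z : E × (Fin (m + 1) → ℝ) => a i z.1) (S ×ˢ univ) :=
      (ha i).comp contDiff_fst.contDiffOn fun z hz => hz.1
    exact h2.smul h3
  exact (ContinuousAlternatingMap.compContinuousLinearMapCLM (𝕜 := ℝ) (ι := Fin 1) (F := L)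
    (ContinuousLinearMap.fst ℝ E (Fin (m + 1) → ℝ))).contDiff.comp_contDiffOn h1

theorem hasFDerivWithinAt_sum_smul (t : Fin (m + 1) → ℝ) {y : E}
    (ha : ∀ i, DifferentiableWithinAt ℝ (a i) S y) :
    HasFDerivWithinAt (fun y => ∑ i, t i • a i y)
      (∑ i, t i • fderivWithin ℝ (a i) S y) S y :=
  HasFDerivWithinAt.fun_sum fun i _ => (ha i).hasFDerivWithinAt.const_smul (t i)

/-- The curvature of `∑ t^i a_i` on `E × ℝ^{m+1}` is `F_t + d_t A_t`. -/
theorem localCurvature_totalConnection (hS : UniqueDiffOn ℝ S)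
    {y : E} (hy : y ∈ S) (t : Fin (m + 1) → ℝ)
    (ha : ∀ i, DifferentiableWithinAt ℝ (a i) S y) :
    localCurvature (S ×ˢ univ) (totalConnection a) (y, t) =
      (localCurvature S (fun y => ∑ i, t i • a i y) y).compContinuousLinearMap
        (ContinuousLinearMap.fst ℝ E (Fin (m + 1) → ℝ)) + dtForm fun i => a i y := by
  have hS' : UniqueDiffOn ℝ (S ×ˢ (univ : Set (Fin (m + 1) → ℝ))) := hS.prod uniqueDiffOn_univ
  -- The product rule separates the two parts: differentiating `a i` leads to `dA_t`,
  -- differentiating the coefficient leads to `d_t A_t`.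
  have h1 : ∀ i, HasFDerivWithinAt (fun z : E × (Fin (m + 1) → ℝ) => z.2 i • a i z.1)
      (t i • (fderivWithin ℝ (a i) S y).comp (ContinuousLinearMap.fst ℝ E (Fin (m + 1) → ℝ)) +
        ((ContinuousLinearMap.proj (R := ℝ) (φ := fun _ : Fin (m + 1) => ℝ) i).comp
          (ContinuousLinearMap.snd ℝ E (Fin (m + 1) → ℝ))).smulRight (a i y))
      (S ×ˢ univ) (y, t) := by
    intro i
    have h2 : HasFDerivWithinAt (fun z : E × (Fin (m + 1) → ℝ) => z.2 i)
        ((ContinuousLinearMap.proj (R := ℝ) (φ := fun _ : Fin (m + 1) => ℝ) i).comp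
          (ContinuousLinearMap.snd ℝ E (Fin (m + 1) → ℝ))) (S ×ˢ univ) (y, t) :=
      ((ContinuousLinearMap.proj (R := ℝ) (φ := fun _ : Fin (m + 1) => ℝ) i).comp
          (ContinuousLinearMap.snd ℝ E (Fin (m + 1) → ℝ))).hasFDerivWithinAt
    have h3 : HasFDerivWithinAt (fun z : E × (Fin (m + 1) → ℝ) => a i z.1)
        ((fderivWithin ℝ (a i) S y).comp (ContinuousLinearMap.fst ℝ E (Fin (m + 1) → ℝ)))
        (S ×ˢ univ) (y, t) :=
      (ha i).hasFDerivWithinAt.comp (y, t) hasFDerivWithinAt_fst fun z hz => hz.1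
    exact h2.smul h3
  have h4 := HasFDerivWithinAt.fun_sum (u := Finset.univ) fun i _ => h1 i
  have h5 := (ContinuousAlternatingMap.compContinuousLinearMapCLM (𝕜 := ℝ) (ι := Fin 1) (F := L)
    (ContinuousLinearMap.fst ℝ E (Fin (m + 1) → ℝ))).hasFDerivAt.comp_hasFDerivWithinAt (y, t) h4
  have h6 := hasFDerivWithinAt_sum_smul (a := a) t ha
  ext z
  have h7 := extDerivWithin_oneForm_apply h5 (hS' (y, t) ⟨hy, mem_univ _⟩) z
  have h8 := extDerivWithin_oneForm_apply h6 (hS y hy) fun i => (z i).1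
  rw [localCurvature, ContinuousAlternatingMap.add_apply, ContinuousAlternatingMap.add_apply,
    ContinuousAlternatingMap.compContinuousLinearMap_apply, dtForm_apply]
  refine (congrArg₂ (· + ·) h7 rfl).trans ?_
  -- The total connection ignores vertical components, so its square is just the pullback of `A_t²`.
  have h9 : localCurvature S (fun y => ∑ i, t i • a i y) y
      (⇑(ContinuousLinearMap.fst ℝ E (Fin (m + 1) → ℝ)) ∘ z) =
      extDerivWithin (fun y => ∑ i, t i • a i y) S y (fun i => (z i).1) +
        squareForm (totalConnection a (y, t)) z := rfl
  rw [h9, h8]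
  simp [ContinuousAlternatingMap.sum_apply, Finset.sum_add_distrib, Function.comp_def]
  abel

/-- The extended Cartan homotopy formula on a convex set. -/
theorem local_homotopy_formula [CompleteSpace V] {p n b : ℕ} {f : L [×(n + 1)]→L[ℝ] V}
    (hinv : IsInvariantTensor f) {a : Fin (m + 1) → E → E [⋀^Fin 1]→L[ℝ] L}
    (w : Fin (p + 2) → Fin (m + 1) → ℝ)
    (hS : Convex ℝ S) (hSu : UniqueDiffOn ℝ S) (hSc : S ⊆ closure (interior S)) {y₀ : E}
    (hy₀ : y₀ ∈ S) (ha : ∀ i, ContDiffOn ℝ 2 (a i) S)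
    (h : b + (p + 1) = 2 * n + 2) (h' : b + 1 + p = 2 * n + 2) :
    ∑ j : Fin (p + 2), (-1 : ℝ) ^ (j : ℕ) • ∫ τ in coordSimplex p,
        insertCLM h' (fun i => ((0 : E), w (j.succAbove i.succ) - w (j.succAbove 0)))
          (ContinuousLinearMap.inl ℝ E (Fin (m + 1) → ℝ))
          (pairingComponent f ((localCurvature S (fun y => ∑ i,
            simplexPoint (fun i => w (j.succAbove i)) τ i • a i y) y₀).compContinuousLinearMap
              (ContinuousLinearMap.fst ℝ E (Fin (m + 1) → ℝ))) (dtForm fun i => a i y₀) p) =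
      (-1 : ℝ) ^ p • extDerivWithin (fun y => ∫ τ in coordSimplex (p + 1),
        insertCLM h (fun i => ((0 : E), w i.succ - w 0))
          (ContinuousLinearMap.inl ℝ E (Fin (m + 1) → ℝ))
          (pairingComponent f ((localCurvature S (fun y => ∑ i,
            simplexPoint w τ i • a i y) y).compContinuousLinearMap
              (ContinuousLinearMap.fst ℝ E (Fin (m + 1) → ℝ))) (dtForm fun i => a i y)
                (p + 1))) S y₀ := by
  have hSu' : UniqueDiffOn ℝ (S ×ˢ (univ : Set (Fin (m + 1) → ℝ))) := hSu.prod uniqueDiffOn_univ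
  have hA := contDiffOn_totalConnection ha
  have hcurv : ∀ y ∈ S, ∀ t, localCurvature (S ×ˢ univ) (totalConnection a) (y, t) =
      (localCurvature S (fun y => ∑ i, t i • a i y) y).compContinuousLinearMap
        (ContinuousLinearMap.fst ℝ E (Fin (m + 1) → ℝ)) + dtForm fun i => a i y := fun y hy t =>
    localCurvature_totalConnection hSu hy t fun i => (ha i).differentiableOn two_ne_zero y hy
  -- The Chern-Weil form of the total connection. It is closed, and its components in `dt` are all
  -- the forms occurring in the formula.
  let G : E × (Fin (m + 1) → ℝ) → (E × (Fin (m + 1) → ℝ)) [⋀^Fin (2 * n + 2)]→L[ℝ] V :=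
    fun z => wedgePairingCMM f (fun _ => 2) (sum_two_eq n) fun _ =>
      localCurvature (S ×ˢ univ) (totalConnection a) z
  have hG : ContDiffOn ℝ 1 G (S ×ˢ univ) := by
    intro z hz
    refine ContDiff.comp_contDiffWithinAt (ContinuousMultilinearMap.contDiff (𝕜 := ℝ)
      (wedgePairingCMM (W := E × (Fin (m + 1) → ℝ)) f (fun _ => 2) (sum_two_eq n))) ?_
    exact contDiffWithinAt_pi.2 fun _ => (hA z hz).localCurvature hSu' (by norm_num) hz
  have hcl : ∀ t, extDerivWithin G (S ×ˢ univ) (y₀, t) = 0 := fun t => by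
    refine extDerivWithin_wedgePairing_localCurvature f hinv (sum_two_eq n)
      (hA (y₀, t) ⟨hy₀, mem_univ _⟩) hSu' ⟨hy₀, mem_univ _⟩ ?_
    rw [interior_prod_eq, interior_univ, closure_prod_eq, closure_univ]
    exact ⟨hSc hy₀, mem_univ _⟩
  have hfs := fibre_stokes w hS hSu hy₀ hG hcl h h'
  -- Inserting `q` vertical vectors leaves only the component of degree `q` in `dt`: `q = p` on the
  -- faces, `q = p + 1` on the simplex.
  have hrew : ∀ {q c : ℕ} (hq : c + q = 2 * n + 2) (u : Fin q → Fin (m + 1) → ℝ) (y : E),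
      y ∈ S → ∀ t, insertCLM hq (fun i => ((0 : E), u i))
        (ContinuousLinearMap.inl ℝ E (Fin (m + 1) → ℝ)) (G (y, t)) =
      insertCLM hq (fun i => ((0 : E), u i)) (ContinuousLinearMap.inl ℝ E (Fin (m + 1) → ℝ))
        (pairingComponent f ((localCurvature S (fun y => ∑ i, t i • a i y)
          y).compContinuousLinearMap (ContinuousLinearMap.fst ℝ E (Fin (m + 1) → ℝ)))
            (dtForm fun i => a i y) q) := by
    intro q c hq u y hy t
    rw [← insertCLM_wedgePairing_add, ← hcurv y hy]
  refine Eq.trans ?_ (hfs.trans ?_)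
  · refine Finset.sum_congr rfl fun j _ => ?_
    congr 2
    ext1 τ
    exact (hrew h' (fun i => w (j.succAbove i.succ) - w (j.succAbove 0)) y₀ hy₀ _).symm
  · congr 1
    refine extDerivWithin_congr' (fun y hy => ?_) hy₀
    congr 1
    ext1 τ
    exact hrew h (fun i => w i.succ - w 0) y hy _

end LocalHomotopyFormula

/-! ### From charts to the manifold. -/

section Charts

open MeasureTheory Set Topology

variable {E H M F L V : Type*} [NormedAddCommGroup E] [NormedSpace ℝ E]
  [TopologicalSpace H] {I : ModelWithCorners ℝ E H} [TopologicalSpace M] [ChartedSpace H M]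
  [NormedAddCommGroup F] [NormedSpace ℝ F]
  [NormedLieRing L] [NormedLieAlgebra L] [NormedAddCommGroup V] [NormedSpace ℝ V]

theorem localCurvature_inter {S T : Set E} {y : E} (hT : T ∈ 𝓝 y) (a : E → E [⋀^Fin 1]→L[ℝ] L) :
    localCurvature (S ∩ T) a y = localCurvature S a y := by
  rw [localCurvature, localCurvature, extDerivWithin, extDerivWithin, fderivWithin_inter hT]

/-- With `y` fixed, `F_t` is polynomial in `t`: the derivative part is linear and the square is
quadratic. -/
theorem continuous_localCurvature_sum {m : ℕ} {a : Fin (m + 1) → E → E [⋀^Fin 1]→L[ℝ] L}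
    {S : Set E} {y : E} (hS : UniqueDiffWithinAt ℝ S y)
    (ha : ∀ i, DifferentiableWithinAt ℝ (a i) S y) :
    Continuous fun t : Fin (m + 1) → ℝ => localCurvature S (fun y => ∑ i, t i • a i y) y := by
  have h : ∀ t : Fin (m + 1) → ℝ, localCurvature S (fun y => ∑ i, t i • a i y) y =
      ContinuousAlternatingMap.alternatizeUncurryFinCLM ℝ E L
        (∑ i, t i • fderivWithin ℝ (a i) S y) + squareForm (∑ i, t i • a i y) := fun t => by
    rw [localCurvature, extDerivWithin, (hasFDerivWithinAt_sum_smul t ha).fderivWithin hS]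
    rfl
  simp only [h]
  refine ((ContinuousLinearMap.continuous _).comp ?_).add
    ((contDiff_squareForm (m := 0)).continuous.comp ?_)
  all_goals exact continuous_finsetSum _ fun i _ => (continuous_apply i).smul continuous_const

theorem continuous_pairingComponent {W : Type*} [NormedAddCommGroup W] [NormedSpace ℝ W] {n : ℕ}
    (f : L [×(n + 1)]→L[ℝ] V) (B : W [⋀^Fin 2]→L[ℝ] L) (p : ℕ) :
    Continuous fun F : W [⋀^Fin 2]→L[ℝ] L => pairingComponent f F B p := by
  refine continuous_finsetSum _ fun s _ =>
    (wedgePairingCMM f (fun _ => 2) (sum_two_eq n)).cont.comp (continuous_pi fun i => ?_)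
  by_cases hi : i ∈ s
  · simp only [Finset.piecewise_eq_of_mem, hi]
    exact continuous_const
  · simp only [hi, not_false_eq_true, Finset.piecewise_eq_of_notMem]
    exact continuous_id

theorem continuous_insertCLM_pairingComponent {X Y : Type*} [NormedAddCommGroup X]
    [NormedSpace ℝ X] [TopologicalSpace Y] {n b q : ℕ} (h : b + q = 2 * n + 2) (u : Fin q → X)
    (f : L [×(n + 1)]→L[ℝ] V) (B : (E × X) [⋀^Fin 2]→L[ℝ] L) (p : ℕ)
    {F : Y → E [⋀^Fin 2]→L[ℝ] L} (hF : Continuous F) :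
    Continuous fun y => insertCLM h (fun i => ((0 : E), u i)) (ContinuousLinearMap.inl ℝ E X)
      (pairingComponent f ((F y).compContinuousLinearMap (ContinuousLinearMap.fst ℝ E X)) B p) := by
  refine (ContinuousLinearMap.continuous _).comp ((continuous_pairingComponent f _ p).comp ?_)
  exact (ContinuousAlternatingMap.compContinuousLinearMapCLM (𝕜 := ℝ) (ι := Fin 2) (F := L)
    (ContinuousLinearMap.fst ℝ E X)).continuous.comp hF

theorem insertCLM_inl_compContinuousLinearMap {X : Type*} [NormedAddCommGroup X] [NormedSpace ℝ X]
    {N a q : ℕ} (h : a + q = N) (u : Fin q → X) (Ω : (E × X) [⋀^Fin N]→L[ℝ] V) (g : E →L[ℝ] E) :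
    (insertCLM h (fun i => ((0 : E), u i)) (ContinuousLinearMap.inl ℝ E X)
      Ω).compContinuousLinearMap g =
    insertCLM h (fun i => ((0 : E), u i)) (ContinuousLinearMap.inl ℝ E X)
      (Ω.compContinuousLinearMap (g.prodMap (ContinuousLinearMap.id ℝ X))) := by
  ext v
  rw [ContinuousAlternatingMap.compContinuousLinearMap_apply, insertCLM_apply, insertCLM_apply,
    ContinuousAlternatingMap.compContinuousLinearMap_apply]
  congr 1
  refine Eq.trans ?_ (comp_headTail _ _ _ _).symm
  simp

theorem insertCLM_pairingComponent_compContinuousLinearMap {m n b q : ℕ}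
    (h : b + q = 2 * n + 2) (u : Fin q → Fin (m + 1) → ℝ) (f : L [×(n + 1)]→L[ℝ] V)
    (F : E [⋀^Fin 2]→L[ℝ] L) (a : Fin (m + 1) → E [⋀^Fin 1]→L[ℝ] L) (p : ℕ) (g : E →L[ℝ] E) :
    (insertCLM h (fun i => ((0 : E), u i)) (ContinuousLinearMap.inl ℝ E (Fin (m + 1) → ℝ))
      (pairingComponent f (F.compContinuousLinearMap
        (ContinuousLinearMap.fst ℝ E (Fin (m + 1) → ℝ))) (dtForm a) p)).compContinuousLinearMap g =
    insertCLM h (fun i => ((0 : E), u i)) (ContinuousLinearMap.inl ℝ E (Fin (m + 1) → ℝ))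
      (pairingComponent f ((F.compContinuousLinearMap g).compContinuousLinearMap
        (ContinuousLinearMap.fst ℝ E (Fin (m + 1) → ℝ)))
          (dtForm fun i => (a i).compContinuousLinearMap g) p) := by
  rw [insertCLM_inl_compContinuousLinearMap, pairingComponent_compContinuousLinearMap,
    dtForm_compContinuousLinearMap]
  rfl

theorem integral_compContinuousLinearMap [CompleteSpace V] {X : Type*} [MeasurableSpace X]
    {μ : Measure X} {k : ℕ} {φ : X → E [⋀^Fin k]→L[ℝ] V} (hφ : Integrable φ μ) (g : E →L[ℝ] E) :
    (∫ x, φ x ∂μ).compContinuousLinearMap g = ∫ x, (φ x).compContinuousLinearMap g ∂μ :=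
  ((ContinuousAlternatingMap.compContinuousLinearMapCLM (𝕜 := ℝ) (ι := Fin k) (F := V)
    g).integral_comp_comm hφ).symm

section
variable [IsManifold I 1 M]

theorem inChart_eq {k : ℕ} (α : DForm E M k F) {x₀ : M} {y : E}
    (hy : y ∈ (extChartAt I x₀).target) :
    inChart I α x₀ y = (α ((extChartAt I x₀).symm y)).compContinuousLinearMap
      (tangentCoordChange I x₀ ((extChartAt I x₀).symm y) ((extChartAt I x₀).symm y)) := by
  rw [tangentCoordChange_def, (extChartAt I x₀).right_inv hy]
  rfl

theorem inChart_center {k : ℕ} (α : DForm E M k F) (x₀ : M) :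
    inChart I α x₀ (extChartAt I x₀ x₀) = α x₀ := by
  rw [inChart_eq α (mem_extChartAt_target x₀)]
  ext v
  rw [ContinuousAlternatingMap.compContinuousLinearMap_apply, extChartAt_to_inv x₀]
  congr 1
  ext1 i
  exact tangentCoordChange_self (mem_extChartAt_source x₀)

/-- The expressions of a form in two charts are related by the change of coordinates. -/
theorem inChart_eq_pullback {k : ℕ} (α : DForm E M k F) {x₀ x₁ : M} {y : E}
    (hy : y ∈ (extChartAt I x₀).target)
    (hy' : (extChartAt I x₀).symm y ∈ (extChartAt I x₁).source) :
    inChart I α x₀ y = (inChart I α x₁ ((extChartAt I x₁ ∘ (extChartAt I x₀).symm)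
      y)).compContinuousLinearMap
        (fderivWithin ℝ (extChartAt I x₁ ∘ (extChartAt I x₀).symm) (range I) y) := by
  have h1 : fderivWithin ℝ (extChartAt I x₁ ∘ (extChartAt I x₀).symm) (range I) y =
      tangentCoordChange I x₀ x₁ ((extChartAt I x₀).symm y) := by
    rw [tangentCoordChange_def, (extChartAt I x₀).right_inv hy]
  rw [h1, inChart_eq α hy, Function.comp_apply, inChart_eq α ((extChartAt I x₁).map_source hy'),
    (extChartAt I x₁).left_inv hy']
  ext v
  simp only [ContinuousAlternatingMap.compContinuousLinearMap_apply]
  congr 1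
  ext1 i
  exact (tangentCoordChange_comp ⟨⟨(extChartAt I x₀).map_target hy, hy'⟩,
    mem_extChartAt_source _⟩).symm

end

theorem IsSmoothForm.differentiableWithinAt {k : ℕ} {α : DForm E M k F} (hα : IsSmoothForm I α)
    {x₀ : M} {y : E} (hy : y ∈ (extChartAt I x₀).target) :
    DifferentiableWithinAt ℝ (inChart I α x₀) (range I) y :=
  (((hα x₀).differentiableOn (by simp)) y hy).mono_of_mem_nhdsWithin
    (extChartAt_target_mem_nhdsWithin_of_mem hy)

theorem inChart_sum_smul {k m : ℕ} (t : Fin m → ℝ) (α : Fin m → DForm E M k F) (x₀ : M) (y : E) :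
    inChart I (∑ i, t i • α i) x₀ y = ∑ i, t i • inChart I (α i) x₀ y := by
  ext v
  simp [inChart, ContinuousAlternatingMap.sum_apply]

theorem integrateSimplex_homotopyPower {m n b q : ℕ} (h : b + q = 2 * n + 2)
    (f : L [×(n + 1)]→L[ℝ] V) (A : Fin (m + 1) → DForm E M 1 L)
    (w : Fin (q + 1) → Fin (m + 1) → ℝ) (p : ℕ) (x : M) :
    integrateSimplex h w (homotopyPower I f A p) x = ∫ τ in coordSimplex q,
      insertCLM h (fun i => ((0 : E), w i.succ - w 0))
        (ContinuousLinearMap.inl ℝ E (Fin (m + 1) → ℝ))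
        (pairingComponent f ((curvature I (simplexConnection A
          (simplexPoint w τ)) x).compContinuousLinearMap
            (ContinuousLinearMap.fst ℝ E (Fin (m + 1) → ℝ))) (dtForm fun i => A i x) p) := by
  simp only [← homotopyPower_eq]
  rfl

variable [IsManifold I ∞ M]

/-- `extD` uses a different chart at each point. Naturality of the exterior derivative under the
change of coordinates lets all these derivatives be computed in the one chart at `x₀`. -/
theorem inChart_extD {k : ℕ} {α : DForm E M k F} {x₀ : M} {y : E}
    (hα : DifferentiableWithinAt ℝ (inChart I α ((extChartAt I x₀).symm y)) (range I)
      (extChartAt I ((extChartAt I x₀).symm y) ((extChartAt I x₀).symm y)))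
    (hy : y ∈ (extChartAt I x₀).target) :
    inChart I (extD I α) x₀ y = extDerivWithin (inChart I α x₀) (range I) y := by
  have : IsManifold I 1 M := IsManifold.of_le (n := ∞) (by simp)
  have : IsManifold I 2 M :=
    IsManifold.of_le (n := ∞) (WithTop.coe_le_coe.2 (le_top : (2 : ℕ∞) ≤ ⊤))
  set z := (extChartAt I x₀).symm y with hz
  have hyr : y ∈ range I := extChartAt_target_subset_range x₀ hy
  have hpull := extDerivWithin_pullback (𝕜 := ℝ) (r := 2) (t := range I)
    (f := extChartAt I z ∘ (extChartAt I x₀).symm) (s := range I) (x := y) hα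
    (contDiffWithinAt_ext_coord_change z x₀ ⟨hy, mem_extChartAt_source z⟩) (by simp)
    I.uniqueDiffOn (I.range_subset_closure_interior hyr) hyr
    (fun w _ => by
      exact mem_range_self _)
  have hev : inChart I α x₀ =ᶠ[𝓝[range I] y] fun y => (inChart I α z
      ((extChartAt I z ∘ (extChartAt I x₀).symm) y)).compContinuousLinearMap
        (fderivWithin ℝ (extChartAt I z ∘ (extChartAt I x₀).symm) (range I) y) := by
    have hsrc : (extChartAt I x₀).symm ⁻¹' (extChartAt I z).source ∈ 𝓝 y :=
      (continuousAt_extChartAt_symm'' hy).preimage_mem_nhds (extChartAt_source_mem_nhds z)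
    filter_upwards [extChartAt_target_mem_nhdsWithin_of_mem hy,
      mem_nhdsWithin_of_mem_nhds hsrc] with w hw hw'
    exact inChart_eq_pullback α hw hw'
  rw [hev.extDerivWithin_eq_of_mem hyr, hpull]
  rfl

theorem inChart_curvature {A : DForm E M 1 L} {x₀ : M} {y : E}
    (hA : ∀ x₁ y₁, y₁ ∈ (extChartAt I x₁).target →
      DifferentiableWithinAt ℝ (inChart I A x₁) (range I) y₁)
    (hy : y ∈ (extChartAt I x₀).target) :
    inChart I (curvature I A) x₀ y = localCurvature (range I) (inChart I A x₀) y := by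
  rw [localCurvature, ← inChart_extD (hA _ _ (mem_extChartAt_target _)) hy]
  rfl

theorem inChart_curvature_simplexConnection {m : ℕ} {A : Fin (m + 1) → DForm E M 1 L}
    (hA : ∀ i, IsSmoothForm I (A i)) (t : Fin (m + 1) → ℝ) {x₀ : M} {y : E}
    (hy : y ∈ (extChartAt I x₀).target) :
    inChart I (curvature I (simplexConnection A t)) x₀ y =
      localCurvature (range I) (fun y => ∑ i, t i • inChart I (A i) x₀ y) y := by
  have h : ∀ x₁, inChart I (simplexConnection A t) x₁ =
      fun y => ∑ i, t i • inChart I (A i) x₁ y := fun x₁ => by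
    ext1 y
    exact inChart_sum_smul t A x₁ y
  rw [inChart_curvature _ hy, h]
  intro x₁ y₁ hy₁
  rw [h]
  exact (hasFDerivWithinAt_sum_smul t
    fun i => (hA i).differentiableWithinAt hy₁).differentiableWithinAt

theorem continuous_curvature_simplexConnection {m : ℕ} {A : Fin (m + 1) → DForm E M 1 L}
    (hA : ∀ i, IsSmoothForm I (A i)) (x : M) :
    Continuous fun t => curvature I (simplexConnection A t) x := by
  have : IsManifold I 1 M := IsManifold.of_le (n := ∞) (by simp)
  have hx := mem_extChartAt_target (I := I) x
  have h : (fun t => curvature I (simplexConnection A t) x) = fun t =>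
      localCurvature (range I) (fun y => ∑ i, t i • inChart I (A i) x y) (extChartAt I x x) := by
    ext1 t
    rw [← inChart_curvature_simplexConnection hA t hx, inChart_center]
  rw [h]
  exact continuous_localCurvature_sum (I.uniqueDiffOn _ (extChartAt_target_subset_range x hx))
    fun i => (hA i).differentiableWithinAt hx

theorem continuous_simplexPoint {m q : ℕ} (w : Fin (q + 1) → Fin (m + 1) → ℝ) :
    Continuous (simplexPoint w) := (contDiff_simplexPoint (k := 0) w).continuous

/-- Pullback by a change of coordinates acts only on the `M` factor and is continuous and linear, so
it passes under the integral and through each operation in the integrand. -/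
theorem inChart_integrateSimplex [CompleteSpace V] {m n b q : ℕ} (h : b + q = 2 * n + 2)
    (f : L [×(n + 1)]→L[ℝ] V) {A : Fin (m + 1) → DForm E M 1 L} (hA : ∀ i, IsSmoothForm I (A i))
    (w : Fin (q + 1) → Fin (m + 1) → ℝ) (p : ℕ) {x₀ : M} {y : E}
    (hy : y ∈ (extChartAt I x₀).target) :
    inChart I (integrateSimplex h w (homotopyPower I f A p)) x₀ y = ∫ τ in coordSimplex q,
      insertCLM h (fun i => ((0 : E), w i.succ - w 0))
        (ContinuousLinearMap.inl ℝ E (Fin (m + 1) → ℝ))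
        (pairingComponent f ((localCurvature (range I) (fun y => ∑ i,
          simplexPoint w τ i • inChart I (A i) x₀ y) y).compContinuousLinearMap
            (ContinuousLinearMap.fst ℝ E (Fin (m + 1) → ℝ)))
              (dtForm fun i => inChart I (A i) x₀ y) p) := by
  have : IsManifold I 1 M := IsManifold.of_le (n := ∞) (by simp)
  have hcont := continuous_insertCLM_pairingComponent h (fun i => w i.succ - w 0) f
    (dtForm fun i => A i ((extChartAt I x₀).symm y)) p
    ((continuous_curvature_simplexConnection hA ((extChartAt I x₀).symm y)).comp
      (continuous_simplexPoint w))
  rw [inChart_eq _ hy, integrateSimplex_homotopyPower]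
  simp only [Function.comp_def] at hcont
  have hint : Integrable _ (volume.restrict (coordSimplex q)) := integrableOn_coordSimplex hcont
  rw [integral_compContinuousLinearMap hint]
  refine integral_congr_ae (Filter.Eventually.of_forall fun τ => ?_)
  have h1 := inChart_curvature_simplexConnection hA (simplexPoint w τ) hy
  have h2 := fun i => inChart_eq (A i) hy
  rw [inChart_eq _ hy] at h1
  simp only [h2]
  rw [← h1]
  exact insertCLM_pairingComponent_compContinuousLinearMap _ _ _ _ _ _ _

/-- The extended Cartan homotopy formula for a simplex with arbitrary vertices. -/
theorem cartan_homotopy_formula [CompleteSpace V] {m p n b : ℕ} {f : L [×(n + 1)]→L[ℝ] V}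
    (hinv : IsInvariantTensor f) {A : Fin (m + 1) → DForm E M 1 L}
    (hA : ∀ i, IsSmoothForm I (A i)) (w : Fin (p + 2) → Fin (m + 1) → ℝ)
    (h : b + (p + 1) = 2 * n + 2) (h' : b + 1 + p = 2 * n + 2) :
    ∑ j : Fin (p + 2), (-1 : ℝ) ^ (j : ℕ) •
        integrateSimplex h' (fun i => w (j.succAbove i)) (homotopyPower I f A p) =
      (-1 : ℝ) ^ p • extD I (integrateSimplex h w (homotopyPower I f A (p + 1))) := by
  have : IsManifold I 1 M := IsManifold.of_le (n := ∞) (by simp)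
  ext1 x
  have hx := mem_extChartAt_target (I := I) x
  -- The chart target need not be convex, but near the base point it contains the range of the model
  -- intersected with a ball, which is convex even at boundary and corner points.
  obtain ⟨δ, hδ, hball⟩ := Metric.mem_nhdsWithin_iff.1 (extChartAt_target_mem_nhdsWithin (I := I) x)
  set y₀ := extChartAt I x x with hy₀
  have hnhds : ∀ y ∈ Metric.ball y₀ δ, Metric.ball y₀ δ ∈ 𝓝 y := fun y hy =>
    Metric.isOpen_ball.mem_nhds hy
  have hsub : range I ∩ Metric.ball y₀ δ ⊆ (extChartAt I x).target := fun y hy =>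
    hball ⟨hy.2, hy.1⟩
  have hmem : y₀ ∈ range I ∩ Metric.ball y₀ δ :=
    ⟨extChartAt_target_subset_range x hx, Metric.mem_ball_self hδ⟩
  have hcl : range I ∩ Metric.ball y₀ δ ⊆ closure (interior (range I ∩ Metric.ball y₀ δ)) := by
    rw [interior_inter, Metric.isOpen_ball.interior_eq]
    intro y hy
    exact Metric.isOpen_ball.closure_inter ⟨I.range_subset_closure_interior hy.1, hy.2⟩
  have hloc := local_homotopy_formula hinv w (I.convex_range.inter (convex_ball y₀ δ))
    (I.uniqueDiffOn.inter Metric.isOpen_ball) hcl hmem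
    (fun i => ((hA i x).mono hsub).of_le (WithTop.coe_le_coe.2 (le_top : (2 : ℕ∞) ≤ ⊤))) h h'
  simp only [Finset.sum_apply, Pi.smul_apply]
  refine Eq.trans ?_ (hloc.trans ?_)
  · refine Finset.sum_congr rfl fun j _ => ?_
    rw [← inChart_center (I := I) (integrateSimplex h' _ _) x,
      inChart_integrateSimplex h' f hA _ p hx]
    simp only [localCurvature_inter (hnhds y₀ hmem.2)]
  · congr 1
    -- Derivatives at a point do not change on passing from the ball to the whole range of the
    -- model, and only the germ of the form at that point matters.
    rw [extD, ← hy₀, extDerivWithin, extDerivWithin, fderivWithin_inter (hnhds y₀ hmem.2)]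
    refine congrArg _ (Filter.EventuallyEq.fderivWithin_eq_of_mem ?_ hmem.1)
    filter_upwards [self_mem_nhdsWithin, mem_nhdsWithin_of_mem_nhds (hnhds y₀ hmem.2)] with y hy hy'
    rw [inChart_integrateSimplex h f hA _ (p + 1) (hsub ⟨hy, hy'⟩)]
    simp only [localCurvature_inter (hnhds y hy')]

end Charts

/-! ### Alternating sums with one or two vertical vectors inserted. -/

section BlockSums

variable {W L V : Type*} [AddCommGroup V]

theorem Fin.insertNth_succ_eq_cons {α : Type*} {n : ℕ} (p : Fin (n + 1)) (u : α)
    (x : Fin (n + 1) → α) : (p.succ.insertNth u x : Fin (n + 2) → α) =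
      Fin.cons (x 0) (p.insertNth u fun i => x i.succ : Fin (n + 1) → α) := by
  conv_lhs => rw [← Fin.cons_self_tail x]
  exact Fin.insertNth_succ_cons _ _ _ _

theorem Fin.sum_univ_eq_two {k : ℕ} (F : Fin (k + 2) → V) (h : ∀ i : Fin k, F i.succ.succ = 0) :
    ∑ p, F p = F 0 + F (Fin.succ 0) := by
  simp [Fin.sum_univ_succ, h]

theorem Fin.sum_univ_eq_three {k : ℕ} (F : Fin (k + 3) → V)
    (h : ∀ i : Fin k, F i.succ.succ.succ = 0) :
    ∑ p, F p = F 0 + (F (Fin.succ 0) + F (Fin.succ (Fin.succ 0))) := by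
  rw [Fin.sum_univ_succ, Fin.sum_univ_eq_two _ h]

theorem Fin.sum_univ_eq_four {k : ℕ} (F : Fin (k + 4) → V)
    (h : ∀ i : Fin k, F i.succ.succ.succ.succ = 0) :
    ∑ p, F p = F 0 + (F (Fin.succ 0) + (F (Fin.succ (Fin.succ 0)) +
      F (Fin.succ (Fin.succ (Fin.succ 0))))) := by
  rw [Fin.sum_univ_succ, Fin.sum_univ_eq_three _ h]

/-- Insertion of a vector into the first factor of a product of two-forms, when it annihilates the
other factors. -/
theorem sum_sign_smul_cons_block [AddCommGroup L] {k : ℕ} (B : W → W → L)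
    (hB : ∀ a b, B a b = - B b a) (G : L → (Fin k → W) → V)
    (hneg : ∀ a z, G (-a) z = - G a z) (u : W) (hG : ∀ a z i, z i = u → G a z = 0)
    (w : Fin (k + 1) → W) :
    ∑ σ : Equiv.Perm (Fin (k + 2)), Equiv.Perm.sign σ •
      (fun y : Fin (k + 2) → W => G (B (y 0) (y 1)) fun i => y i.succ.succ)
        ((Fin.cons u w : Fin (k + 2) → W) ∘ σ) =
    2 • ∑ e : Equiv.Perm (Fin (k + 1)), Equiv.Perm.sign e •
      G (B u (w (e 0))) fun i => w (e i.succ) := by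
  -- Only the two positions inside `B` can hold `u`. They contribute equally, the sign of the second
  -- being undone by skew-symmetry of `B`.
  rw [sum_sign_smul_cons fun y : Fin (k + 2) → W => G (B (y 0) (y 1)) fun i => y i.succ.succ,
    Fin.sum_univ_eq_two, two_smul]
  · congr 1
    · simp only [Fin.val_zero, pow_zero, one_smul]
      rfl
    · simp only [← Fin.succ_zero_eq_one, Fin.insertNth_succ_eq_cons, Fin.insertNth_zero',
        Fin.cons_zero, Fin.cons_succ, Function.comp_apply, fun x => hB x u, hneg, smul_neg,
        Finset.sum_neg_distrib, Fin.val_succ, Fin.val_zero, zero_add, pow_one, Units.neg_smul,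
        one_smul, neg_neg]
  · intro p
    rw [Finset.sum_eq_zero, smul_zero]
    intro e _
    rw [hG _ _ p, smul_zero]
    exact Fin.insertNth_apply_same _ _ _

/-- Insertion of two vectors into the first two factors of a product of two-forms, when they
annihilate the other factors. -/
theorem sum_sign_smul_cons_cons_block [AddCommGroup L] {k : ℕ} (B : W → W → L)
    (hB : ∀ a b, B a b = - B b a) (G : L → L → (Fin k → W) → V)
    (hneg₁ : ∀ a b z, G (-a) b z = - G a b z) (hsymm : ∀ a b z, G a b z = G b a z)
    (h0 : ∀ b z, G 0 b z = 0) (u₁ u₂ : W) (hu : B u₁ u₂ = 0)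
    (hG₁ : ∀ a b z i, z i = u₁ → G a b z = 0) (hG₂ : ∀ a b z i, z i = u₂ → G a b z = 0)
    (w : Fin (k + 2) → W) (hw : ∀ i j, B (w i) (w j) = 0) :
    ∑ σ : Equiv.Perm (Fin (k + 4)), Equiv.Perm.sign σ •
      (fun y : Fin (k + 4) → W => G (B (y 0) (y 1)) (B (y 2) (y 3))
        fun i => y i.succ.succ.succ.succ)
        ((Fin.cons u₁ (Fin.cons u₂ w : Fin (k + 3) → W) : Fin (k + 4) → W) ∘ σ) =
    8 • ∑ e : Equiv.Perm (Fin (k + 2)), Equiv.Perm.sign e •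
      G (B u₂ (w (e 0))) (B u₁ (w (e 1))) fun i => w (e i.succ.succ) := by
  set g : (Fin (k + 4) → W) → V := fun y => G (B (y 0) (y (Fin.succ 0)))
    (B (y (Fin.succ (Fin.succ 0))) (y (Fin.succ (Fin.succ (Fin.succ 0)))))
    fun i => y i.succ.succ.succ.succ with hg
  set S := ∑ e : Equiv.Perm (Fin (k + 2)), Equiv.Perm.sign e •
    G (B u₂ (w (e 0))) (B u₁ (w (e (Fin.succ 0)))) fun i => w (e i.succ.succ) with hS
  -- Exchanging the two horizontal arguments and then the two symmetric slots of `G` reverses the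
  -- sign.
  have hS' : ∑ e : Equiv.Perm (Fin (k + 2)), Equiv.Perm.sign e •
      G (B u₁ (w (e 0))) (B u₂ (w (e (Fin.succ 0)))) (fun i => w (e i.succ.succ)) = -S := by
    rw [hS, ← Finset.sum_neg_distrib]
    refine Fintype.sum_equiv (Equiv.mulRight (Equiv.swap 0 (Fin.succ 0))) _ _ fun e => ?_
    have hi : ∀ i : Fin k, Equiv.swap (0 : Fin (k + 2)) (Fin.succ 0) i.succ.succ = i.succ.succ :=
      fun i =>
      Equiv.swap_apply_of_ne_of_ne (Fin.succ_ne_zero _)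
        fun h => Fin.succ_ne_zero i (Fin.succ_injective _ h)
    simp only [Equiv.coe_mulRight, Equiv.Perm.sign_mul,
      Equiv.Perm.sign_swap (Fin.succ_ne_zero _).symm,
      Equiv.Perm.mul_apply, Equiv.swap_apply_left, Equiv.swap_apply_right, hi, mul_neg, mul_one,
      Units.neg_smul, neg_neg]
    rw [hsymm]
  have hneg₂ : ∀ a b z, G a (-b) z = - G a b z := fun a b z => by rw [hsymm, hneg₁, hsymm]
  have huB : B u₂ u₁ = 0 := by rw [hB, hu, neg_zero]
  let T : Fin (k + 4) → Fin (k + 3) → V := fun p p' => ∑ e : Equiv.Perm (Fin (k + 2)),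
    Equiv.Perm.sign e • g (p.insertNth u₁ (p'.insertNth u₂ (w ∘ e) : Fin (k + 3) → W))
  have hT : ∑ σ : Equiv.Perm (Fin (k + 4)), Equiv.Perm.sign σ •
      g ((Fin.cons u₁ (Fin.cons u₂ w : Fin (k + 3) → W) : Fin (k + 4) → W) ∘ σ) =
      ∑ p : Fin (k + 4), (-1 : ℤˣ) ^ (p : ℕ) •
        ∑ p' : Fin (k + 3), (-1 : ℤˣ) ^ (p' : ℕ) • T p p' := by
    rw [sum_sign_smul_cons g]
    refine Finset.sum_congr rfl fun p _ => ?_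
    rw [sum_sign_smul_cons fun y : Fin (k + 3) → W => g (p.insertNth u₁ y)]
  have hT₁ : ∀ (i : Fin k) p', T i.succ.succ.succ.succ p' = 0 := fun i p' =>
    Finset.sum_eq_zero fun e _ => by
      rw [hg]
      simp only
      rw [hG₁ _ _ _ i (Fin.insertNth_apply_same _ _ _), smul_zero]
  -- Once a position among the first four has been used for `u₁`, index `i + 3` of the remaining
  -- tuple is position `i + 4` of the full one, outside both `B` factors.
  have hT₂ : ∀ (p : Fin 4) (i : Fin k), T (Fin.castLE (by omega) p) i.succ.succ.succ = 0 := by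
    intro p i
    refine Finset.sum_eq_zero fun e _ => ?_
    have hp : (Fin.castLE (by omega : 4 ≤ k + 4) p).succAbove i.succ.succ.succ =
        i.succ.succ.succ.succ := by
      rw [Fin.succAbove_of_le_castSucc]
      simp only [Fin.le_def, Fin.val_castLE, Fin.val_castSucc, Fin.val_succ]
      omega
    rw [hg]
    simp only
    rw [hG₂ _ _ _ i, smul_zero]
    rw [← hp, Fin.insertNth_apply_succAbove, Fin.insertNth_apply_same]
  -- For each position of `u₁`, the vector `u₂` must lie in the other `B` factor, at either of two
  -- positions. After the signs are collected both contribute the same multiple of `S`.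
  have key : ∀ p : Fin 4,
      ∑ p' : Fin (k + 3), (-1 : ℤˣ) ^ (p' : ℕ) • T (Fin.castLE (by omega) p) p' =
      (-1 : ℤˣ) ^ (p : ℕ) • (2 : ℕ) • S := by
    intro p
    rw [Fin.sum_univ_eq_three _ fun i => by rw [hT₂, smul_zero]]
    have e0 : Fin.castLE (by omega : 4 ≤ k + 4) 0 = 0 := rfl
    have e1 : Fin.castLE (by omega : 4 ≤ k + 4) 1 = Fin.succ 0 := rfl
    have e2 : Fin.castLE (by omega : 4 ≤ k + 4) 2 = Fin.succ (Fin.succ 0) := rfl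
    have e3 : Fin.castLE (by omega : 4 ≤ k + 4) 3 = Fin.succ (Fin.succ (Fin.succ 0)) := rfl
    have hu₁ : ∀ x, B x u₁ = -B u₁ x := fun x => hB _ _
    have hu₂ : ∀ i, B (w i) u₂ = -B u₂ (w i) := fun x => hB _ _
    fin_cases p
    all_goals
      simp only [Fin.zero_eta, Fin.mk_one, Fin.reduceFinMk, e0, e1, e2, e3, T, hg,
        Fin.insertNth_succ_eq_cons, Fin.insertNth_zero', Fin.cons_zero, Fin.cons_succ,
        Function.comp_apply, hu, huB, hw, h0, hu₁, hu₂, hneg₁, hneg₂, smul_zero, smul_neg,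
        Finset.sum_neg_distrib, Finset.sum_const_zero, hS', ← hS, neg_neg, Fin.val_succ,
        Fin.val_zero, zero_add, pow_succ, pow_zero, mul_neg, mul_one, Units.neg_smul,
        one_smul, two_smul, add_zero, neg_add]
  change ∑ σ : Equiv.Perm (Fin (k + 4)), Equiv.Perm.sign σ •
      g ((Fin.cons u₁ (Fin.cons u₂ w : Fin (k + 3) → W) : Fin (k + 4) → W) ∘ σ) = 8 • S
  -- Four positions for `u₁` times two for `u₂` give the factor `8`; the sign `(-1) ^ p` appears
  -- twice and cancels.
  rw [hT, Fin.sum_univ_eq_four]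
  · have h0 := key 0
    have h1 := key 1
    have h2 := key 2
    have h3 := key 3
    have e0 : Fin.castLE (by omega : 4 ≤ k + 4) 0 = 0 := rfl
    have e1 : Fin.castLE (by omega : 4 ≤ k + 4) 1 = Fin.succ 0 := rfl
    have e2 : Fin.castLE (by omega : 4 ≤ k + 4) 2 = Fin.succ (Fin.succ 0) := rfl
    have e3 : Fin.castLE (by omega : 4 ≤ k + 4) 3 = Fin.succ (Fin.succ (Fin.succ 0)) := rfl
    rw [e0] at h0
    rw [e1] at h1
    rw [e2] at h2
    rw [e3] at h3
    rw [h0, h1, h2, h3]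
    simp only [smul_smul, Fin.val_succ, Fin.coe_ofNat_eq_mod]
    norm_num [pow_succ]
    abel
  · intro i
    rw [Finset.sum_eq_zero, smul_zero]
    intro p' _
    rw [hT₁, smul_zero]

end BlockSums

/-! ### Commutation of two-forms inside a symmetric tensor. -/

section Symmetry

variable {W L V : Type*} [NormedAddCommGroup W] [NormedSpace ℝ W]
  [NormedLieRing L] [NormedLieAlgebra L] [NormedAddCommGroup V] [NormedSpace ℝ V]

/-- Two-forms commute inside a symmetric tensor. -/
theorem wedgePairing_twoForms_perm {r N : ℕ} {f : L [×r]→L[ℝ] V} (hf : IsSymmetricTensor f)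
    (h : ∑ _i : Fin r, 2 = N) (η : Fin r → W [⋀^Fin 2]→L[ℝ] L) (π : Equiv.Perm (Fin r)) :
    wedgePairingCMM f (fun _ => 2) h (fun i => η (π i)) = wedgePairingCMM f (fun _ => 2) h η := by
  let ε : Fin 2 × Fin r ≃ Fin N :=
    (Equiv.prodComm _ _).trans ((Equiv.sigmaEquivProd _ _).symm.trans
      (finSigmaFinEquiv.trans (finCongr h)))
  have hε : ∀ i j, twoFormIndex h i j = ε (j, i) := fun i j => rfl
  let b : Equiv.Perm (Fin N) := ε.permCongr (Equiv.prodCongrRight fun _ : Fin 2 => π)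
  -- Permuting blocks of length two applies `π` once to the first and once to the second arguments
  -- of the blocks, so the sign is a square.
  have hb : Equiv.Perm.sign b = 1 := by
    simp only [b, Equiv.Perm.sign_permCongr, Equiv.Perm.sign_prodCongrRight, Finset.prod_const,
      Finset.card_univ, Fintype.card_fin]
    exact Int.units_sq _
  have hbε : ∀ i j, b (ε (j, i)) = ε (j, π i) := fun i j => by
    simp [b, Equiv.permCongr_apply]
  ext v
  rw [wedgePairing_twoForms_apply, wedgePairing_twoForms_apply]
  congr 1
  refine Fintype.sum_equiv (Equiv.mulRight b⁻¹) _ _ fun σ => ?_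
  rw [Equiv.coe_mulRight, Equiv.Perm.sign_mul, Equiv.Perm.sign_inv, hb, mul_one,
    ← hf π fun i => η i ![(v ∘ ⇑(σ * b⁻¹)) (twoFormIndex h i 0),
      (v ∘ ⇑(σ * b⁻¹)) (twoFormIndex h i 1)]]
  have hb' : ∀ i j, b⁻¹ (ε (j, π i)) = ε (j, i) := fun i j => by
    rw [← hbε]; exact b.symm_apply_apply _
  simp only [hε, Function.comp_apply, Equiv.Perm.mul_apply, hb']

end Symmetry

/-! ### The components of degree one and two in `dt` as transgression integrands. -/

section Symmetry

variable {W E L V : Type*} [NormedAddCommGroup W] [NormedSpace ℝ W]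
  [NormedAddCommGroup E] [NormedSpace ℝ E]
  [NormedLieRing L] [NormedLieAlgebra L] [NormedAddCommGroup V] [NormedSpace ℝ V]

theorem exists_perm_mem_iff {r : ℕ} {s t : Finset (Fin r)} (h : s.card = t.card) :
    ∃ π : Equiv.Perm (Fin r), ∀ i, π i ∈ t ↔ i ∈ s := by
  let e : {i // i ∈ s} ≃ {i // i ∈ t} := Fintype.equivOfCardEq (by simpa using h)
  refine ⟨e.extendSubtype, fun i => ⟨fun hi => ?_, fun hi => e.extendSubtype_mem i hi⟩⟩
  by_contra hs
  exact e.extendSubtype_not_mem i hs hi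

/-- Two subsets of equal size differ by a permutation of the factors, under which the pairing is
unchanged; so all `choose (n + 1) p` terms agree. -/
theorem pairingComponent_eq_smul {n p : ℕ} {f : L [×(n + 1)]→L[ℝ] V} (hf : IsSymmetricTensor f)
    (F B : W [⋀^Fin 2]→L[ℝ] L) {t : Finset (Fin (n + 1))} (ht : t.card = p) :
    pairingComponent f F B p = ((n + 1).choose p : ℝ) • wedgePairingCMM f (fun _ => 2)
      (sum_two_eq n) (t.piecewise (fun _ => B) fun _ => F) := by
  rw [pairingComponent, Finset.sum_congr rfl (g := fun _ => wedgePairingCMM f (fun _ => 2)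
      (sum_two_eq n) (t.piecewise (fun _ => B) fun _ => F)), Finset.sum_const,
    Finset.card_powersetCard, Finset.card_univ, Fintype.card_fin, Nat.cast_smul_eq_nsmul]
  intro s hs
  obtain ⟨π, hπ⟩ := exists_perm_mem_iff ((Finset.mem_powersetCard_univ.1 hs).trans ht.symm)
  refine Eq.trans ?_ (wedgePairing_twoForms_perm hf _ _ π)
  congr 1
  ext1 i
  by_cases hi : i ∈ s
  · simp [hi, (hπ i).2 hi]
  · simp [hi, (hπ i).not.2 hi]

theorem IsSymmetricTensor.cons_cons_swap {n : ℕ} {f : L [×(n + 2)]→L[ℝ] V}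
    (hf : IsSymmetricTensor f) (a b : L) (c : Fin n → L) :
    f (Fin.cons a (Fin.cons b c : Fin (n + 1) → L)) =
      f (Fin.cons b (Fin.cons a c : Fin (n + 1) → L)) := by
  rw [← hf (Equiv.swap 0 (Fin.succ 0))]
  congr 1
  ext1 i
  refine Fin.cases ?_ (fun i => Fin.cases ?_ (fun i => ?_) i) i
  · simp
  · rw [Equiv.swap_apply_right, Fin.cons_zero, Fin.cons_succ, Fin.cons_zero]
  · rw [Equiv.swap_apply_of_ne_of_ne (Fin.succ_ne_zero _)
      fun h => Fin.succ_ne_zero i (Fin.succ_injective _ h)]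
    rfl

theorem twoFormIndex_val {r N : ℕ} (h : ∑ _i : Fin r, 2 = N) (i : Fin r) (j : Fin 2) :
    (twoFormIndex h i j : ℕ) = 2 * i + j := by
  rw [twoFormIndex, Fin.val_cast, finSigmaFinEquiv_apply]
  simp [mul_comm]

/-- The degree is part of the data of a `HomForm`, so identifying a factor means carrying its
arguments along the equality of degrees. -/
theorem HomForm.apply_of_eq {k : ℕ} {α : HomForm W L} {η : W [⋀^Fin k]→L[ℝ] L}
    (h : α = ⟨k, η⟩) (x : Fin α.1 → W) :
    α.2 x = η fun j => x (Fin.cast (congrArg Sigma.fst h).symm j) := by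
  subst h; rfl

/-- The value of `⟨F_1, …, F_n⟩` with the two-forms in consecutive arguments. -/
def twoFormValues {n : ℕ} (F : W [⋀^Fin 2]→L[ℝ] L) (z : Fin (2 * n) → W) : Fin n → L :=
  fun i => F ![z ⟨2 * i, by omega⟩, z ⟨2 * i + 1, by omega⟩]

/-- A vertical vector has zero horizontal part, so the pulled-back curvature factor that receives it
vanishes. This is the annihilation hypothesis of the block sums. -/
theorem exists_twoFormValues_eq_zero {n : ℕ} (F : W [⋀^Fin 2]→L[ℝ] L) {z : Fin (2 * n) → W}
    {k : Fin (2 * n)} (hz : z k = 0) : ∃ i, twoFormValues F z i = 0 := by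
  refine ⟨⟨k / 2, by omega⟩, ?_⟩
  rcases Nat.mod_two_eq_zero_or_one k with h | h
  · refine F.map_coord_zero 0 ?_
    rw [← hz]
    change z _ = z _
    congr 1
    ext
    change 2 * (k.1 / 2) = k
    omega
  · refine F.map_coord_zero 1 ?_
    rw [← hz]
    change z _ = z _
    congr 1
    ext
    change 2 * (k.1 / 2) + 1 = k
    omega

theorem wedgePairing_transgressionFactors_apply {n : ℕ} (f : L [×(n + 1)]→L[ℝ] V)
    (Θ : W [⋀^Fin 1]→L[ℝ] L) (F : W [⋀^Fin 2]→L[ℝ] L) (v : Fin (2 * n + 1) → W) :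
    wedgePairing f (transgressionFactors n Θ F) (sum_transgressionFactors n Θ F) v =
      ((2 : ℝ) ^ n)⁻¹ • ∑ σ : Equiv.Perm (Fin (2 * n + 1)), Equiv.Perm.sign σ •
        f (Fin.cons (Θ fun _ => v (σ 0)) (twoFormValues F fun i => v (σ i.succ))) := by
  have h0 : transgressionFactors n Θ F 0 = ⟨1, Θ⟩ := rfl
  have hs : ∀ i : Fin n, transgressionFactors n Θ F i.succ = ⟨2, F⟩ := fun i => rfl
  rw [wedgePairing_apply, Fin.prod_univ_succ]
  congr 1
  · simp [h0, hs]
  · refine Finset.sum_congr rfl fun σ _ => ?_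
    congr 2
    ext1 i
    refine Fin.cases ?_ (fun i => ?_) i
    · rw [HomForm.apply_of_eq h0, Fin.cons_zero]
      congr 1
      ext1 j
      fin_cases j
      congr 2
      exact Fin.ext (by simp [finSigmaFinEquiv_apply])
    · rw [HomForm.apply_of_eq (hs i), Fin.cons_succ, twoFormValues]
      congr 1
      rw [← fin_two_eta fun j => v (σ (Fin.cast (sum_transgressionFactors n Θ F)
        (finSigmaFinEquiv ⟨i.succ, Fin.cast (congrArg Sigma.fst (hs i)).symm j⟩)))]
      have hval : ∀ j : Fin 2, (finSigmaFinEquiv (n := fun i => (transgressionFactors n Θ F i).1)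
          ⟨i.succ, Fin.cast (congrArg Sigma.fst (hs i)).symm j⟩ : ℕ) = 2 * i + 1 + j := fun j => by
        rw [finSigmaFinEquiv_apply]
        simp [transgressionFactors, Fin.sum_univ_succ]
        ring
      have hidx : ∀ j : Fin 2, Fin.cast (sum_transgressionFactors n Θ F) (finSigmaFinEquiv
          ⟨i.succ, Fin.cast (congrArg Sigma.fst (hs i)).symm j⟩) =
          Fin.succ ⟨2 * i + j, by omega⟩ := fun j => Fin.ext ((hval j).trans (by simp; ring))
      simp only [hidx]
      rfl

theorem wedgePairing_boundaryFactors_apply {n : ℕ} (hn : 1 ≤ n + 1) (f : L [×(n + 2)]→L[ℝ] V)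
    (Θ Ξ : W [⋀^Fin 1]→L[ℝ] L) (F : W [⋀^Fin 2]→L[ℝ] L) (v : Fin (2 * (n + 1)) → W) :
    wedgePairing f (boundaryFactors (n + 1) Θ Ξ F) (sum_boundaryFactors hn Θ Ξ F) v =
      ((2 : ℝ) ^ n)⁻¹ • ∑ σ : Equiv.Perm (Fin (2 * n + 2)), Equiv.Perm.sign σ •
        f (Fin.cons (Θ fun _ => v (σ 0)) (Fin.cons (Ξ fun _ => v (σ 1))
          (twoFormValues F fun i => v (σ i.succ.succ)) : Fin (n + 1) → L)) := by
  have h0 : boundaryFactors (n + 1) Θ Ξ F 0 = ⟨1, Θ⟩ := rfl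
  have h1 : boundaryFactors (n + 1) Θ Ξ F (Fin.succ 0) = ⟨1, Ξ⟩ := rfl
  have hs : ∀ i : Fin n, boundaryFactors (n + 1) Θ Ξ F i.succ.succ = ⟨2, F⟩ := fun i => rfl
  rw [wedgePairing_apply, Fin.prod_univ_succ, Fin.prod_univ_succ]
  congr 1
  · rw [h0, h1]
    simp [hs]
  · refine Finset.sum_congr rfl fun σ _ => ?_
    congr 2
    ext1 i
    refine Fin.cases ?_ (fun i => Fin.cases ?_ (fun i => ?_) i) i
    · rw [HomForm.apply_of_eq h0, Fin.cons_zero]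
      congr 1
      ext1 j
      fin_cases j
      congr 2
      exact Fin.ext (by simp [finSigmaFinEquiv_apply])
    · rw [HomForm.apply_of_eq h1, Fin.cons_succ, Fin.cons_zero]
      congr 1
      ext1 j
      fin_cases j
      congr 2
      have hval : (finSigmaFinEquiv (n := fun i => (boundaryFactors (n + 1) Θ Ξ F i).1)
          ⟨Fin.succ 0, Fin.cast (congrArg Sigma.fst h1).symm 0⟩ : ℕ) = 1 := by
        rw [finSigmaFinEquiv_apply]
        change ∑ i : Fin 1, _ + _ = 1
        rw [Fin.sum_univ_succ, Finset.univ_eq_empty, Finset.sum_empty]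
        rfl
      exact Fin.ext (hval.trans (Fin.val_one _).symm)
    · rw [HomForm.apply_of_eq (hs i), Fin.cons_succ, Fin.cons_succ, twoFormValues]
      congr 1
      rw [← fin_two_eta fun j => v (σ (Fin.cast (sum_boundaryFactors hn Θ Ξ F)
        (finSigmaFinEquiv ⟨i.succ.succ, Fin.cast (congrArg Sigma.fst (hs i)).symm j⟩)))]
      have hval : ∀ j : Fin 2, (finSigmaFinEquiv
          (n := fun i => (boundaryFactors (n + 1) Θ Ξ F i).1)
          ⟨i.succ.succ, Fin.cast (congrArg Sigma.fst (hs i)).symm j⟩ : ℕ) =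
            2 * i + 2 + j := fun j => by
        rw [finSigmaFinEquiv_apply]
        simp [boundaryFactors, Fin.sum_univ_succ]
        ring
      have hidx : ∀ j : Fin 2, Fin.cast (sum_boundaryFactors hn Θ Ξ F) (finSigmaFinEquiv
          ⟨i.succ.succ, Fin.cast (congrArg Sigma.fst (hs i)).symm j⟩) =
          Fin.succ (Fin.succ (⟨2 * i + j, by omega⟩ : Fin (2 * n))) := fun j =>
        Fin.ext ((hval j).trans (by simp; ring))
      simp only [hidx]
      rfl

variable {m : ℕ}

theorem dtForm_vertical (b : Fin (m + 1) → E [⋀^Fin 1]→L[ℝ] L) (u : Fin (m + 1) → ℝ) (e : E) :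
    dtForm b ![((0 : E), u), (e, 0)] = (∑ i, u i • b i) fun _ => e := by
  rw [dtForm_apply]
  simp [ContinuousAlternatingMap.sum_apply]

/-- Insertion of one vertical vector into `⟨B F^n⟩`. -/
theorem insertCLM_pairingComponent_one {n : ℕ} {f : L [×(n + 1)]→L[ℝ] V}
    (hf : IsSymmetricTensor f) (F : E [⋀^Fin 2]→L[ℝ] L) (b : Fin (m + 1) → E [⋀^Fin 1]→L[ℝ] L)
    (h : 2 * n + 1 + 1 = 2 * n + 2) (u : Fin 1 → Fin (m + 1) → ℝ) :
    insertCLM h (fun i => ((0 : E), u i)) (ContinuousLinearMap.inl ℝ E (Fin (m + 1) → ℝ))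
      (pairingComponent f (F.compContinuousLinearMap
        (ContinuousLinearMap.fst ℝ E (Fin (m + 1) → ℝ))) (dtForm b) 1) =
      ((n : ℝ) + 1) • wedgePairing f (transgressionFactors n (∑ i, u 0 i • b i) F)
        (sum_transgressionFactors n _ _) := by
  set F' := F.compContinuousLinearMap (ContinuousLinearMap.fst ℝ E (Fin (m + 1) → ℝ)) with hF'
  ext v
  rw [insertCLM_apply, pairingComponent_eq_smul hf F' _ (Finset.card_singleton 0),
    ContinuousAlternatingMap.smul_apply, ContinuousAlternatingMap.smul_apply,
    wedgePairing_twoForms_apply, wedgePairing_transgressionFactors_apply]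
  set w : Fin (2 * n + 1) → E × (Fin (m + 1) → ℝ) := fun i => (v i, 0) with hw
  have hv : headTail h (fun i => ((0 : E), u i)) (fun i =>
      ContinuousLinearMap.inl ℝ E (Fin (m + 1) → ℝ) (v i)) =
      (Fin.cons ((0 : E), u 0) w : Fin (2 * n + 2) → E × (Fin (m + 1) → ℝ)) := by
    exact headTail_succ _ _
  have hsum := sum_sign_smul_cons_block (k := 2 * n) (fun y y' => dtForm b ![y, y'])
    (fun y y' => twoForm_swap _ _ _)
    (fun a z => f (Fin.cons a (twoFormValues F fun i => (z i).1) : Fin (n + 1) → L))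
    (fun a z => by simpa using f.cons_smul (twoFormValues F fun i => (z i).1) (-1) a) ((0 : E), u 0)
    (fun a z i hz => by
      obtain ⟨j, hj⟩ := exists_twoFormValues_eq_zero F (z := fun i => (z i).1) (k := i)
        (by simp [hz])
      exact f.map_coord_zero j.succ (by simpa using hj)) w
  have hg : ∀ y : Fin (2 * n + 2) → E × (Fin (m + 1) → ℝ),
      (f fun i => (({0} : Finset (Fin (n + 1))).piecewise (fun _ => dtForm b) fun _ => F') i
        ![y (twoFormIndex (sum_two_eq n) i 0), y (twoFormIndex (sum_two_eq n) i 1)]) =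
      f (Fin.cons (dtForm b ![y 0, y 1]) (twoFormValues F fun i => (y i.succ.succ).1) :
        Fin (n + 1) → L) := by
    intro y
    congr 1
    ext1 i
    refine Fin.cases ?_ (fun i => ?_) i
    · rw [Finset.piecewise_eq_of_mem _ _ _ (Finset.mem_singleton_self 0), Fin.cons_zero]
      congr 3
      · exact Fin.ext (by simp [twoFormIndex_val])
      · congr 2
        exact Fin.ext (by simp [twoFormIndex_val])
    · rw [Finset.piecewise_eq_of_notMem _ _ _ (by simp), Fin.cons_succ, twoFormValues, hF',
        ContinuousAlternatingMap.compContinuousLinearMap_apply]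
      congr 1
      ext1 j
      have hidx : ∀ j, twoFormIndex (sum_two_eq n) i.succ j =
          Fin.succ (Fin.succ (⟨2 * i + j, by omega⟩ : Fin (2 * n))) := fun j =>
        Fin.ext (by simp [twoFormIndex_val]; ring)
      fin_cases j <;> simp [hidx]
  rw [hv]
  simp only [hg]
  refine (congrArg (fun x => (((n + 1).choose 1 : ℕ) : ℝ) • ((2 : ℝ) ^ (n + 1))⁻¹ • x)
    hsum).trans ?_
  simp only [hw, dtForm_vertical]
  rw [← Nat.cast_smul_eq_nsmul ℝ, smul_smul, smul_smul, smul_smul]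
  congr 1
  -- The constants: `(n + 1) · 2 / 2 ^ (n + 1) = (n + 1) / 2 ^ n`.
  rw [Nat.choose_one_right, pow_succ]
  push_cast
  field_simp

/-- Insertion of two vertical vectors into `⟨B B F^{n-1}⟩`. -/
theorem insertCLM_pairingComponent_two {n : ℕ} (hn : 1 ≤ n) {f : L [×(n + 1)]→L[ℝ] V}
    (hf : IsSymmetricTensor f) (F : E [⋀^Fin 2]→L[ℝ] L) (b : Fin (m + 1) → E [⋀^Fin 1]→L[ℝ] L)
    (h : 2 * n + 2 = 2 * n + 2) (u : Fin 2 → Fin (m + 1) → ℝ) :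
    insertCLM h (fun i => ((0 : E), u i)) (ContinuousLinearMap.inl ℝ E (Fin (m + 1) → ℝ))
      (pairingComponent f (F.compContinuousLinearMap
        (ContinuousLinearMap.fst ℝ E (Fin (m + 1) → ℝ))) (dtForm b) 2) =
      ((n : ℝ) * ((n : ℝ) + 1)) • wedgePairing f
        (boundaryFactors n (∑ i, u 1 i • b i) (∑ i, u 0 i • b i) F)
        (sum_boundaryFactors hn _ _ _) := by
  obtain ⟨n, rfl⟩ : ∃ k, n = k + 1 := ⟨n - 1, by omega⟩
  set F' := F.compContinuousLinearMap (ContinuousLinearMap.fst ℝ E (Fin (m + 1) → ℝ)) with hF'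
  have hcard : ({0, Fin.succ 0} : Finset (Fin (n + 2))).card = 2 :=
    Finset.card_pair (Fin.succ_ne_zero _).symm
  ext v
  rw [insertCLM_apply, pairingComponent_eq_smul hf F' _ hcard,
    ContinuousAlternatingMap.smul_apply, ContinuousAlternatingMap.smul_apply,
    wedgePairing_twoForms_apply, wedgePairing_boundaryFactors_apply hn]
  set w : Fin (2 * n + 2) → E × (Fin (m + 1) → ℝ) := fun i => (v i, 0) with hw
  have hv : headTail h (fun i => ((0 : E), u i)) (fun i =>
      ContinuousLinearMap.inl ℝ E (Fin (m + 1) → ℝ) (v i)) =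
      (Fin.cons ((0 : E), u 0) (Fin.cons ((0 : E), u 1) w : Fin (2 * n + 3) → _) :
        Fin (2 * n + 4) → E × (Fin (m + 1) → ℝ)) := by
    refine (headTail_succ _ _).trans (congrArg _ ?_)
    exact headTail_succ _ _
  have hneg : ∀ (a b : L) (z : Fin (2 * n) → E × (Fin (m + 1) → ℝ)),
      f (Fin.cons (-a) (Fin.cons b (twoFormValues F fun i => (z i).1) : Fin (n + 1) → L)) =
      -f (Fin.cons a (Fin.cons b (twoFormValues F fun i => (z i).1) : Fin (n + 1) → L)) :=
    fun a b z => by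
      simpa using f.cons_smul (Fin.cons b (twoFormValues F fun i => (z i).1)) (-1) a
  have hzero : ∀ (a b : L) (z : Fin (2 * n) → E × (Fin (m + 1) → ℝ)) (i : Fin (2 * n)),
      (z i).1 = 0 →
      f (Fin.cons a (Fin.cons b (twoFormValues F fun i => (z i).1) : Fin (n + 1) → L)) = 0 :=
    fun a b z i hz => by
      obtain ⟨j, hj⟩ := exists_twoFormValues_eq_zero F (z := fun i => (z i).1) (k := i) hz
      exact f.map_coord_zero j.succ.succ (by simpa using hj)
  have hsum := sum_sign_smul_cons_cons_block (k := 2 * n) (fun y y' => dtForm b ![y, y'])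
    (fun y y' => twoForm_swap _ _ _)
    (fun a b z => f (Fin.cons a (Fin.cons b (twoFormValues F fun i => (z i).1) :
      Fin (n + 1) → L))) hneg (fun a b z => hf.cons_cons_swap _ _ _)
    (fun b z => f.map_coord_zero 0 rfl) ((0 : E), u 0) ((0 : E), u 1)
    (by simp [dtForm_apply, ContinuousAlternatingMap.map_coord_zero _ (0 : Fin 1)])
    (fun a b z i hz => hzero a b z i (by rw [hz])) (fun a b z i hz => hzero a b z i (by rw [hz]))
    w (fun i j => by simp [dtForm_apply, hw])
  have hg : ∀ y : Fin (2 * n + 4) → E × (Fin (m + 1) → ℝ),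
      (f fun i => (({0, Fin.succ 0} : Finset (Fin (n + 2))).piecewise
        (fun _ => dtForm b) fun _ => F') i
        ![y (twoFormIndex (sum_two_eq (n + 1)) i 0), y (twoFormIndex (sum_two_eq (n + 1)) i 1)]) =
      f (Fin.cons (dtForm b ![y 0, y 1]) (Fin.cons (dtForm b ![y 2, y 3])
        (twoFormValues F fun i => (y i.succ.succ.succ.succ).1) : Fin (n + 1) → L)) := by
    intro y
    congr 1
    ext1 i
    refine Fin.cases ?_ (fun i => Fin.cases ?_ (fun i => ?_) i) i
    · rw [Finset.piecewise_eq_of_mem _ _ _ (by simp), Fin.cons_zero]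
      congr 3
      · exact Fin.ext (by simp [twoFormIndex_val])
      · congr 2
        exact Fin.ext (by simp [twoFormIndex_val])
    · rw [Finset.piecewise_eq_of_mem _ _ _ (by simp), Fin.cons_succ, Fin.cons_zero]
      congr 3
      · exact Fin.ext (by rw [twoFormIndex_val]; rfl)
      · congr 2
        exact Fin.ext (by rw [twoFormIndex_val]; rfl)
    · rw [Finset.piecewise_eq_of_notMem, Fin.cons_succ, Fin.cons_succ, twoFormValues, hF',
        ContinuousAlternatingMap.compContinuousLinearMap_apply]
      · congr 1
        ext1 j
        have hidx : ∀ j, twoFormIndex (sum_two_eq (n + 1)) i.succ.succ j =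
            Fin.succ (Fin.succ (Fin.succ (Fin.succ (⟨2 * i + j, by omega⟩ : Fin (2 * n))))) :=
          fun j => Fin.ext (by simp [twoFormIndex_val]; ring)
        fin_cases j <;> simp [hidx]
      · simp only [Finset.mem_insert, Finset.mem_singleton, not_or]
        exact ⟨Fin.succ_ne_zero _, fun h => Fin.succ_ne_zero i (Fin.succ_injective _ h)⟩
  rw [hv]
  simp only [hg]
  refine (congrArg (fun x => (((n + 1 + 1).choose 2 : ℕ) : ℝ) • ((2 : ℝ) ^ (n + 1 + 1))⁻¹ • x)
    hsum).trans ?_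
  simp only [hw, dtForm_vertical]
  rw [← Nat.cast_smul_eq_nsmul ℝ, smul_smul, smul_smul, smul_smul]
  congr 1
  -- The constants, with `n` already shifted by one: `choose (n + 2) 2 · 8 / 2 ^ (n + 2) = (n + 1)
  -- (n + 2) / 2 ^ n`.
  rw [Nat.cast_choose_two, pow_succ, pow_succ]
  push_cast
  field_simp
  ring

end Symmetry

/-! ### Integrals over simplices of dimension at most two, and the triangle identity. -/

section LowDegree

open MeasureTheory Set

variable {W E H M L V : Type*} [NormedAddCommGroup W] [NormedSpace ℝ W]
  [NormedAddCommGroup E] [NormedSpace ℝ E]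
  [NormedLieRing L] [NormedLieAlgebra L] [NormedAddCommGroup V] [NormedSpace ℝ V]

theorem setIntegral_coordSimplex_zero [CompleteSpace V] (h : (Fin 0 → ℝ) → V) :
    ∫ τ in coordSimplex 0, h τ = h 0 := by
  have h1 : coordSimplex 0 = univ := by
    ext τ
    simp [coordSimplex]
  rw [h1, setIntegral_univ, integral_unique]
  simp [Measure.real, volume_pi]
  congr 1

theorem setIntegral_coordSimplex_one [CompleteSpace V] {h : (Fin 1 → ℝ) → V} (hh : Continuous h) :
    ∫ τ in coordSimplex 1, h τ = ∫ t in (0 : ℝ)..1, h fun _ => t := by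
  rw [setIntegral_coordSimplex_succ 0 hh, setIntegral_coordSimplex_zero]
  simp only [Finset.univ_eq_empty, Finset.sum_empty, sub_zero]
  congr 1
  ext1 t
  congr 1
  ext1 i
  fin_cases i
  rfl

/-- The coordinates are `t = τ₁ + τ₂` and `s = τ₂`. They are reached by the volume-preserving
reflection, Fubini, and finally the substitution `t ↦ 1 - t`. -/
theorem setIntegral_coordSimplex_two [CompleteSpace V] {h : (Fin 2 → ℝ) → V} (hh : Continuous h) :
    ∫ τ in coordSimplex 2, h τ = ∫ t in (0 : ℝ)..1, ∫ s in (0 : ℝ)..t, h ![t - s, s] := by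
  have hr : Continuous fun τ => h (simplexReflection (0 : Fin 2) τ) :=
    hh.comp (continuous_id.update 0
      (continuous_const.sub (continuous_finsetSum _ fun i _ => continuous_apply i)))
  have hi : ∀ τ : Fin 1 → ℝ, ∫ s in (0 : ℝ)..(1 - ∑ i, τ i),
      h (simplexReflection 0 ((1 : Fin 2).insertNth s τ)) =
      ∫ s in (0 : ℝ)..(1 - τ 0), h ![1 - τ 0 - s, s] := by
    intro τ
    rw [Fin.sum_univ_one]
    congr 1
    ext1 s
    congr 1
    ext1 i
    fin_cases i
    · simp [simplexReflection]
      ring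
    · simp [simplexReflection]
  have hcont : Continuous fun τ : Fin 1 → ℝ =>
      ∫ s in (0 : ℝ)..(1 - τ 0), h ![1 - τ 0 - s, s] := by
    refine intervalIntegral.continuous_parametric_intervalIntegral_of_continuous
      (f := fun (τ : Fin 1 → ℝ) s => h ![1 - τ 0 - s, s]) (hh.comp ?_) (by fun_prop)
    refine continuous_pi fun i => ?_
    fin_cases i
    · exact (continuous_const.sub ((continuous_apply 0).comp continuous_fst)).sub continuous_snd
    · exact continuous_snd
  rw [← setIntegral_coordSimplex_comp_simplexReflection 0, setIntegral_coordSimplex_succ 1 hr]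
  simp only [hi]
  rw [setIntegral_coordSimplex_one hcont]
  have := intervalIntegral.integral_comp_sub_left (a := 0) (b := 1)
    (fun t : ℝ => ∫ s in (0 : ℝ)..t, h ![t - s, s]) 1
  simpa using this

/-- Exchanging the two one-form arguments changes the sign of the permutation but not the symmetric
value, so the sum equals its own negative. -/
theorem wedgePairing_boundaryFactors_self {n : ℕ} (hn : 1 ≤ n + 1) {f : L [×(n + 2)]→L[ℝ] V}
    (hf : IsSymmetricTensor f) (Θ : W [⋀^Fin 1]→L[ℝ] L) (F : W [⋀^Fin 2]→L[ℝ] L) :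
    wedgePairing f (boundaryFactors (n + 1) Θ Θ F) (sum_boundaryFactors hn Θ Θ F) = 0 := by
  ext v
  rw [wedgePairing_boundaryFactors_apply hn]
  have hself : ∀ x : V, x = -x → x = 0 := fun x hx =>
    (smul_eq_zero_iff_right (two_ne_zero (α := ℝ))).1 (by
      rw [two_smul]; nth_rewrite 1 [hx]; exact neg_add_cancel x)
  refine (congrArg _ (hself _ ?_)).trans (smul_zero _)
  rw [← Finset.sum_neg_distrib]
  refine Fintype.sum_equiv (Equiv.mulRight (Equiv.swap 0 1)) _ _ fun e => ?_
  have hne : (0 : Fin (2 * n + 2)) ≠ 1 := Fin.zero_ne_one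
  have hi : ∀ i : Fin (2 * n), Equiv.swap (0 : Fin (2 * n + 2)) 1 i.succ.succ = i.succ.succ :=
    fun i => Equiv.swap_apply_of_ne_of_ne (Fin.succ_ne_zero _)
      fun h => Fin.succ_ne_zero i (Fin.succ_injective _ h)
  simp only [Equiv.coe_mulRight, Equiv.Perm.sign_mul, Equiv.Perm.sign_swap hne,
    Equiv.Perm.mul_apply, Equiv.swap_apply_left, Equiv.swap_apply_right, hi, mul_neg, mul_one,
    Units.neg_smul, neg_neg]
  rw [hf.cons_cons_swap]

theorem wedgePairing_boundaryFactors_add_self {n : ℕ} (hn : 1 ≤ n) {f : L [×(n + 1)]→L[ℝ] V}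
    (hf : IsSymmetricTensor f) (Θ Ξ : W [⋀^Fin 1]→L[ℝ] L) (F : W [⋀^Fin 2]→L[ℝ] L) :
    wedgePairing f (boundaryFactors n (Θ + Ξ) Ξ F) (sum_boundaryFactors hn _ Ξ F) =
      wedgePairing f (boundaryFactors n Θ Ξ F) (sum_boundaryFactors hn Θ Ξ F) := by
  obtain ⟨n, rfl⟩ : ∃ k, n = k + 1 := ⟨n - 1, by omega⟩
  ext v
  have h0 := congrArg (fun Ω => Ω v) (wedgePairing_boundaryFactors_self hn hf Ξ F)
  rw [wedgePairing_boundaryFactors_apply hn] at h0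
  rw [wedgePairing_boundaryFactors_apply hn, wedgePairing_boundaryFactors_apply hn]
  simp only [ContinuousAlternatingMap.add_apply, f.cons_add, smul_add, Finset.sum_add_distrib]
  exact (congrArg _ h0).trans (add_zero _)

theorem simplexConnection_apply {m : ℕ} (A : Fin (m + 1) → DForm E M 1 L) (t : Fin (m + 1) → ℝ)
    (x : M) : simplexConnection A t x = ∑ i, t i • A i x := by
  simp [simplexConnection]

theorem simplexConnection_stdVertices {m : ℕ} (A : Fin (m + 1) → DForm E M 1 L) (i : Fin (m + 1)) :
    simplexConnection A (stdVertices m i) = A i := by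
  simp [simplexConnection, stdVertices, Pi.single_apply]

theorem simplexConnection_add {m : ℕ} (A : Fin (m + 1) → DForm E M 1 L) (t t' : Fin (m + 1) → ℝ) :
    simplexConnection A (t + t') = simplexConnection A t + simplexConnection A t' := by
  simp [simplexConnection, add_smul, Finset.sum_add_distrib]

theorem simplexConnection_sub {m : ℕ} (A : Fin (m + 1) → DForm E M 1 L) (t t' : Fin (m + 1) → ℝ) :
    simplexConnection A (t - t') = simplexConnection A t - simplexConnection A t' := by
  simp [simplexConnection, sub_smul, Finset.sum_sub_distrib]

theorem simplexConnection_smul {m : ℕ} (A : Fin (m + 1) → DForm E M 1 L) (c : ℝ)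
    (t : Fin (m + 1) → ℝ) : simplexConnection A (c • t) = c • simplexConnection A t := by
  simp [simplexConnection, Finset.smul_sum, smul_smul]

variable [TopologicalSpace H] {I : ModelWithCorners ℝ E H} [TopologicalSpace M] [ChartedSpace H M]

variable [IsManifold I ∞ M]

theorem continuous_integrand {m n b q : ℕ} (h : b + q = 2 * n + 2) (f : L [×(n + 1)]→L[ℝ] V)
    {A : Fin (m + 1) → DForm E M 1 L} (hA : ∀ i, IsSmoothForm I (A i))
    (w : Fin (q + 1) → Fin (m + 1) → ℝ) (p : ℕ) (x : M) :
    Continuous fun τ => insertCLM h (fun i => ((0 : E), w i.succ - w 0))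
      (ContinuousLinearMap.inl ℝ E (Fin (m + 1) → ℝ))
      (pairingComponent f ((curvature I (simplexConnection A
        (simplexPoint w τ)) x).compContinuousLinearMap
          (ContinuousLinearMap.fst ℝ E (Fin (m + 1) → ℝ))) (dtForm fun i => A i x) p) :=
  continuous_insertCLM_pairingComponent h (fun i => w i.succ - w 0) f (dtForm fun i => A i x) p
    ((continuous_curvature_simplexConnection hA x).comp (continuous_simplexPoint w))

variable [CompleteSpace V]

theorem integrateSimplex_homotopyPower_one {m n : ℕ} {f : L [×(n + 1)]→L[ℝ] V}
    (hf : IsSymmetricTensor f) {A : Fin (m + 1) → DForm E M 1 L} (hA : ∀ i, IsSmoothForm I (A i))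
    (w : Fin 2 → Fin (m + 1) → ℝ) (h : 2 * n + 1 + 1 = 2 * n + 2) :
    integrateSimplex h w (homotopyPower I f A 1) =
      transgression I f (simplexConnection A (w 1)) (simplexConnection A (w 0)) := by
  ext1 x
  rw [integrateSimplex_homotopyPower,
    setIntegral_coordSimplex_one (continuous_integrand h f hA w 1 x),
    transgression, ← intervalIntegral.integral_smul]
  congr 1
  ext1 t
  rw [insertCLM_pairingComponent_one hf _ _ h fun i => w i.succ - w 0]
  congr 1
  refine wedgePairing_congr f ?_ _
  congr 1
  · exact (simplexConnection_apply A _ x).symm.trans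
      (congrFun (simplexConnection_sub A (w 1) (w 0)) x)
  · congr 1
    rw [simplexPoint, Fin.sum_univ_one, simplexConnection_add, simplexConnection_smul,
      simplexConnection_sub]
    rfl

theorem integrateSimplex_homotopyPower_two {m n : ℕ} (hn : 1 ≤ n) {f : L [×(n + 1)]→L[ℝ] V}
    (hf : IsSymmetricTensor f) {A : Fin (m + 1) → DForm E M 1 L} (hA : ∀ i, IsSmoothForm I (A i))
    (w : Fin 3 → Fin (m + 1) → ℝ) (h : 2 * n + 2 = 2 * n + 2) :
    integrateSimplex h w (homotopyPower I f A 2) =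
      transgressionBoundary I hn f (simplexConnection A (w 2)) (simplexConnection A (w 1))
        (simplexConnection A (w 0)) := by
  ext1 x
  rw [integrateSimplex_homotopyPower,
    setIntegral_coordSimplex_two (continuous_integrand h f hA w 2 x),
    transgressionBoundary, ← intervalIntegral.integral_smul]
  congr 1
  ext1 t
  rw [← intervalIntegral.integral_smul]
  congr 1
  ext1 s
  rw [insertCLM_pairingComponent_two hn hf _ _ h fun i => w i.succ - w 0]
  congr 1
  -- The second edge at `w 0` is `A₂ - A₀`; it is split so that its `A₁ - A₀` part dies against the
  -- other factor.
  have h1 : ∑ i, (w (Fin.succ 1) - w 0) i • A i x = (simplexConnection A (w 2) x -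
      simplexConnection A (w 1) x) + (simplexConnection A (w 1) x - simplexConnection A (w 0) x) :=
    (simplexConnection_apply A _ x).symm.trans
      ((congrFun (simplexConnection_sub A (w 2) (w 0)) x).trans (sub_add_sub_cancel _ _ _).symm)
  have h2 : ∑ i, (w (Fin.succ 0) - w 0) i • A i x = simplexConnection A (w 1) x -
      simplexConnection A (w 0) x :=
    (simplexConnection_apply A _ x).symm.trans
      (congrFun (simplexConnection_sub A (w 1) (w 0)) x)
  -- Barycentric weights `t - s` and `s` at the second and third vertices are the parameters `s`,
  -- `t` of `F_{st}`.
  have h3 : simplexConnection A (simplexPoint w ![t - s, s]) = simplexConnection A (w 0) +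
      s • (simplexConnection A (w 2) - simplexConnection A (w 1)) +
      t • (simplexConnection A (w 1) - simplexConnection A (w 0)) := by
    rw [simplexPoint, Fin.sum_univ_two, simplexConnection_add, simplexConnection_add,
      simplexConnection_smul, simplexConnection_smul, simplexConnection_sub, simplexConnection_sub]
    change simplexConnection A (w 0) + ((t - s) • (simplexConnection A (w 1) -
      simplexConnection A (w 0)) + s • (simplexConnection A (w 2) - simplexConnection A (w 0))) = _
    module
  refine Eq.trans ?_ (wedgePairing_boundaryFactors_add_self hn hf _ _ _)
  refine wedgePairing_congr f ?_ _
  rw [h1, h2, h3]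

theorem triangle_identity {n : ℕ} (hn : 1 ≤ n) {f : L [×(n + 1)]→L[ℝ] V}
    (hsymm : IsSymmetricTensor f) (hinv : IsInvariantTensor f) {A : Fin 3 → DForm E M 1 L}
    (hA : ∀ i, IsSmoothForm I (A i)) :
    transgression I f (A 2) (A 0) = transgression I f (A 2) (A 1) + transgression I f (A 1) (A 0) +
      extD I (transgressionBoundary I hn f (A 2) (A 1) (A 0)) := by
  have h := cartan_homotopy_formula (p := 1) (b := 2 * n) hinv hA (stdVertices 2) rfl rfl
  rw [Fin.sum_univ_three, integrateSimplex_homotopyPower_two hn hsymm hA,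
    integrateSimplex_homotopyPower_one hsymm hA, integrateSimplex_homotopyPower_one hsymm hA,
    integrateSimplex_homotopyPower_one hsymm hA] at h
  simp only [simplexConnection_stdVertices] at h
  -- The faces `(A₁ A₂)`, `(A₀ A₂)`, `(A₀ A₁)` carry the signs `+`, `-`, `+`, and the right side has
  -- the sign `(-1) ^ 1`.
  have h' : transgression I f (A 2) (A 1) - transgression I f (A 2) (A 0) +
      transgression I f (A 1) (A 0) =
      -extD I (transgressionBoundary I hn f (A 2) (A 1) (A 0)) := by
    refine Eq.trans ?_ (h.trans (by simp))
    simp [sub_eq_add_neg]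
    rfl
  rw [eq_neg_iff_add_eq_zero] at h'
  rw [← sub_eq_zero, ← neg_eq_zero, ← h']
  abel

end LowDegree

/-! ### Vanishing beyond the number of factors, and assembly. -/

section Main

variable {E H M L V : Type*} [NormedAddCommGroup E] [NormedSpace ℝ E]
  [NormedLieRing L] [NormedLieAlgebra L] [NormedAddCommGroup V] [NormedSpace ℝ V]

theorem integrateSimplex_zero {m N b q : ℕ} (h : b + q = N) (w : Fin (q + 1) → Fin (m + 1) → ℝ) :
    integrateSimplex h w (0 : ProdForm E M m N V) = 0 := by
  ext1 x
  have h0 : integrateSimplex h w (0 : ProdForm E M m N V) x =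
      ∫ _τ in coordSimplex q, insertCLM h (fun i => ((0 : E), w i.succ - w 0))
        (ContinuousLinearMap.inl ℝ E (Fin (m + 1) → ℝ)) (0 : _ [⋀^Fin N]→L[ℝ] V) := rfl
  rw [h0, map_zero, MeasureTheory.integral_zero]
  rfl

variable [TopologicalSpace H] {I : ModelWithCorners ℝ E H} [TopologicalSpace M] [ChartedSpace H M]

/-- There are only `n + 1` factors in which `F_t` can be replaced. -/
theorem homotopyPower_eq_zero {m n p : ℕ} (hp : n + 1 < p) (f : L [×(n + 1)]→L[ℝ] V)
    (A : Fin (m + 1) → DForm E M 1 L) : homotopyPower I f A p = 0 := by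
  ext1 t
  ext1 x
  rw [homotopyPower_eq, pairingComponent, Finset.powersetCard_eq_empty.2 (by simpa using hp),
    Finset.sum_empty]
  rfl

theorem integrateBoundaryT_homotopyPower_eq_zero {n p b : ℕ} (hp : n + 1 < p)
    (h : b + p = 2 * n + 2) (f : L [×(n + 1)]→L[ℝ] V) (A : Fin (p + 1 + 1) → DForm E M 1 L) :
    integrateBoundaryT h (homotopyPower I f A p) = 0 := by
  rw [homotopyPower_eq_zero hp]
  exact Finset.sum_eq_zero fun j _ => by rw [integrateSimplex_zero, smul_zero]

variable [IsManifold I ∞ M] [CompleteSpace V]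

theorem integrateT_homotopyPower_two {n : ℕ} (hn : 1 ≤ n) {f : L [×(n + 1)]→L[ℝ] V}
    (hsymm : IsSymmetricTensor f) {A : Fin 3 → DForm E M 1 L} (hA : ∀ i, IsSmoothForm I (A i)) :
    integrateT (a := 2 * n) rfl (homotopyPower I f A 2) =
      transgressionBoundary I hn f (A 2) (A 1) (A 0) := by
  have h := integrateSimplex_homotopyPower_two hn hsymm hA (stdVertices 2) rfl
  simp only [simplexConnection_stdVertices] at h
  exact h

theorem integrateBoundaryT_homotopyPower {p n b : ℕ} {f : L [×(n + 1)]→L[ℝ] V}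
    (hinv : IsInvariantTensor f) {A : Fin (p + 1 + 1) → DForm E M 1 L}
    (hA : ∀ i, IsSmoothForm I (A i)) (h : b + (p + 1) = 2 * n + 2) (h' : b + 1 + p = 2 * n + 2) :
    integrateBoundaryT h' (homotopyPower I f A p) =
      (-1 : ℝ) ^ p • extD I (integrateT h (homotopyPower I f A (p + 1))) :=
  cartan_homotopy_formula hinv hA (stdVertices (p + 1)) h h'

end Main

end

theorem mainTheorem6 {E H M L V : Type*}
    [NormedAddCommGroup E] [NormedSpace ℝ E] [FiniteDimensional ℝ E]
    [TopologicalSpace H] (I : ModelWithCorners ℝ E H)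
    [TopologicalSpace M] [ChartedSpace H M] [IsManifold I ∞ M]
    [NormedLieRing L] [NormedLieAlgebra L]
    [NormedAddCommGroup V] [NormedSpace ℝ V] [CompleteSpace V]
    (n : ℕ) (f : L [×(n + 1)]→L[ℝ] V)
    (hsymm : IsSymmetricTensor f) (hinv : IsInvariantTensor f) :
    -- the triangle identity, with its explicit boundary term
    (∀ (hn : 1 ≤ n) (A₀ A₁ A₂ : DForm E M 1 L),
      IsSmoothForm I A₀ → IsSmoothForm I A₁ → IsSmoothForm I A₂ →
        transgression I f A₂ A₀ =
            transgression I f A₂ A₁ + transgression I f A₁ A₀ +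
              extD I (transgressionBoundary I hn f A₂ A₁ A₀) ∧
          integrateT rfl (homotopyPower I f ![A₀, A₁, A₂] 2) =
            transgressionBoundary I hn f A₂ A₁ A₀) ∧
    -- the restricted extended Cartan homotopy formula
    (∀ (p a : ℕ) (h : a + (p + 1) = 2 * n + 2) (A : Fin (p + 2) → DForm E M 1 L),
      (∀ i, IsSmoothForm I (A i)) →
        integrateBoundaryT (by omega) (homotopyPower I f A p) =
          (-1 : ℝ) ^ p • extD I (integrateT h (homotopyPower I f A (p + 1)))) ∧
    -- its extreme case `p = 2n + 2`, where the form on the right has degree `-1`, so is zero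
    (∀ A : Fin (2 * n + 2 + 2) → DForm E M 1 L, (∀ i, IsSmoothForm I (A i)) →
        integrateBoundaryT (a := 0) (by omega) (homotopyPower I f A (2 * n + 2)) = 0) := by
  refine ⟨fun hn A₀ A₁ A₂ h₀ h₁ h₂ => ?_, fun p a h A hA => ?_, fun A _ => ?_⟩
  · have hA : ∀ i, IsSmoothForm I (![A₀, A₁, A₂] i) := by
      intro i
      fin_cases i
      exacts [h₀, h₁, h₂]
    exact ⟨triangle_identity (A := ![A₀, A₁, A₂]) hn hsymm hinv hA,
      integrateT_homotopyPower_two (A := ![A₀, A₁, A₂]) hn hsymm hA⟩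
  · exact integrateBoundaryT_homotopyPower (p := p) (n := n) (b := a) hinv hA h (by omega)
  -- The extreme value `p = 2n + 2` exceeds the number `n + 1` of factors for every `n`, so the
  -- integrand itself vanishes.
  · exact integrateBoundaryT_homotopyPower_eq_zero (p := 2 * n + 2) (n := n) (b := 0) (by omega)
      (by omega) f A
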